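/- **Setting.** Let $X$ and $M$ be finite-dimensional second countable Hausdorff $C^\infty$ manifolds (for instance connected Riemannian manifolds). Let $\sigma$ be a nonatomic Radon measure on $X$ and $p(x,dm)$ an ($s$-finite) kernel from $X$ to $M$ such that the measure $\tilde\sigma(dx,dm)=p(x,dm)\,\sigma(dx)$ on $X\times M$ satisfies $\tilde\sigma(\Lambda\times M)<\infty$ for every Borel set $\Lambda\subset X$ with compact closure. Let $\Omega$ be the marked configuration space: the set of all $\omega\subset X\times M$ in which distinct points have distinct $X$-coordinates and whose projection to $X$ is locally finite, with the smallest $\sigma$-algebra that makes $\omega\mapsto\#(\omega\cap B)$ measurable for each Borel $B\subset X\times M$ whose projection to $X$ is Borel with compact closure. Let $\pi_{\tilde\sigma}$ be the marked Poisson measure with Lévy measure $\tilde\sigma$: the probability measure on $\Omega$ whose image under $\omega\mapsto\omega\cap(\Lambda\times M)$ is, for each open relatively compact $\Lambda\subset X$, $$e^{-\tilde\sigma(\Lambda\times M)}\sum_{n\ge0}\frac1{n!}\,(\tilde\sigma|_{\Lambda\times M})^{\otimes n}\circ\big[(z_1,\dots,z_n)\mapsto\{z_1,\dots,z_n\}\big]^{-1}.$$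 Let $\mathcal F=\bigoplus_{n\ge0}L^2(\tilde\sigma)^{\widehat\otimes n}\,n!$ be the (real) symmetric Fock space over $L^2(\tilde\sigma)$, with $\|(f^{(n)})\|^2=\sum_n n!\,|f^{(n)}|^2_{L^2(\tilde\sigma^{\otimes n})}$. Put $\mathfrak D_0=C_0^\infty(X\times M)$ and $\langle\varphi,\omega\rangle=\sum_{z\in\omega}\varphi(z)$, and let $I:\mathcal F\to L^2(\pi_{\tilde\sigma})$ be the unitary isomorphism with $I(\varphi^{\otimes n})=Q_n(\varphi^{\otimes n};\cdot)$ for $\varphi\in\mathfrak D_0$, where $Q_n(\,\cdot\,;\omega)$ is linear on the $n$-th symmetric algebraic tensor power of $\mathfrak D_0$, $Q_0(1;\omega)=1$ and $$Q_{n+1}(\varphi^{\otimes(n+1)};\omega)=Q_n(\varphi^{\otimes n};\omega)\Big(\langle\varphi,\omega\rangle-\int\varphi\,d\tilde\sigma\Big)-n\,Q_n(\varphi^{\otimes(n-1)}\widehat\otimes\varphi^2;\omega)-n\,Q_{n-1}(\varphi^{\otimes(n-1)};\omega)\int\varphi^2\,d\tilde\sigma .$$ For a contraction $B$ of $L^2(\tilde\sigma)$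 let $\operatorname{Exp}B$ be the operator on $\mathcal F$ that equals $B^{\otimes n}$ on the $n$-th summand (the identity for $n=0$). For a positive (i.e. nonnegative) self-adjoint operator $A$ on $L^2(\tilde\sigma)$ let $d\operatorname{Exp}A$ be the generator of the semigroup $\operatorname{Exp}(e^{-tA})$, $t\ge0$, i.e. $\operatorname{Exp}(e^{-tA})=\exp(-t\,d\operatorname{Exp}A)$, and let $H_A^{\mathrm{MP}}=I\,(d\operatorname{Exp}A)\,I^{-1}$ be its image in $L^2(\pi_{\tilde\sigma})$. Let $\mathcal{FP}$ be the set of polynomial cylinder functions $F(\omega)=g(\langle\varphi_1,\omega\rangle,\dots,\langle\varphi_N,\omega\rangle)$ with $g$ a real polynomial and $\varphi_1,\dots,\varphi_N\in\mathfrak D_0$. For $F\in\mathcal{FP}$ put $$(\nabla^{\mathrm{MP}}F)(\omega,(x,m))=F(\omega+\varepsilon_{(x,m)})-F(\omega),$$ where $\omega+\varepsilon_{(x,m)}=\omega\cup\{(x,m)\}$. For fixed $\omega$ this is defined for $\tilde\sigma$-almost all $(x,m)$, namely whenever no point of $\omega$ lies over $x$. **Theorem 6.1.** Let $A$ be a positive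 self-adjoint operator on $L^2(\tilde\sigma)$ with $\mathfrak D_0\subset\operatorname{Dom}A$. Then $\mathcal{FP}\subset L^2(\pi_{\tilde\sigma})$ and $\mathcal{FP}\subset\operatorname{Dom}H_A^{\mathrm{MP}}$; for each $F\in\mathcal{FP}$ and each $\omega\in\Omega$, $\nabla^{\mathrm{MP}}F(\omega,\cdot)$ is in $L^2(\tilde\sigma)$ and in $\operatorname{Dom}A$; and for all $F_1,F_2\in\mathcal{FP}$ the function $\omega\mapsto(\nabla^{\mathrm{MP}}F_1(\omega),A\nabla^{\mathrm{MP}}F_2(\omega))_{L^2(\tilde\sigma)}$ is $\pi_{\tilde\sigma}$-integrable and $$(H_A^{\mathrm{MP}}F_1,F_2)_{L^2(\pi_{\tilde\sigma})}=\int_\Omega(\nabla^{\mathrm{MP}}F_1(\omega),A\nabla^{\mathrm{MP}}F_2(\omega))_{L^2(\tilde\sigma)}\,\pi_{\tilde\sigma}(d\omega).$$ -/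

import Mathlib

open MeasureTheory ProbabilityTheory Filter Topology Set
open scoped NNReal ENNReal Manifold

noncomputable section

/-! ### Marked configurations -/

section Configurations

/-- The marked configuration space over `X` with marks in `M`: the subsets `ω` of `X × M` in which
distinct points have distinct `X`-coordinates and whose projection to `X` is locally finite. -/
def MarkedConfig (X M : Type*) [TopologicalSpace X] : Type _ :=
  {ω : Set (X × M) // InjOn Prod.fst ω ∧ ∀ K : Set X, IsCompact K → (Prod.fst '' ω ∩ K).Finite}

variable {X M : Type*} [TopologicalSpace X] [TopologicalSpace M]
  [MeasurableSpace X] [MeasurableSpace M]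

/-- Borel subsets of `X` with compact closure. -/
def IsBc (L : Set X) : Prop := MeasurableSet L ∧ IsCompact (closure L)

/-- Borel subsets of `X × M` whose projection to `X` is Borel with compact closure. -/
def IsBcMarked (B : Set (X × M)) : Prop := MeasurableSet B ∧ IsBc (Prod.fst '' B)

/-- The counting function `N_B(ω) = #(ω ∩ B)`. -/
def countIn (B : Set (X × M)) (ω : MarkedConfig X M) : ℕ := (ω.1 ∩ B).ncard

/-- The smallest σ-algebra making all the counting functions `N_B` measurable. -/
instance MarkedConfig.instMeasurableSpace : MeasurableSpace (MarkedConfig X M) :=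
  ⨆ (B : Set (X × M)) (_ : IsBcMarked B), MeasurableSpace.comap (countIn B) ⊤

/-- The empty configuration. -/
def MarkedConfig.empty : MarkedConfig X M := ⟨∅, by simp, by simp⟩

/-- The restriction `p_L(ω) = ω ∩ (L × M)`. -/
def MarkedConfig.restrict (L : Set X) (ω : MarkedConfig X M) : MarkedConfig X M :=
  ⟨ω.1 ∩ L ×ˢ univ, ω.2.1.mono inter_subset_left, fun K hK =>
    (ω.2.2 K hK).subset (inter_subset_inter_left _ (image_mono inter_subset_left))⟩

open Classical in
/-- The map `((x₁, m₁), …, (xₙ, mₙ)) ↦ {(x₁, m₁), …, (xₙ, mₙ)}` on tuples with pairwise distinct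
`X`-coordinates; the remaining tuples, which form a null set below, go to `∅`. -/
def MarkedConfig.ofTuple (n : ℕ) (z : Fin n → X × M) : MarkedConfig X M :=
  if h : Function.Injective (fun i => (z i).1) then
    ⟨range z, by
      rintro _ ⟨i, rfl⟩ _ ⟨j, rfl⟩ hij
      rw [h hij], fun _ _ => ((finite_range z).image _).inter_of_left _⟩
  else MarkedConfig.empty

open Classical in
/-- `ω + ε_{(x,m)}`, that is `ω ∪ {(x,m)}`, when no point of `ω` lies over `x`. For a fixed `ω` only
the points `(x,m)` with `x` in the countable projection of `ω` are left out, and there the value is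
taken to be `ω`. -/
def MarkedConfig.addPoint (ω : MarkedConfig X M) (z : X × M) : MarkedConfig X M :=
  if h : z.1 ∉ Prod.fst '' ω.1 then
    ⟨insert z ω.1, by
      have hz : z ∉ ω.1 := fun hz => h ⟨z, hz, rfl⟩
      exact (injOn_insert hz).2 ⟨ω.2.1, h⟩, fun K hK => by
      rw [image_insert_eq]
      refine ((ω.2.2 K hK).insert z.1).subset ?_
      rintro x ⟨hx | hx, hK'⟩
      · exact Or.inl hx
      · exact Or.inr ⟨hx, hK'⟩⟩
  else ω

/-- `⟨f, ω⟩ = ∑_{(x,m) ∈ ω} f(x,m)`, a finite sum when `f` has compact support. -/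
def pairing (f : X × M → ℝ) (ω : MarkedConfig X M) : ℝ := ∑ᶠ z ∈ ω.1, f z

/-- The finite-volume marked Poisson measure
`e^{-τ(L × M)} ∑ₙ (1/n!) (τ restricted to L × M)^{⊗ n} ∘ (tuple ↦ configuration)⁻¹`. -/
def poissonIn (τ : Measure (X × M)) (L : Set X) : Measure (MarkedConfig X M) :=
  ENNReal.ofReal (Real.exp (-(τ (L ×ˢ univ)).toReal)) •
    Measure.sum fun n : ℕ => ((n.factorial : ℝ≥0∞)⁻¹) •
      (Measure.pi fun _ : Fin n => τ.restrict (L ×ˢ univ)).map (MarkedConfig.ofTuple n)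

/-- `π` is the marked Poisson measure with Lévy measure `τ`: the probability measure on the marked
configuration space whose image under `ω ↦ ω ∩ (L × M)`, for each open relatively compact `L`,
is the finite-volume marked Poisson measure. -/
def IsMarkedPoisson (τ : Measure (X × M)) (π : Measure (MarkedConfig X M)) : Prop :=
  IsProbabilityMeasure π ∧ ∀ L : Set X, IsOpen L → IsCompact (closure L) →
    π.map (MarkedConfig.restrict L) = poissonIn τ L

/-- The marked Poisson gradient `(∇F)(ω, (x,m)) = F(ω + ε_{(x,m)}) - F(ω)`. -/
def gradMP (F : MarkedConfig X M → ℝ) (ω : MarkedConfig X M) (z : X × M) : ℝ :=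
  F (ω.addPoint z) - F ω

/-- Polynomial cylinder functions
`F(ω) = g(⟨φ₁, ω⟩, …, ⟨φ_N, ω⟩)`, `g` a real polynomial and `φ₁, …, φ_N ∈ D`. -/
def PolyCylinder (D : Set (X × M → ℝ)) : Set (MarkedConfig X M → ℝ) :=
  {F | ∃ (N : ℕ) (φ : Fin N → X × M → ℝ) (g : MvPolynomial (Fin N) ℝ),
    (∀ i, φ i ∈ D) ∧ ∀ ω, F ω = MvPolynomial.eval (fun i => pairing (φ i) ω) g}

/-- The polynomials `Q_n(φ₀ ⊗̂ ⋯ ⊗̂ φₙ₋₁; ω)`, by the recursion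
`Q_{n+1}(φ₀ ⊗̂ ψ₁ ⊗̂ ⋯ ⊗̂ ψₙ) = Q_n(ψ₁ ⊗̂ ⋯ ⊗̂ ψₙ) (⟨ω, φ₀⟩ - ∫ φ₀ dτ)
  - ∑ᵢ Q_n(ψ₁ ⊗̂ ⋯ ⊗̂ φ₀ψᵢ ⊗̂ ⋯ ⊗̂ ψₙ) - ∑ᵢ (∫ φ₀ψᵢ dτ) Q_{n-1}(ψ₁ ⊗̂ ⋯ (without ψᵢ) ⋯ ⊗̂ ψₙ)`,
the polarized form of
`Q_{n+1}(φ^{⊗(n+1)}) = Q_n(φ^{⊗n}) (⟨ω, φ⟩ - ∫ φ dτ) - n Q_n(φ^{⊗(n-1)} ⊗̂ φ²)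
  - n (∫ φ² dτ) Q_{n-1}(φ^{⊗(n-1)})`. -/
def charlierQ (τ : Measure (X × M)) (ω : MarkedConfig X M) :
    (n : ℕ) → (Fin n → X × M → ℝ) → ℝ
  | 0, _ => 1
  | 1, φ => pairing (φ 0) ω - ∫ z, φ 0 z ∂τ
  | n + 2, φ =>
      let ψ : Fin (n + 1) → X × M → ℝ := Fin.tail φ
      charlierQ τ ω (n + 1) ψ * (pairing (φ 0) ω - ∫ z, φ 0 z ∂τ)
        - ∑ i, charlierQ τ ω (n + 1) (Function.update ψ i (fun z => φ 0 z * ψ i z))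
        - ∑ i, (∫ z, φ 0 z * ψ i z ∂τ) * charlierQ τ ω n (fun j => ψ (i.succAbove j))

end Configurations

/-- The set `C_0^∞(X × M)` of smooth compactly supported real functions on the product of a
`d`-dimensional and a `k`-dimensional smooth manifold. -/
def TestFun (d k : ℕ) (X M : Type*) [TopologicalSpace X] [TopologicalSpace M]
    [ChartedSpace (EuclideanSpace ℝ (Fin d)) X] [ChartedSpace (EuclideanSpace ℝ (Fin k)) M] :
    Set (X × M → ℝ) :=
  {φ | ContMDiff ((𝓡 d).prod (𝓡 k)) 𝓘(ℝ) ((⊤ : ℕ∞) : WithTop ℕ∞) φ ∧ HasCompactSupport φ}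

open Classical in
/-- The class in `L²(μ)` of a square-integrable function (and `0` for any other function). -/
def toL2 {Z : Type*} [MeasurableSpace Z] (μ : Measure Z) (f : Z → ℝ) : Lp ℝ 2 μ :=
  if h : MemLp f 2 μ then h.toLp f else 0

/-! ### Semigroups and their generators -/

section Semigroups

variable {H : Type*} [NormedAddCommGroup H] [InnerProductSpace ℝ H]

/-- The graph of the operator `f ↦ lim_{t ↓ 0} (f - S_t f) / t`. -/
def genGraph (S : ℝ≥0 → H →L[ℝ] H) : Submodule ℝ (H × H) where
  carrier := {x | Tendsto (fun t : ℝ≥0 => (t : ℝ)⁻¹ • (x.1 - S t x.1)) (𝓝[>] 0) (𝓝 x.2)}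
  zero_mem' := by simp
  add_mem' {x y} hx hy := by
    refine (Tendsto.add hx hy).congr fun t => ?_
    simp only [Prod.fst_add, map_add, ← smul_add]
    congr 1
    abel
  smul_mem' c x hx := by
    refine (Tendsto.const_smul hx c).congr fun t => ?_
    simp only [Prod.smul_fst, map_smul, ← smul_sub]
    rw [smul_comm]

/-- The generator of `S`, with the sign convention `S_t = e^{-tL}`: the operator
`L f = lim_{t ↓ 0} (f - S_t f) / t` on the domain of all `f` for which the limit exists. -/
def semigroupGenerator (S : ℝ≥0 → H →L[ℝ] H) : H →ₗ.[ℝ] H := (genGraph S).toLinearPMap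

/-- Strongly continuous contraction semigroups. -/
structure IsContractionSemigroup (S : ℝ≥0 → H →L[ℝ] H) : Prop where
  zero : S 0 = ContinuousLinearMap.id ℝ H
  add : ∀ s t, S (s + t) = (S s).comp (S t)
  norm_le : ∀ t, ‖S t‖ ≤ 1
  cont : ∀ f, Continuous fun t => S t f

open Classical in
/-- `e^{-tA}`, `t ≥ 0`: the unique strongly continuous contraction semigroup whose generator
(with the above sign convention) is `A`. It exists for each positive self-adjoint `A`; if there is
none the value is `0`. -/
def expNeg (A : H →ₗ.[ℝ] H) : ℝ≥0 → H →L[ℝ] H :=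
  if h : ∃ S : ℝ≥0 → H →L[ℝ] H, IsContractionSemigroup S ∧ semigroupGenerator S = A
  then h.choose else 0

/-- The image `U L U⁻¹` of an operator `L` under an (injective) linear map `U`, with domain `U (Dom L)`. -/
def imageOperator {K : Type*} [NormedAddCommGroup K] [InnerProductSpace ℝ K]
    (U : H →ₗ[ℝ] K) (L : H →ₗ.[ℝ] H) : K →ₗ.[ℝ] K :=
  (L.graph.map (U.prodMap U)).toLinearPMap

end Semigroups

/-! ### The symmetric Fock space over `L²(τ)` and second quantization -/

section Fock

variable {Z : Type*} [MeasurableSpace Z]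

/-- The measure `n! · τ^{⊗n}`, whose `L²`-norm squared is `n! ∫ |f|² dτ^{⊗n}`. -/
def weightedPow (τ : Measure Z) (n : ℕ) : Measure (Fin n → Z) :=
  (n.factorial : ℝ≥0∞) • Measure.pi fun _ : Fin n => τ

/-- The tensor power `f^{⊗n}(z₁, …, zₙ) = f(z₁) ⋯ f(zₙ)` of `f ∈ L²(τ)`. -/
def tensorPow (τ : Measure Z) (n : ℕ) (f : Lp ℝ 2 τ) : Lp ℝ 2 (weightedPow τ n) :=
  toL2 _ fun z => ∏ i, f (z i)

/-- The `n`-th symmetric tensor power of `L²(τ)`, the closed span of all `f^{⊗n}` (equivalently, by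
polarization, the symmetric functions in `L²(τ^{⊗n})`), with norm squared `n! |f|²`. -/
def fockN (τ : Measure Z) (n : ℕ) : Submodule ℝ (Lp ℝ 2 (weightedPow τ n)) :=
  (Submodule.span ℝ (range (tensorPow τ n))).topologicalClosure

/-- The symmetric Fock space: the Hilbert sum of the symmetric tensor powers, with norm squared
`∑ₙ n! |f⁽ⁿ⁾|²`. -/
abbrev Fock (τ : Measure Z) : Type _ := lp (fun n : ℕ => fockN τ n) 2

/-- `f^{⊗n}` as an element of the Fock space. -/
def fockPow (τ : Measure Z) (n : ℕ) (f : Lp ℝ 2 τ) : Fock τ :=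
  lp.single 2 n ⟨tensorPow τ n f,
    Submodule.le_topologicalClosure _ (Submodule.subset_span (mem_range_self f))⟩

open Classical in
/-- `Exp B`, for a contraction `B` of `L²(τ)`: the unique bounded operator on the Fock space that is
`B ⊗ ⋯ ⊗ B` on each symmetric tensor power, i.e. `f^{⊗n} ↦ (Bf)^{⊗n}` (and the identity for
`n = 0`). -/
def fockExp (τ : Measure Z) (B : Lp ℝ 2 τ →L[ℝ] Lp ℝ 2 τ) : Fock τ →L[ℝ] Fock τ :=
  if h : ∃ C : Fock τ →L[ℝ] Fock τ, ∀ n f, C (fockPow τ n f) = fockPow τ n (B f)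
  then h.choose else 0

/-- The second quantization `d Exp A`, the generator of the semigroup `Exp (e^{-tA})`, `t ≥ 0`. -/
def dExp (τ : Measure Z) (A : Lp ℝ 2 τ →ₗ.[ℝ] Lp ℝ 2 τ) : Fock τ →ₗ.[ℝ] Fock τ :=
  semigroupGenerator fun t => fockExp τ (expNeg A t)

end Fock

section ChaosDecomposition

variable {X M : Type*} [TopologicalSpace X] [TopologicalSpace M]
  [MeasurableSpace X] [MeasurableSpace M]

open Classical in
/-- The chaos decomposition map from the Fock space over `L²(τ)` to `L²(π)`: the unique isometry
with `φ^{⊗n} ↦ Q_n(φ^{⊗n}; ·)` for `φ ∈ D` (for `D` a dense algebra such as `C_0^∞(X × M)`). -/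
def chaosMap (D : Set (X × M → ℝ)) (τ : Measure (X × M)) (π : Measure (MarkedConfig X M)) :
    Fock τ →ₗ[ℝ] Lp ℝ 2 π :=
  if h : ∃ U : Fock τ →ₗᵢ[ℝ] Lp ℝ 2 π, ∀ n, ∀ φ ∈ D,
      U (fockPow τ n (toL2 τ φ)) = toL2 π fun ω => charlierQ τ ω n fun _ => φ
  then h.choose.toLinearMap else 0

/-- The image in `L²(π)` of the second quantization `d Exp A`. -/
def hamiltonianMP (D : Set (X × M → ℝ)) (τ : Measure (X × M)) (π : Measure (MarkedConfig X M))
    (A : Lp ℝ 2 τ →ₗ.[ℝ] Lp ℝ 2 τ) : Lp ℝ 2 π →ₗ.[ℝ] Lp ℝ 2 π :=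
  imageOperator (chaosMap D τ π) (dExp τ A)

end ChaosDecomposition

end

/-!
The polynomials `Q_n(φ^{⊗n})` have the same Gram matrix in `L²(π)` as the powers `φ^{⊗n}` in the
Fock space, which yields the chaos isometry, and they span the polynomial cylinder functions. Adding
a point acts on them as an annihilation operator,
`Q_n(φ^{⊗n}; ω + ε_z) - Q_n(φ^{⊗n}; ω) = n φ(z) Q_{n-1}(φ^{⊗(n-1)}; ω)`,
whereas `d Exp A` sends `φ^{⊗n}` to `n φ^{⊗(n-1)} ⊗̂ Aφ`. Hence for `F₁ = Q_n(φ^{⊗n})` and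
`F₂ = Q_m(ψ^{⊗m})` both sides of the formula equal `n m (φ, Aψ) (Q_{n-1}(φ^{⊗(n-1)}),
Q_{m-1}(ψ^{⊗(m-1)}))`, and the general case follows by bilinearity.
-/

noncomputable section

/-! ### Positive self-adjoint operators generate contraction semigroups -/

theorem tendsto_apply_of_dense {ι E F : Type*} [NormedAddCommGroup E] [NormedSpace ℝ E]
    [NormedAddCommGroup F] [NormedSpace ℝ F] {l : Filter ι} {T : ι → E →L[ℝ] F} {C : ℝ≥0}
    (hT : ∀ i, ‖T i‖ ≤ C) {T₀ : E →L[ℝ] F} {s : Set E} (hs : Dense s)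
    (h : ∀ x ∈ s, Tendsto (fun i => T i x) l (𝓝 (T₀ x))) (x : E) :
    Tendsto (fun i => T i x) l (𝓝 (T₀ x)) := by
  have hequi : UniformEquicontinuous fun i => (T i : E → F) :=
    LipschitzWith.uniformEquicontinuous _ C fun i => (T i).lipschitz.weaken (hT i)
  have hclosed := hequi.equicontinuous.isClosed_setOfPred_tendsto (l := l) T₀.continuous
  exact hclosed.closure_subset_iff.2 h (hs x)

theorem cauchySeq_apply_of_dense {ι E F : Type*} [Nonempty ι] [SemilatticeSup ι]
    [NormedAddCommGroup E] [NormedSpace ℝ E] [NormedAddCommGroup F] [NormedSpace ℝ F]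
    {T : ι → E →L[ℝ] F} {C : ℝ≥0} (hT : ∀ i, ‖T i‖ ≤ C) {s : Set E} (hs : Dense s)
    (h : ∀ x ∈ s, CauchySeq fun i => T i x) (x : E) : CauchySeq fun i => T i x := by
  have hdiff (x : E) : CauchySeq (fun i => T i x) ↔
      Tendsto (fun p : ι × ι => (T p.1 - T p.2) x) atTop (𝓝 ((0 : E →L[ℝ] F) x)) := by
    simp only [cauchySeq_iff_tendsto_dist_atTop_0, dist_eq_norm, zero_apply, sub_apply,
      ← tendsto_zero_iff_norm_tendsto_zero]
  rw [hdiff]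
  refine tendsto_apply_of_dense (C := C + C) (fun p => ?_) hs (fun x hx => (hdiff x).1 (h x hx)) x
  exact (norm_sub_le _ _).trans (add_le_add (hT p.1) (hT p.2))

section Generator

variable {H : Type*} [NormedAddCommGroup H] [InnerProductSpace ℝ H] {S : ℝ≥0 → H →L[ℝ] H}

theorem graph_semigroupGenerator (S : ℝ≥0 → H →L[ℝ] H) :
    (semigroupGenerator S).graph = genGraph S := by
  refine Submodule.toLinearPMap_graph_eq _ fun x hx hx0 => ?_
  have hlim : Tendsto (fun t : ℝ≥0 => (t : ℝ)⁻¹ • (x.1 - S t x.1)) (𝓝[>] 0) (𝓝 x.2) := hx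
  simp only [hx0, map_zero, sub_zero, smul_zero] at hlim
  exact tendsto_nhds_unique hlim tendsto_const_nhds

theorem real_inner_apply_le_of_norm_le {T : H →L[ℝ] H} (hT : ‖T‖ ≤ 1) (x : H) :
    inner ℝ x (T x) ≤ inner ℝ x x :=
  calc inner ℝ x (T x) ≤ ‖x‖ * ‖T x‖ := real_inner_le_norm _ _
    _ ≤ ‖x‖ * ‖x‖ := by gcongr; simpa using T.le_of_opNorm_le hT x
    _ = inner ℝ x x := (real_inner_self_eq_norm_mul_norm x).symm

theorem inner_nonneg_of_mem_genGraph (hS : ∀ t, ‖S t‖ ≤ 1) {x : H × H} (hx : x ∈ genGraph S) :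
    0 ≤ inner ℝ x.1 x.2 := by
  refine ge_of_tendsto' (tendsto_const_nhds.inner hx) fun t => ?_
  rw [inner_smul_right, inner_sub_right]
  exact mul_nonneg (by positivity) (sub_nonneg.2 (real_inner_apply_le_of_norm_le (hS t) x.1))

theorem continuous_apply_of_tendsto_zero (hadd : ∀ s t, S (s + t) = (S s).comp (S t))
    (hnorm : ∀ t, ‖S t‖ ≤ 1) {g : H} (hg : Tendsto (fun t => S t g) (𝓝 0) (𝓝 g)) :
    Continuous fun t => S t g := by
  have hle {s t : ℝ≥0} (hst : s ≤ t) : ‖S t g - S s g‖ ≤ ‖S (t - s) g - g‖ := by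
    have : S t g = S s (S (t - s) g) := by
      rw [← ContinuousLinearMap.comp_apply, ← hadd, add_tsub_cancel_of_le hst]
    rw [this, ← map_sub]
    simpa using (S s).le_of_opNorm_le (hnorm s) (S (t - s) g - g)
  -- one of the two truncated differences vanishes, so their sum is `|t - s|`
  have hdist (s t : ℝ≥0) : ‖S t g - S s g‖ ≤ ‖S ((t - s) + (s - t)) g - g‖ := by
    rcases le_total s t with h | h
    · simpa [tsub_eq_zero_of_le h] using hle h
    · simpa [tsub_eq_zero_of_le h, norm_sub_rev (S t g)] using hle h
  refine continuous_iff_continuousAt.2 fun s => tendsto_iff_norm_sub_tendsto_zero.2 ?_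
  have habs : Tendsto (fun t : ℝ≥0 => (t - s) + (s - t)) (𝓝 s) (𝓝 0) := by
    have : Continuous fun t : ℝ≥0 => (t - s) + (s - t) := by fun_prop
    simpa using this.tendsto s
  exact squeeze_zero (fun t => norm_nonneg _) (hdist s)
    (tendsto_iff_norm_sub_tendsto_zero.1 (hg.comp habs))

end Generator

section BoundedGenerator

variable {H : Type*} [NormedAddCommGroup H] [InnerProductSpace ℝ H] {B C : H →L[ℝ] H}
  {t : ℝ}

/-- The exponential `e^{-tB}` of a bounded operator. -/
def boundedSemigroup (B : H →L[ℝ] H) (t : ℝ) : H →L[ℝ] H := NormedSpace.exp ((-t) • B)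

theorem boundedSemigroup_zero (B : H →L[ℝ] H) : boundedSemigroup B 0 = 1 := by
  simp [boundedSemigroup]

theorem boundedSemigroup_apply_comm (h : Commute B C) (t : ℝ) (f : H) :
    boundedSemigroup B t (C f) = C (boundedSemigroup B t f) := by
  let _ : NormedAlgebra ℚ (H →L[ℝ] H) := NormedAlgebra.restrictScalars ℚ ℝ _
  exact DFunLike.congr_fun (h.smul_left (-t)).exp_left.eq f

variable [CompleteSpace H]

theorem boundedSemigroup_add (B : H →L[ℝ] H) (s t : ℝ) :
    boundedSemigroup B (s + t) = boundedSemigroup B s * boundedSemigroup B t := by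
  let _ : NormedAlgebra ℚ (H →L[ℝ] H) := NormedAlgebra.restrictScalars ℚ ℝ _
  rw [boundedSemigroup, neg_add, add_smul,
    NormedSpace.exp_add_of_commute (((Commute.refl B).smul_left _).smul_right _)]
  rfl

theorem hasDerivAt_boundedSemigroup (B : H →L[ℝ] H) (t : ℝ) :
    HasDerivAt (boundedSemigroup B) (-(boundedSemigroup B t * B)) t := by
  have h := (hasDerivAt_exp_smul_const (𝕂 := ℝ) B (-t)).scomp t (hasDerivAt_neg t)
  have heq : boundedSemigroup B = (fun u : ℝ => NormedSpace.exp (u • B)) ∘ Neg.neg := rfl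
  simpa [heq] using h

theorem hasDerivAt_boundedSemigroup_apply (B : H →L[ℝ] H) (f : H) (t : ℝ) :
    HasDerivAt (fun s => boundedSemigroup B s f) (-(boundedSemigroup B t (B f))) t := by
  simpa using (hasDerivAt_boundedSemigroup B t).clm_apply (hasDerivAt_const t f)

theorem norm_boundedSemigroup_apply_le (hB : ∀ f, 0 ≤ inner ℝ f (B f)) (ht : 0 ≤ t) (f : H) :
    ‖boundedSemigroup B t f‖ ≤ ‖f‖ := by
  have hd (s : ℝ) : HasDerivAt (fun s => ‖boundedSemigroup B s f‖ ^ 2)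
      (2 * inner ℝ (boundedSemigroup B s f) (-(boundedSemigroup B s (B f)))) s :=
    (hasDerivAt_boundedSemigroup_apply B f s).norm_sq
  have hanti : Antitone fun s => ‖boundedSemigroup B s f‖ ^ 2 := by
    refine antitone_of_deriv_nonpos (fun s => (hd s).differentiableAt) fun s => ?_
    rw [(hd s).deriv, inner_neg_right, boundedSemigroup_apply_comm (Commute.refl B)]
    linarith [hB (boundedSemigroup B s f)]
  refine (sq_le_sq₀ (norm_nonneg _) (norm_nonneg _)).1 ?_
  simpa [boundedSemigroup_zero] using hanti ht

theorem norm_boundedSemigroup_le (hB : ∀ f, 0 ≤ inner ℝ f (B f)) (ht : 0 ≤ t) :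
    ‖boundedSemigroup B t‖ ≤ 1 :=
  ContinuousLinearMap.opNorm_le_bound _ zero_le_one fun f => by
    simpa using norm_boundedSemigroup_apply_le hB ht f

theorem norm_boundedSemigroup_sub_le (hB : ∀ f, 0 ≤ inner ℝ f (B f))
    (hC : ∀ f, 0 ≤ inner ℝ f (C f)) (h : Commute B C) (ht : 0 ≤ t) (f : H) :
    ‖boundedSemigroup C t f - boundedSemigroup B t f‖ ≤ t * ‖B f - C f‖ := by
  have hd (s : ℝ) : HasDerivAt (fun s => boundedSemigroup B (t - s) (boundedSemigroup C s f))
      (boundedSemigroup B (t - s) (boundedSemigroup C s (B f - C f))) s := by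
    have hB' : HasDerivAt (fun s => boundedSemigroup B (t - s))
        (boundedSemigroup B (t - s) * B) s := by
      simpa [Function.comp_def] using
        (hasDerivAt_boundedSemigroup B (t - s)).scomp s ((hasDerivAt_id s).const_sub t)
    convert hB'.clm_apply (hasDerivAt_boundedSemigroup_apply C f s) using 1
    simp [boundedSemigroup_apply_comm h.symm, sub_eq_add_neg]
  have hderiv_le : ∀ s ∈ Ico 0 t,
      ‖boundedSemigroup B (t - s) (boundedSemigroup C s (B f - C f))‖ ≤ ‖B f - C f‖ :=
    fun s hs => (norm_boundedSemigroup_apply_le hB (by linarith [hs.2]) _).trans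
      (norm_boundedSemigroup_apply_le hC hs.1 _)
  simpa [boundedSemigroup_zero, mul_comm] using norm_image_sub_le_of_norm_deriv_le_segment'
    (fun s _ => (hd s).hasDerivWithinAt) hderiv_le t (right_mem_Icc.2 ht)

theorem norm_sub_boundedSemigroup_le (hB : ∀ f, 0 ≤ inner ℝ f (B f)) (ht : 0 ≤ t) (f : H) :
    ‖f - boundedSemigroup B t f‖ ≤ t * ‖B f‖ := by
  simpa [boundedSemigroup] using
    norm_boundedSemigroup_sub_le (C := 0) hB (by simp) (Commute.zero_right B) ht f

theorem norm_sub_boundedSemigroup_sub_smul_le {f : H} {c : ℝ} (ht : 0 ≤ t)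
    (hc : ∀ s ∈ Icc 0 t, ‖B f - boundedSemigroup B s (B f)‖ ≤ c) :
    ‖f - boundedSemigroup B t f - t • B f‖ ≤ t * c := by
  have hd (s : ℝ) : HasDerivAt (fun s => -(boundedSemigroup B s f) - s • B f)
      (-(-(boundedSemigroup B s (B f))) - (1 : ℝ) • B f) s :=
    (hasDerivAt_boundedSemigroup_apply B f s).neg.sub ((hasDerivAt_id s).smul_const (B f))
  have key := norm_image_sub_le_of_norm_deriv_le_segment' (C := c)
    (fun s _ => (hd s).hasDerivWithinAt) (fun s hs => ?_) t (right_mem_Icc.2 ht)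
  · rw [sub_zero, mul_comm] at key
    convert key using 2
    simp only [boundedSemigroup_zero, one_apply_eq_self, zero_smul, sub_zero]
    abel
  · rw [neg_neg, one_smul, norm_sub_rev]
    exact hc s ⟨hs.1, hs.2.le⟩

/-- The point of this bound is that it only sees `B f` through an approximation `h`, and so
survives the limit from Yosida approximations to an unbounded operator. -/
theorem norm_sub_boundedSemigroup_sub_smul_le_of_approx (hB : ∀ f, 0 ≤ inner ℝ f (B f))
    (ht : 0 ≤ t) (f h : H) :
    ‖f - boundedSemigroup B t f - t • B f‖ ≤ t * (2 * ‖B f - h‖ + t * ‖B h‖) := by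
  refine norm_sub_boundedSemigroup_sub_smul_le ht fun s hs => ?_
  calc ‖B f - boundedSemigroup B s (B f)‖
      = ‖(B f - h) - boundedSemigroup B s (B f - h) + (h - boundedSemigroup B s h)‖ := by
        rw [map_sub]; congr 1; abel
    _ ≤ ‖B f - h‖ + ‖boundedSemigroup B s (B f - h)‖ + ‖h - boundedSemigroup B s h‖ :=
        (norm_add_le _ _).trans (add_le_add_left (norm_sub_le _ _) _)
    _ ≤ ‖B f - h‖ + ‖B f - h‖ + s * ‖B h‖ := by
        gcongr
        · exact norm_boundedSemigroup_apply_le hB hs.1 _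
        · exact norm_sub_boundedSemigroup_le hB hs.1 h
    _ ≤ 2 * ‖B f - h‖ + t * ‖B h‖ := by
        rw [← two_mul]; gcongr; exact hs.2

end BoundedGenerator

section Resolvent

variable {H : Type*} [NormedAddCommGroup H] [InnerProductSpace ℝ H] {A : H →ₗ.[ℝ] H}

theorem norm_smul_le_norm_smul_add {x y : H} (h : 0 ≤ inner ℝ x y) {l : ℝ} (hl : 0 < l) :
    ‖l • x‖ ≤ ‖l • x + y‖ := by
  refine (sq_le_sq₀ (norm_nonneg _) (norm_nonneg _)).1 ?_
  rw [norm_add_sq_real, real_inner_smul_left]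
  nlinarith [mul_nonneg hl.le h, sq_nonneg ‖y‖]

/-- The operator `l + A`, as a bounded operator on the graph of `A`. -/
def graphShift (A : H →ₗ.[ℝ] H) (l : ℝ) : A.graph →L[ℝ] H :=
  (l • ContinuousLinearMap.fst ℝ H H + ContinuousLinearMap.snd ℝ H H).comp A.graph.subtypeL

theorem graphShift_apply (l : ℝ) (x : A.graph) : graphShift A l x = l • x.1.1 + x.1.2 := rfl

/-- The resolvent `(l + A)⁻¹`; it has the junk value `0` when `l + A` is not invertible. -/
def shiftInverse (A : H →ₗ.[ℝ] H) (l : ℝ) : H →L[ℝ] H :=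
  ((ContinuousLinearMap.fst ℝ H H).comp A.graph.subtypeL).comp (graphShift A l).inverse

variable [CompleteSpace H]

/-- Positive self-adjoint operators. -/
structure IsPosSelfAdjoint (A : H →ₗ.[ℝ] H) : Prop where
  isSelfAdjoint : IsSelfAdjoint A
  inner_nonneg : ∀ x ∈ A.graph, 0 ≤ inner ℝ x.1 x.2

namespace IsPosSelfAdjoint

variable {l : ℝ}

theorem of_domain (hA : IsSelfAdjoint A) (hpos : ∀ f : A.domain, 0 ≤ inner ℝ (f : H) (A f)) :
    IsPosSelfAdjoint A where
  isSelfAdjoint := hA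
  inner_nonneg := by
    rintro ⟨_, _⟩ hx
    obtain ⟨f, rfl, rfl⟩ := A.mem_graph_iff.1 hx
    exact hpos f

variable (hA : IsPosSelfAdjoint A)
include hA

theorem dense_domain : Dense (A.domain : Set H) := hA.isSelfAdjoint.dense_domain

theorem inner_comm_of_mem_graph {x y : H × H} (hx : x ∈ A.graph) (hy : y ∈ A.graph) :
    inner ℝ x.2 y.1 = inner ℝ x.1 y.2 := by
  have hformal := LinearPMap.adjoint_isFormalAdjoint hA.dense_domain
  rw [LinearPMap.isSelfAdjoint_def.1 hA.isSelfAdjoint] at hformal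
  obtain ⟨f, hf₁, hf₂⟩ := A.mem_graph_iff.1 hx
  obtain ⟨g, hg₁, hg₂⟩ := A.mem_graph_iff.1 hy
  rw [← hf₁, ← hf₂, ← hg₁, ← hg₂]
  exact hformal f g

theorem mem_graph_of_inner_eq {g h : H}
    (hgh : ∀ f : A.domain, inner ℝ h (f : H) = inner ℝ g (A f)) :
    (g, h) ∈ A.graph := by
  have hdom := LinearPMap.mem_adjoint_domain_of_exists (T := A) g ⟨h, hgh⟩
  have hmem : (g, h) ∈ A.adjoint.graph := A.adjoint.mem_graph_iff.2
    ⟨⟨g, hdom⟩, rfl, LinearPMap.adjoint_apply_eq hA.dense_domain ⟨g, hdom⟩ hgh⟩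
  rwa [LinearPMap.isSelfAdjoint_def.1 hA.isSelfAdjoint] at hmem

theorem antilipschitzWith_graphShift (hl : 0 < l) :
    AntilipschitzWith (max l⁻¹ 2).toNNReal (graphShift A l) := by
  refine AddMonoidHomClass.antilipschitz_of_bound _ fun x => ?_
  have hfst : ‖l • x.1.1‖ ≤ ‖graphShift A l x‖ :=
    norm_smul_le_norm_smul_add (hA.inner_nonneg _ x.2) hl
  have hsnd : ‖x.1.2‖ ≤ 2 * ‖graphShift A l x‖ := by
    have := norm_sub_le (graphShift A l x) (l • x.1.1)
    rw [graphShift_apply, add_sub_cancel_left, ← graphShift_apply] at this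
    linarith
  rw [norm_smul, Real.norm_of_nonneg hl.le, ← le_inv_mul_iff₀ hl] at hfst
  rw [Real.coe_toNNReal _ (by positivity)]
  exact max_le (hfst.trans (by gcongr; exact le_max_left _ _))
    (hsnd.trans (by gcongr; exact le_max_right _ _))

theorem orthogonal_range_graphShift (hl : 0 < l) :
    ((graphShift A l : A.graph →ₗ[ℝ] H).range)ᗮ = ⊥ := by
  refine (Submodule.eq_bot_iff _).2 fun g hg => ?_
  -- `g ⟂ (l + A) f` for all `f` says `A g = - l g`
  have hmem : (g, -(l • g)) ∈ A.graph := hA.mem_graph_of_inner_eq fun f => by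
    have h0 : inner ℝ (graphShift A l ⟨((f : H), A f), A.mem_graph f⟩) g = 0 :=
      (Submodule.mem_orthogonal _ _).1 hg _ ⟨_, rfl⟩
    rw [graphShift_apply, inner_add_left, real_inner_smul_left] at h0
    rw [inner_neg_left, real_inner_smul_left, real_inner_comm, real_inner_comm (A f)]
    linarith
  have h0 := hA.inner_nonneg _ hmem
  rw [inner_neg_right, inner_smul_right] at h0
  have hle : inner ℝ g g ≤ 0 := nonpos_of_mul_nonpos_right (neg_nonneg.1 h0) hl
  exact real_inner_self_nonpos.1 hle

theorem isInvertible_graphShift (hl : 0 < l) : (graphShift A l).IsInvertible := by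
  have hclosed : IsClosed (A.graph : Set (H × H)) := hA.isSelfAdjoint.isClosed
  have : CompleteSpace A.graph := hclosed.completeSpace_coe
  have hanti := hA.antilipschitzWith_graphShift hl
  have hrange : IsClosed ((graphShift A l : A.graph →ₗ[ℝ] H).range : Set H) :=
    hanti.isClosed_range (graphShift A l).uniformContinuous
  have hsurj : (graphShift A l : A.graph →ₗ[ℝ] H).range = ⊤ := by
    rw [← hrange.submodule_topologicalClosure_eq, Submodule.topologicalClosure_eq_top_iff]
    exact hA.orthogonal_range_graphShift hl
  exact ⟨ContinuousLinearEquiv.ofBijective _ (LinearMap.ker_eq_bot.2 hanti.injective) hsurj,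
    ContinuousLinearEquiv.coe_ofBijective _ _ _⟩

theorem shiftInverse_mem_graph (hl : 0 < l) (h : H) :
    (shiftInverse A l h, h - l • shiftInverse A l h) ∈ A.graph := by
  set y := (graphShift A l).inverse h
  have hy : l • y.1.1 + y.1.2 = h := (hA.isInvertible_graphShift hl).self_apply_inverse h
  have heq : y.1 = (shiftInverse A l h, h - l • shiftInverse A l h) :=
    Prod.ext rfl (eq_sub_of_add_eq' hy)
  exact heq ▸ y.2

theorem shiftInverse_apply (hl : 0 < l) {x : H × H} (hx : x ∈ A.graph) :
    shiftInverse A l (l • x.1 + x.2) = x.1 :=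
  congrArg (fun y : A.graph => y.1.1)
    ((hA.isInvertible_graphShift hl).inverse_apply_self ⟨x, hx⟩)

theorem smul_shiftInverse_add (hl : 0 < l) {x : H × H} (hx : x ∈ A.graph) :
    l • shiftInverse A l x.1 + shiftInverse A l x.2 = x.1 := by
  rw [← map_smul, ← map_add, hA.shiftInverse_apply hl hx]

theorem norm_smul_shiftInverse_apply_le (hl : 0 < l) (h : H) : ‖l • shiftInverse A l h‖ ≤ ‖h‖ := by
  simpa using norm_smul_le_norm_smul_add (hA.inner_nonneg _ (hA.shiftInverse_mem_graph hl h)) hl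

theorem norm_smul_shiftInverse_le (hl : 0 < l) : ‖l • shiftInverse A l‖ ≤ 1 :=
  ContinuousLinearMap.opNorm_le_bound _ zero_le_one fun h => by
    simpa using hA.norm_smul_shiftInverse_apply_le hl h

theorem shiftInverse_sub_shiftInverse {m : ℝ} (hl : 0 < l) (hm : 0 < m) (h : H) :
    shiftInverse A l h - shiftInverse A m h = (m - l) • shiftInverse A l (shiftInverse A m h) := by
  have key := hA.shiftInverse_apply hl (hA.shiftInverse_mem_graph hm h)
  have heq : l • shiftInverse A m h + (h - m • shiftInverse A m h)
      = h - (m - l) • shiftInverse A m h := by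
    module
  rw [heq, map_sub, map_smul] at key
  exact sub_eq_iff_eq_add'.2 (sub_eq_iff_eq_add.1 key)

theorem commute_shiftInverse {m : ℝ} (hl : 0 < l) (hm : 0 < m) :
    Commute (shiftInverse A l) (shiftInverse A m) := by
  rcases eq_or_ne l m with rfl | hlm
  · exact Commute.refl _
  refine ContinuousLinearMap.ext fun h => smul_right_injective H (sub_ne_zero.2 hlm.symm) ?_
  calc (m - l) • shiftInverse A l (shiftInverse A m h)
      = -(shiftInverse A m h - shiftInverse A l h) := by
        rw [← hA.shiftInverse_sub_shiftInverse hl hm, neg_sub]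
    _ = (m - l) • shiftInverse A m (shiftInverse A l h) := by
        rw [hA.shiftInverse_sub_shiftInverse hm hl, ← neg_smul, neg_sub]

end IsPosSelfAdjoint

end Resolvent

section Yosida

variable {H : Type*} [NormedAddCommGroup H] [InnerProductSpace ℝ H] {A : H →ₗ.[ℝ] H}

/-- The Yosida approximation `l (1 - l (l + A)⁻¹) = A (1 + A / l)⁻¹` with `l = n + 1`. -/
def yosida (A : H →ₗ.[ℝ] H) (n : ℕ) : H →L[ℝ] H :=
  ((n : ℝ) + 1) • (1 - ((n : ℝ) + 1) • shiftInverse A (n + 1))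

variable [CompleteSpace H]

namespace IsPosSelfAdjoint

variable (hA : IsPosSelfAdjoint A)
include hA

theorem yosida_inner_nonneg (n : ℕ) (f : H) : 0 ≤ inner ℝ f (yosida A n f) := by
  rw [yosida, smul_apply, inner_smul_right, sub_apply, inner_sub_right]
  exact mul_nonneg n.cast_add_one_pos.le (sub_nonneg.2 (real_inner_apply_le_of_norm_le
    (hA.norm_smul_shiftInverse_le n.cast_add_one_pos) f))

theorem commute_yosida (m n : ℕ) : Commute (yosida A m) (yosida A n) := by
  have h := hA.commute_shiftInverse m.cast_add_one_pos n.cast_add_one_pos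
  refine Commute.smul_left (Commute.smul_right ?_ _) _
  exact (Commute.one_left _).sub_left
    ((Commute.one_right _).sub_right ((h.smul_left _).smul_right _))

theorem yosida_apply (n : ℕ) {x : H × H} (hx : x ∈ A.graph) :
    yosida A n x.1 = ((n : ℝ) + 1) • shiftInverse A (n + 1) x.2 := by
  rw [yosida, smul_apply, sub_apply, smul_apply, one_apply_eq_self,
    sub_eq_of_eq_add' (hA.smul_shiftInverse_add n.cast_add_one_pos hx).symm]

theorem norm_yosida_apply_le (n : ℕ) {x : H × H} (hx : x ∈ A.graph) :
    ‖yosida A n x.1‖ ≤ ‖x.2‖ := by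
  rw [hA.yosida_apply n hx]
  exact hA.norm_smul_shiftInverse_apply_le n.cast_add_one_pos x.2

theorem tendsto_smul_shiftInverse (g : H) :
    Tendsto (fun n : ℕ => ((n : ℝ) + 1) • shiftInverse A (n + 1) g) atTop (𝓝 g) := by
  refine tendsto_apply_of_dense (C := 1) (T₀ := ContinuousLinearMap.id ℝ H)
    (T := fun n : ℕ => ((n : ℝ) + 1) • shiftInverse A (n + 1))
    (fun n => hA.norm_smul_shiftInverse_le n.cast_add_one_pos) hA.dense_domain (fun f hf => ?_) g
  have hgraph := A.mem_graph ⟨f, hf⟩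
  refine tendsto_iff_norm_sub_tendsto_zero.2 (squeeze_zero (fun n => norm_nonneg _)
    (fun n => ?_) (by simpa using
      (tendsto_one_div_add_atTop_nhds_zero_nat (𝕜 := ℝ)).mul_const ‖A ⟨f, hf⟩‖))
  have hpos : (0 : ℝ) < n + 1 := n.cast_add_one_pos
  have heq : ((n : ℝ) + 1) • shiftInverse A (n + 1) f - f
      = -shiftInverse A (n + 1) (A ⟨f, hf⟩) := by
    rw [sub_eq_iff_eq_add, ← sub_eq_neg_add]
    exact eq_sub_of_add_eq (hA.smul_shiftInverse_add hpos hgraph)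
  calc ‖((n : ℝ) + 1) • shiftInverse A (n + 1) f - f‖
      = ((n : ℝ) + 1)⁻¹ * ‖((n : ℝ) + 1) • shiftInverse A (n + 1) (A ⟨f, hf⟩)‖ := by
        rw [heq, norm_neg, norm_smul, Real.norm_of_nonneg hpos.le, inv_mul_cancel_left₀ hpos.ne']
    _ ≤ ((n : ℝ) + 1)⁻¹ * ‖A ⟨f, hf⟩‖ := by
        gcongr; exact hA.norm_smul_shiftInverse_apply_le hpos _

theorem tendsto_yosida {x : H × H} (hx : x ∈ A.graph) :
    Tendsto (fun n => yosida A n x.1) atTop (𝓝 x.2) :=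
  (hA.tendsto_smul_shiftInverse x.2).congr fun n => (hA.yosida_apply n hx).symm

theorem cauchySeq_boundedSemigroup_yosida (t : ℝ≥0) (g : H) :
    CauchySeq fun n => boundedSemigroup (yosida A n) t g := by
  refine cauchySeq_apply_of_dense (C := 1)
    (fun n => norm_boundedSemigroup_le (hA.yosida_inner_nonneg n) t.2) hA.dense_domain
    (fun f hf => cauchySeq_iff_tendsto_dist_atTop_0.2 ?_) g
  have hyosida := cauchySeq_iff_tendsto_dist_atTop_0.1
    (hA.tendsto_yosida (A.mem_graph ⟨f, hf⟩)).cauchySeq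
  refine squeeze_zero (fun p => dist_nonneg) (fun p => ?_)
    (by simpa using hyosida.const_mul (t : ℝ))
  rw [dist_comm (yosida A p.1 f), dist_eq_norm, dist_eq_norm]
  exact norm_boundedSemigroup_sub_le (hA.yosida_inner_nonneg p.2) (hA.yosida_inner_nonneg p.1)
    (hA.commute_yosida p.2 p.1) t.2 f

/-- The semigroup generated by a positive self-adjoint operator, the strong limit of the
semigroups generated by its Yosida approximations. -/
def semigroup (t : ℝ≥0) : H →L[ℝ] H :=
  continuousLinearMapOfTendsto (fun n => boundedSemigroup (yosida A n) t) (tendsto_pi_nhds.2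
    fun g => (cauchySeq_tendsto_of_complete
      (hA.cauchySeq_boundedSemigroup_yosida t g)).choose_spec)

theorem tendsto_boundedSemigroup_yosida (t : ℝ≥0) (g : H) :
    Tendsto (fun n => boundedSemigroup (yosida A n) t g) atTop (𝓝 (hA.semigroup t g)) :=
  (cauchySeq_tendsto_of_complete (hA.cauchySeq_boundedSemigroup_yosida t g)).choose_spec

theorem norm_semigroup_le (t : ℝ≥0) : ‖hA.semigroup t‖ ≤ 1 := by
  refine ContinuousLinearMap.opNorm_le_bound _ zero_le_one fun g => ?_
  rw [one_mul]
  exact le_of_tendsto' (hA.tendsto_boundedSemigroup_yosida t g).norm fun n =>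
    norm_boundedSemigroup_apply_le (hA.yosida_inner_nonneg n) t.2 g

theorem semigroup_zero : hA.semigroup 0 = ContinuousLinearMap.id ℝ H :=
  ContinuousLinearMap.ext fun g => tendsto_nhds_unique (hA.tendsto_boundedSemigroup_yosida 0 g)
    (by simp [boundedSemigroup_zero])

theorem semigroup_add (s t : ℝ≥0) :
    hA.semigroup (s + t) = (hA.semigroup s).comp (hA.semigroup t) := by
  refine ContinuousLinearMap.ext fun g =>
    tendsto_nhds_unique (hA.tendsto_boundedSemigroup_yosida (s + t) g) ?_
  have hdiff : Tendsto (fun n => boundedSemigroup (yosida A n) s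
      (boundedSemigroup (yosida A n) t g - hA.semigroup t g)) atTop (𝓝 0) :=
    squeeze_zero_norm (fun n => norm_boundedSemigroup_apply_le (hA.yosida_inner_nonneg n) s.2 _)
      (tendsto_iff_norm_sub_tendsto_zero.1 (hA.tendsto_boundedSemigroup_yosida t g))
  have hsum := hdiff.add (hA.tendsto_boundedSemigroup_yosida s (hA.semigroup t g))
  rw [zero_add] at hsum
  exact hsum.congr fun n => by simp [boundedSemigroup_add]

theorem norm_sub_semigroup_le {x : H × H} (hx : x ∈ A.graph) (t : ℝ≥0) :
    ‖x.1 - hA.semigroup t x.1‖ ≤ t * ‖x.2‖ :=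
  le_of_tendsto' ((hA.tendsto_boundedSemigroup_yosida t x.1).const_sub x.1).norm fun n =>
    (norm_sub_boundedSemigroup_le (hA.yosida_inner_nonneg n) t.2 x.1).trans
      (mul_le_mul_of_nonneg_left (hA.norm_yosida_apply_le n hx) t.2)

theorem tendsto_semigroup_zero (g : H) :
    Tendsto (fun t => hA.semigroup t g) (𝓝 0) (𝓝 g) := by
  refine tendsto_apply_of_dense (C := 1) (T₀ := ContinuousLinearMap.id ℝ H) hA.norm_semigroup_le
    hA.dense_domain (fun f hf => ?_) g
  have hlim : Tendsto (fun t : ℝ≥0 => (t : ℝ) * ‖A ⟨f, hf⟩‖) (𝓝 0) (𝓝 0) := by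
    have : Continuous fun t : ℝ≥0 => (t : ℝ) * ‖A ⟨f, hf⟩‖ := by fun_prop
    simpa using this.tendsto 0
  refine tendsto_iff_norm_sub_tendsto_zero.2
    (squeeze_zero (fun t => norm_nonneg _) (fun t => ?_) hlim)
  rw [norm_sub_rev]
  exact hA.norm_sub_semigroup_le (A.mem_graph ⟨f, hf⟩) t

theorem isContractionSemigroup_semigroup : IsContractionSemigroup hA.semigroup where
  zero := hA.semigroup_zero
  add := hA.semigroup_add
  norm_le := hA.norm_semigroup_le
  cont g := continuous_apply_of_tendsto_zero hA.semigroup_add hA.norm_semigroup_le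
    (hA.tendsto_semigroup_zero g)

theorem norm_sub_semigroup_sub_smul_le {x : H × H} (hx : x ∈ A.graph) {h : H × H}
    (hh : h ∈ A.graph) (t : ℝ≥0) :
    ‖x.1 - hA.semigroup t x.1 - (t : ℝ) • x.2‖ ≤ t * (2 * ‖x.2 - h.1‖ + t * ‖h.2‖) := by
  have hyosida := hA.tendsto_yosida hx
  have hlhs := (((hA.tendsto_boundedSemigroup_yosida t x.1).const_sub x.1).sub
    (hyosida.const_smul (t : ℝ))).norm
  have hrhs := ((((hyosida.sub_const h.1).norm.const_mul 2).add_const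
    ((t : ℝ) * ‖h.2‖)).const_mul (t : ℝ))
  refine le_of_tendsto_of_tendsto' hlhs hrhs fun n =>
    (norm_sub_boundedSemigroup_sub_smul_le_of_approx
      (hA.yosida_inner_nonneg n) t.2 x.1 h.1).trans ?_
  exact mul_le_mul_of_nonneg_left (add_le_add_right
    (mul_le_mul_of_nonneg_left (hA.norm_yosida_apply_le n hh) t.2) _) t.2

theorem graph_le_genGraph : A.graph ≤ genGraph hA.semigroup := by
  intro x hx
  refine Metric.tendsto_nhds.2 fun ε hε => ?_
  obtain ⟨f, hf, hfA⟩ := Metric.dense_iff.1 hA.dense_domain x.2 (ε / 4) (by positivity)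
  have hlim : Tendsto (fun t : ℝ≥0 => 2 * ‖x.2 - f‖ + t * ‖A ⟨f, hfA⟩‖) (𝓝 0)
      (𝓝 (2 * ‖x.2 - f‖)) := by
    have : Continuous fun t : ℝ≥0 => 2 * ‖x.2 - f‖ + t * ‖A ⟨f, hfA⟩‖ := by fun_prop
    simpa using this.tendsto 0
  have hf' : 2 * ‖x.2 - f‖ < ε := by
    rw [mem_ball_iff_norm'] at hf
    linarith
  filter_upwards [nhdsWithin_le_nhds (hlim.eventually_lt_const hf'), self_mem_nhdsWithin]
    with t ht ht0
  replace ht0 : (0 : ℝ) < t := ht0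
  have heq : (t : ℝ)⁻¹ • (x.1 - hA.semigroup t x.1) - x.2
      = (t : ℝ)⁻¹ • (x.1 - hA.semigroup t x.1 - (t : ℝ) • x.2) := by
    rw [smul_sub _ (x.1 - _), inv_smul_smul₀ ht0.ne']
  rw [dist_eq_norm, heq, norm_smul, norm_inv, Real.norm_of_nonneg ht0.le, inv_mul_lt_iff₀ ht0]
  exact (hA.norm_sub_semigroup_sub_smul_le hx (A.mem_graph ⟨f, hfA⟩) t).trans_lt
    (mul_lt_mul_of_pos_left ht ht0)

theorem eq_graph_of_le {G : Submodule ℝ (H × H)} (hle : A.graph ≤ G)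
    (hG : ∀ x ∈ G, 0 ≤ inner ℝ x.1 x.2) : G = A.graph := by
  refine le_antisymm (fun x hx => ?_) hle
  -- The solution `y` of `y + A y = x.1 + x.2` has `x - y = (w, -w)`, so positivity gives `w = 0`.
  set y := (shiftInverse A 1 (x.1 + x.2),
    x.1 + x.2 - (1 : ℝ) • shiftInverse A 1 (x.1 + x.2)) with hy
  have hyA : y ∈ A.graph := hA.shiftInverse_mem_graph one_pos _
  have hneg : (x - y).2 = -(x - y).1 := by
    simp only [hy, Prod.snd_sub, Prod.fst_sub, one_smul]
    abel
  have hpos := hG _ (G.sub_mem hx (hle hyA))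
  rw [hneg, inner_neg_right, neg_nonneg, real_inner_self_nonpos] at hpos
  have hxy : x = y := sub_eq_zero.1 (Prod.ext hpos (by rw [hneg, hpos, neg_zero]; rfl))
  exact hxy ▸ hyA

theorem semigroupGenerator_semigroup : semigroupGenerator hA.semigroup = A := by
  refine LinearPMap.eq_of_eq_graph ?_
  rw [graph_semigroupGenerator]
  exact hA.eq_graph_of_le hA.graph_le_genGraph fun _ =>
    inner_nonneg_of_mem_genGraph hA.norm_semigroup_le

theorem expNeg_spec :
    IsContractionSemigroup (expNeg A) ∧ semigroupGenerator (expNeg A) = A := by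
  have h : ∃ S : ℝ≥0 → H →L[ℝ] H, IsContractionSemigroup S ∧ semigroupGenerator S = A :=
    ⟨hA.semigroup, hA.isContractionSemigroup_semigroup, hA.semigroupGenerator_semigroup⟩
  rw [expNeg, dif_pos h]
  exact h.choose_spec

end IsPosSelfAdjoint

end Yosida

/-! ### Gram matrices -/

section GramMatrix

variable {ι E F : Type*} [NormedAddCommGroup E] [InnerProductSpace ℝ E]
  [NormedAddCommGroup F] [InnerProductSpace ℝ F] {v : ι → E} {w : ι → F}

theorem norm_linearCombination_sq (v : ι → E) (c : ι →₀ ℝ) :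
    ‖Finsupp.linearCombination ℝ v c‖ ^ 2
      = c.sum fun i a => c.sum fun j b => a * Matrix.gram ℝ v i j * b := by
  simp only [← real_inner_self_eq_norm_sq, Finsupp.linearCombination_apply, Finsupp.sum, sum_inner,
    inner_sum, real_inner_smul_left, real_inner_smul_right, Matrix.gram_apply]
  exact Finset.sum_congr rfl fun i _ => Finset.sum_congr rfl fun j _ => by
    rw [real_inner_comm]
    ring

theorem gram_posSemidef (v : ι → E) : (Matrix.gram ℝ v).PosSemidef :=
  ⟨Matrix.isHermitian_gram ℝ v, fun c => (sq_nonneg _).trans_eq (norm_linearCombination_sq v c)⟩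

theorem norm_linearCombination_le (h : (Matrix.gram ℝ v - Matrix.gram ℝ w).PosSemidef)
    (c : ι →₀ ℝ) :
    ‖Finsupp.linearCombination ℝ w c‖ ≤ ‖Finsupp.linearCombination ℝ v c‖ := by
  rw [← sq_le_sq₀ (norm_nonneg _) (norm_nonneg _), norm_linearCombination_sq,
    norm_linearCombination_sq, ← sub_nonneg]
  simpa only [Finsupp.sum, star_trivial, Matrix.sub_apply, mul_sub, sub_mul,
    Finset.sum_sub_distrib] using h.2 c

theorem denseRange_linearCombination
    (hv : (Submodule.span ℝ (range v)).topologicalClosure = ⊤) :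
    DenseRange (Finsupp.linearCombination ℝ v) := by
  have hdense := Submodule.dense_iff_topologicalClosure_eq_top.2 hv
  rwa [← Finsupp.range_linearCombination] at hdense

variable [CompleteSpace F]

theorem exists_clm_apply_eq_of_gram_le
    (hv : (Submodule.span ℝ (range v)).topologicalClosure = ⊤)
    (h : (Matrix.gram ℝ v - Matrix.gram ℝ w).PosSemidef) :
    ∃ T : E →L[ℝ] F, ∀ i, T (v i) = w i := by
  refine ⟨(Finsupp.linearCombination ℝ w).extendOfNorm (Finsupp.linearCombination ℝ v),
    fun i => ?_⟩
  have hT := LinearMap.extendOfNorm_eq (denseRange_linearCombination hv)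
    ⟨1, fun c => by simpa using norm_linearCombination_le h c⟩ (Finsupp.single i 1)
  simpa using hT

theorem exists_linearIsometry_apply_eq_of_gram_eq
    (hv : (Submodule.span ℝ (range v)).topologicalClosure = ⊤)
    (h : Matrix.gram ℝ w = Matrix.gram ℝ v) : ∃ U : E →ₗᵢ[ℝ] F, ∀ i, U (v i) = w i := by
  obtain ⟨T, hT⟩ := exists_clm_apply_eq_of_gram_le hv (w := w)
    (by rw [h, sub_self]; exact Matrix.PosSemidef.zero)
  refine ⟨⟨T.toLinearMap, fun x => ?_⟩, hT⟩
  refine (denseRange_linearCombination hv).induction_on (p := fun x => ‖T x‖ = ‖x‖) x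
    (isClosed_eq T.continuous.norm continuous_norm) fun c => ?_
  have hTc : T (Finsupp.linearCombination ℝ v c) = Finsupp.linearCombination ℝ w c := by
    simp only [Finsupp.linearCombination_apply, Finsupp.sum, map_sum, map_smul, hT]
  rw [hTc, ← sq_eq_sq₀ (norm_nonneg _) (norm_nonneg _), norm_linearCombination_sq,
    norm_linearCombination_sq, h]

end GramMatrix

section PosSemidef

variable {ι : Type*} {G K : Matrix ι ι ℝ}

theorem posSemidef_map_pow (hG : G.PosSemidef) (n : ℕ) : (G.map (· ^ n)).PosSemidef := by
  induction n with
  | zero =>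
    have hone : G.map (· ^ 0) = Matrix.gram ℝ fun _ : ι => (1 : ℝ) := by
      ext i j
      simp [Matrix.gram_apply]
    exact hone ▸ gram_posSemidef _
  | succ n ih =>
    have hsucc : G.map (· ^ (n + 1)) = (G.map (· ^ n)).hadamard G := by
      ext i j
      exact pow_succ _ n
    exact hsucc ▸ ih.hadamard hG

theorem posSemidef_map_pow_sub_map_pow (hK : K.PosSemidef) (h : (G - K).PosSemidef) (n : ℕ) :
    (G.map (· ^ n) - K.map (· ^ n)).PosSemidef := by
  induction n with
  | zero =>
    have hzero : G.map (· ^ 0) - K.map (· ^ 0) = 0 := by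
      ext i j
      simp
    exact hzero ▸ Matrix.PosSemidef.zero
  | succ n ih =>
    have hsucc : G.map (· ^ (n + 1)) - K.map (· ^ (n + 1))
        = (G.map (· ^ n) - K.map (· ^ n)).hadamard (K + (G - K))
          + (K.map (· ^ n)).hadamard (G - K) := by
      ext i j
      simp only [Matrix.sub_apply, Matrix.add_apply, Matrix.map_apply, Matrix.hadamard_apply]
      ring
    rw [hsucc]
    exact (ih.hadamard (hK.add h)).add ((posSemidef_map_pow hK n).hadamard h)

theorem posSemidef_of_block {κ : Type*} [DecidableEq κ] {M : κ → Matrix ι ι ℝ}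
    (hM : ∀ k, (M k).PosSemidef) :
    (Matrix.of fun p q : κ × ι => if p.1 = q.1 then M p.1 p.2 q.2 else 0).PosSemidef := by
  refine ⟨Matrix.IsHermitian.ext fun p q => ?_, fun c => ?_⟩
  · by_cases h : p.1 = q.1
    · simpa [h] using (hM q.1).isHermitian.apply p.2 q.2
    · simp [h, Ne.symm h]
  · have hsum := (Matrix.posSemidef_sum (c.support.image Prod.fst) fun k _ =>
      ((hM k).submatrix (Prod.snd : κ × ι → ι)).hadamard
        (gram_posSemidef fun p : κ × ι => if p.1 = k then (1 : ℝ) else 0)).2 c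
    refine hsum.trans_eq (Finsupp.sum_congr fun p hp => Finsupp.sum_congr fun q _ => ?_)
    congr 2
    rw [Matrix.sum_apply, Finset.sum_eq_single_of_mem p.1 (Finset.mem_image_of_mem _ hp)]
    · simp [Matrix.gram_apply, eq_comm]
    · intro k _ hk
      simp [Matrix.gram_apply, hk.symm]

theorem posSemidef_gram_sub_gram_comp {E : Type*} [NormedAddCommGroup E] [InnerProductSpace ℝ E]
    {B : E →L[ℝ] E} (hB : ‖B‖ ≤ 1) (v : ι → E) :
    (Matrix.gram ℝ v - Matrix.gram ℝ (B ∘ v)).PosSemidef := by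
  have hsplit : Matrix.gram ℝ v - Matrix.gram ℝ (B ∘ v)
      = (‖B‖ ^ 2 • Matrix.gram ℝ v - Matrix.gram ℝ (B ∘ v))
        + (1 - ‖B‖ ^ 2) • Matrix.gram ℝ v := by module
  rw [hsplit]
  exact (Matrix.posSemidef_opNorm_smul_gram_sub_gram v B).add
    ((gram_posSemidef v).smul (sub_nonneg.2 (pow_le_one₀ (norm_nonneg _) hB)))

end PosSemidef

/-! ### Tensor powers of square-integrable functions -/

section ToL2

variable {Z : Type*} [MeasurableSpace Z] {μ : Measure Z} {f g : Z → ℝ}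

theorem toL2_of_memLp (h : MemLp f 2 μ) : toL2 μ f = h.toLp f := dif_pos h

theorem coeFn_toL2 (h : MemLp f 2 μ) : toL2 μ f =ᵐ[μ] f := by
  rw [toL2_of_memLp h]
  exact h.coeFn_toLp

theorem toL2_congr (h : f =ᵐ[μ] g) : toL2 μ f = toL2 μ g := by
  by_cases hf : MemLp f 2 μ
  · rw [toL2_of_memLp hf, toL2_of_memLp (hf.ae_eq h)]
    exact (MemLp.toLp_eq_toLp_iff _ _).2 h
  · rw [toL2, toL2, dif_neg hf, dif_neg fun hg => hf (hg.ae_eq h.symm)]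

theorem toL2_coeFn (f : Lp ℝ 2 μ) : toL2 μ f = f := by
  rw [toL2_of_memLp (Lp.memLp f), Lp.toLp_coeFn]

theorem toL2_sum_smul {ι : Type*} (s : Finset ι) (c : ι → ℝ) {f : ι → Z → ℝ}
    (hf : ∀ i, MemLp (f i) 2 μ) :
    toL2 μ (fun z => ∑ i ∈ s, c i * f i z) = ∑ i ∈ s, c i • toL2 μ (f i) := by
  refine (toL2_congr ?_).trans (toL2_coeFn _)
  have hterm : ∀ᵐ z ∂μ, ∀ i ∈ s, (c i • toL2 μ (f i) : Lp ℝ 2 μ) z = c i * f i z := by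
    refine (Filter.eventually_all_finset s).2 fun i _ => ?_
    filter_upwards [Lp.coeFn_smul (c i) (toL2 μ (f i)), coeFn_toL2 (hf i)] with z hsmul hfi
    rw [hsmul, Pi.smul_apply, hfi, smul_eq_mul]
  filter_upwards [Lp.coeFn_finsetSum s fun i => c i • toL2 μ (f i), hterm] with z hsum hz
  rw [hsum, Finset.sum_apply]
  exact Finset.sum_congr rfl fun i hi => (hz i hi).symm

theorem inner_toL2 (hf : MemLp f 2 μ) (hg : MemLp g 2 μ) :
    inner ℝ (toL2 μ f) (toL2 μ g) = ∫ z, f z * g z ∂μ := by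
  rw [L2.inner_def]
  refine integral_congr_ae ?_
  filter_upwards [coeFn_toL2 hf, coeFn_toL2 hg] with z hfz hgz
  rw [hfz, hgz, real_inner_eq_re_inner, RCLike.inner_apply', conj_trivial, RCLike.re_to_real]

end ToL2

section Tensor

variable {Z : Type*} [MeasurableSpace Z] (τ : Measure Z)

/-- The class of `(z₁, …, zₙ) ↦ f₁(z₁) ⋯ fₙ(zₙ)`. -/
def tensorL2 {n : ℕ} (f : Fin n → Lp ℝ 2 τ) : Lp ℝ 2 (weightedPow τ n) :=
  toL2 _ fun z => ∏ i, f i (z i)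

variable [SigmaFinite τ]

theorem quasiMeasurePreserving_eval_weightedPow {n : ℕ} (i : Fin n) :
    Measure.QuasiMeasurePreserving (Function.eval i) (weightedPow τ n) τ :=
  (Measure.quasiMeasurePreserving_eval (fun _ => τ) i).mono_left Measure.smul_absolutelyContinuous

theorem memLp_tensor {n : ℕ} (f : Fin n → Lp ℝ 2 τ) :
    MemLp (fun z : Fin n → Z => ∏ i, f i (z i)) 2 (weightedPow τ n) := by
  refine MemLp.smul_measure ?_ (ENNReal.natCast_ne_top _)
  have hmeas : Measurable fun z : Fin n → Z => ∏ i, f i (z i) :=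
    Finset.measurable_prod _ fun i _ =>
      (Lp.stronglyMeasurable (f i)).measurable.comp (measurable_pi_apply i)
  rw [memLp_two_iff_integrable_sq hmeas.aestronglyMeasurable]
  simp_rw [← Finset.prod_pow]
  exact Integrable.fintype_prod (f := fun i z => f i z ^ 2) fun i => (Lp.memLp (f i)).integrable_sq

theorem coeFn_tensorL2 {n : ℕ} (f : Fin n → Lp ℝ 2 τ) :
    tensorL2 τ f =ᵐ[weightedPow τ n] fun z => ∏ i, f i (z i) :=
  coeFn_toL2 (memLp_tensor τ f)

theorem inner_tensorL2 {n : ℕ} (f g : Fin n → Lp ℝ 2 τ) :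
    inner ℝ (tensorL2 τ f) (tensorL2 τ g) = n.factorial * ∏ i, inner ℝ (f i) (g i) := by
  rw [tensorL2, tensorL2, inner_toL2 (memLp_tensor τ f) (memLp_tensor τ g), weightedPow,
    integral_smul_measure, ENNReal.toReal_natCast, smul_eq_mul]
  simp_rw [← Finset.prod_mul_distrib]
  rw [integral_fintype_prod_eq_prod fun i z => f i z * g i z]
  simp only [L2.inner_def, RCLike.inner_apply', conj_trivial]

theorem norm_tensorL2 {n : ℕ} (f : Fin n → Lp ℝ 2 τ) :
    ‖tensorL2 τ f‖ = √n.factorial * ∏ i, ‖f i‖ := by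
  rw [← sq_eq_sq₀ (norm_nonneg _) (by positivity), ← real_inner_self_eq_norm_sq, inner_tensorL2,
    mul_pow, Real.sq_sqrt (by positivity), ← Finset.prod_pow]
  simp only [real_inner_self_eq_norm_sq]

theorem coeFn_tensorL2_update {n : ℕ} (f : Fin n → Lp ℝ 2 τ) (i : Fin n) (u : Lp ℝ 2 τ) :
    tensorL2 τ (Function.update f i u)
      =ᵐ[weightedPow τ n] fun z => u (z i) * ∏ j ∈ Finset.univ \ {i}, f j (z j) := by
  filter_upwards [coeFn_tensorL2 τ (Function.update f i u)] with z hz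
  rw [hz, ← Finset.prod_update_of_mem (Finset.mem_univ i) (fun j => f j (z j))]
  exact Finset.prod_congr rfl fun j _ =>
    Function.apply_update (fun j (g : Lp ℝ 2 τ) => g (z j)) f i u j

/-- The tensor product as a continuous multilinear map. -/
def tensorCMM (n : ℕ) :
    ContinuousMultilinearMap ℝ (fun _ : Fin n => Lp ℝ 2 τ) (Lp ℝ 2 (weightedPow τ n)) :=
  MultilinearMap.mkContinuous
    { toFun := tensorL2 τ
      map_update_add' := by
        intro inst f i x y
        obtain rfl : inst = instDecidableEqFin n := Subsingleton.elim _ _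
        refine Lp.ext ?_
        filter_upwards [coeFn_tensorL2_update τ f i (x + y), coeFn_tensorL2_update τ f i x,
          coeFn_tensorL2_update τ f i y, Lp.coeFn_add (tensorL2 τ (Function.update f i x))
          (tensorL2 τ (Function.update f i y)), (quasiMeasurePreserving_eval_weightedPow τ i).ae
          (Lp.coeFn_add x y)] with z hxy hx hy hadd heval
        rw [hadd, Pi.add_apply, hxy, hx, hy, ← add_mul]
        exact congrArg (· * _) heval
      map_update_smul' := by
        intro inst f i c x
        obtain rfl : inst = instDecidableEqFin n := Subsingleton.elim _ _
        refine Lp.ext ?_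
        filter_upwards [coeFn_tensorL2_update τ f i (c • x), coeFn_tensorL2_update τ f i x,
          Lp.coeFn_smul c (tensorL2 τ (Function.update f i x)),
          (quasiMeasurePreserving_eval_weightedPow τ i).ae (Lp.coeFn_smul c x)]
          with z hcx hx hsmul heval
        rw [hsmul, Pi.smul_apply, hcx, hx, smul_eq_mul, ← mul_assoc]
        exact congrArg (· * _) heval }
    (√n.factorial) fun f => (norm_tensorL2 τ f).le

/-- The derivative of `f ↦ f^{⊗n}` at `x.1` in the direction `x.2`. -/
def tensorPowDeriv (n : ℕ) (x : Lp ℝ 2 τ × Lp ℝ 2 τ) : Lp ℝ 2 (weightedPow τ n) :=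
  ∑ i, tensorL2 τ (Function.update (fun _ => x.1) i x.2)

theorem hasFDerivAt_tensorPow (n : ℕ) (f : Lp ℝ 2 τ) :
    HasFDerivAt (tensorPow τ n) (((tensorCMM τ n).linearDeriv fun _ => f).comp
      (ContinuousLinearMap.pi fun _ => ContinuousLinearMap.id ℝ (Lp ℝ 2 τ))) f :=
  HasFDerivAt.comp (g := tensorCMM τ n) (f := fun (h : Lp ℝ 2 τ) (_ : Fin n) => h) f
    ((tensorCMM τ n).hasFDerivAt fun _ => f)
    (ContinuousLinearMap.pi fun _ : Fin n => ContinuousLinearMap.id ℝ (Lp ℝ 2 τ)).hasFDerivAt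

theorem continuous_tensorPow (n : ℕ) : Continuous (tensorPow τ n) :=
  continuous_iff_continuousAt.2 fun f => (hasFDerivAt_tensorPow τ n f).continuousAt

theorem linearDeriv_tensorCMM (n : ℕ) (x : Lp ℝ 2 τ × Lp ℝ 2 τ) :
    (tensorCMM τ n).linearDeriv (fun _ => x.1) (fun _ => x.2) = tensorPowDeriv τ n x :=
  ContinuousMultilinearMap.linearDeriv_apply ..

theorem tendsto_slope_tensorPow (n : ℕ) {x : Lp ℝ 2 τ × Lp ℝ 2 τ}
    {S : ℝ≥0 → Lp ℝ 2 τ →L[ℝ] Lp ℝ 2 τ} (hS : IsContractionSemigroup S) (hx : x ∈ genGraph S) :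
    Tendsto (fun t : ℝ≥0 => (t : ℝ)⁻¹ • (tensorPow τ n x.1 - tensorPow τ n (S t x.1))) (𝓝[>] 0)
      (𝓝 (tensorPowDeriv τ n x)) := by
  have hzero : Tendsto (fun t => S t x.1 - x.1) (𝓝[>] 0) (𝓝 0) := by
    have hcont := ((hS.cont x.1).tendsto 0).sub_const x.1
    rw [hS.zero, ContinuousLinearMap.id_apply, sub_self] at hcont
    exact hcont.mono_left nhdsWithin_le_nhds
  have hx' : Tendsto (fun t : ℝ≥0 => (t : ℝ)⁻¹ • (x.1 - S t x.1)) (𝓝[>] 0) (𝓝 x.2) := hx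
  have hlim := (hasFDerivAt_tensorPow τ n x.1).hasFDerivWithinAt.lim (s := univ)
    (c := fun t : ℝ≥0 => -(t : ℝ)⁻¹) hzero (Eventually.of_forall fun _ => mem_univ _)
    (hx'.congr fun t => by rw [neg_smul, ← smul_neg, neg_sub])
  rw [← linearDeriv_tensorCMM]
  refine hlim.congr fun t => ?_
  rw [neg_smul, ← smul_neg, neg_sub, add_sub_cancel]

theorem inner_tensorPow (n : ℕ) (f g : Lp ℝ 2 τ) :
    inner ℝ (tensorPow τ n f) (tensorPow τ n g) = n.factorial * inner ℝ f g ^ n := by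
  refine (inner_tensorL2 τ (fun _ : Fin n => f) fun _ => g).trans ?_
  rw [Finset.prod_const, Finset.card_univ, Fintype.card_fin]

theorem inner_tensorPowDeriv_tensorPow (n : ℕ) (x : Lp ℝ 2 τ × Lp ℝ 2 τ) (h : Lp ℝ 2 τ) :
    inner ℝ (tensorPowDeriv τ n x) (tensorPow τ n h)
      = n.factorial * n * inner ℝ x.1 h ^ (n - 1) * inner ℝ x.2 h := by
  have hterm (i : Fin n) :
      inner ℝ (tensorL2 τ (Function.update (fun _ => x.1) i x.2)) (tensorPow τ n h)
        = n.factorial * (inner ℝ x.2 h * inner ℝ x.1 h ^ (n - 1)) := by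
    refine (inner_tensorL2 τ _ fun _ => h).trans ?_
    congr 1
    calc ∏ j, inner ℝ (Function.update (fun _ => x.1) i x.2 j) h
        = ∏ j, Function.update (fun _ => inner ℝ x.1 h) i (inner ℝ x.2 h) j :=
          Finset.prod_congr rfl fun j _ =>
            Function.apply_update (fun _ (g : Lp ℝ 2 τ) => inner ℝ g h) _ i x.2 j
      _ = inner ℝ x.2 h * inner ℝ x.1 h ^ (n - 1) := by
          simp [Finset.prod_update_of_mem, Finset.card_sdiff]
  rw [tensorPowDeriv, sum_inner, Finset.sum_congr rfl fun i _ => hterm i, Finset.sum_const,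
    Finset.card_univ, Fintype.card_fin, nsmul_eq_mul]
  ring

end Tensor

/-! ### Second quantization -/

section FockPow

variable {Z : Type*} [MeasurableSpace Z] (τ : Measure Z)

instance fockN.instCompleteSpace (n : ℕ) : CompleteSpace (fockN τ n) :=
  Submodule.topologicalClosure.completeSpace _

theorem tensorPow_mem_fockN (n : ℕ) (f : Lp ℝ 2 τ) : tensorPow τ n f ∈ fockN τ n :=
  Submodule.le_topologicalClosure _ (Submodule.subset_span (mem_range_self f))

theorem inner_fockPow_left (n : ℕ) (f : Lp ℝ 2 τ) (F : Fock τ) :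
    inner ℝ (fockPow τ n f) F = inner ℝ (tensorPow τ n f) (F n : Lp ℝ 2 (weightedPow τ n)) :=
  lp.inner_single_left ..

variable [SigmaFinite τ]

theorem inner_fockPow (n m : ℕ) (f g : Lp ℝ 2 τ) :
    inner ℝ (fockPow τ n f) (fockPow τ m g)
      = if n = m then n.factorial * inner ℝ f g ^ n else 0 := by
  rw [inner_fockPow_left, fockPow]
  split_ifs with h
  · subst h
    rw [lp.single_apply_self, inner_tensorPow]
  · rw [lp.single_apply_ne _ _ _ h, ZeroMemClass.coe_zero, inner_zero_right]

theorem topologicalClosure_span_fockPow {ι : Type*} {v : ι → Lp ℝ 2 τ} (hv : DenseRange v) :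
    (Submodule.span ℝ (range fun q : ℕ × ι => fockPow τ q.1 (v q.2))).topologicalClosure = ⊤ := by
  rw [Submodule.topologicalClosure_eq_top_iff, Submodule.eq_bot_iff]
  intro F hF
  have hpow (n : ℕ) (f : Lp ℝ 2 τ) :
      inner ℝ (tensorPow τ n f) (F n : Lp ℝ 2 (weightedPow τ n)) = 0 := by
    refine hv.induction_on (p := fun f => inner ℝ (tensorPow τ n f)
      (F n : Lp ℝ 2 (weightedPow τ n)) = 0) f
      (isClosed_eq ((continuous_tensorPow τ n).inner continuous_const) continuous_const) fun i => ?_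
    rw [← inner_fockPow_left]
    exact (Submodule.mem_orthogonal _ _).1 hF _ (Submodule.subset_span ⟨(n, i), rfl⟩)
  refine lp.ext (funext fun n => Subtype.ext (inner_self_eq_zero (𝕜 := ℝ).1 ?_))
  have hle : fockN τ n ≤ (ℝ ∙ (F n : Lp ℝ 2 (weightedPow τ n)))ᗮ :=
    Submodule.topologicalClosure_minimal _ (Submodule.span_le.2 (range_subset_iff.2 fun f =>
      Submodule.mem_orthogonal_singleton_iff_inner_left.2 (hpow n f)))
      (Submodule.isClosed_orthogonal _)
  exact Submodule.mem_orthogonal_singleton_iff_inner_left.1 (hle (F n).2)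

theorem posSemidef_gram_fockPow_sub {B : Lp ℝ 2 τ →L[ℝ] Lp ℝ 2 τ} (hB : ‖B‖ ≤ 1) :
    (Matrix.gram ℝ (fun q : ℕ × Lp ℝ 2 τ => fockPow τ q.1 q.2)
      - Matrix.gram ℝ fun q : ℕ × Lp ℝ 2 τ => fockPow τ q.1 (B q.2)).PosSemidef := by
  have hblock (n : ℕ) := (posSemidef_map_pow_sub_map_pow (gram_posSemidef (B ∘ id))
    (posSemidef_gram_sub_gram_comp hB id) n).smul (Nat.cast_nonneg (α := ℝ) n.factorial)
  convert posSemidef_of_block hblock using 1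
  ext p q
  simp only [Matrix.sub_apply, Matrix.smul_apply, Matrix.map_apply, Matrix.gram_apply,
    Matrix.of_apply, inner_fockPow, Function.comp_apply, id, smul_eq_mul]
  split_ifs <;> ring

theorem fockExp_fockPow {B : Lp ℝ 2 τ →L[ℝ] Lp ℝ 2 τ} (hB : ‖B‖ ≤ 1) (n : ℕ) (f : Lp ℝ 2 τ) :
    fockExp τ B (fockPow τ n f) = fockPow τ n (B f) := by
  obtain ⟨C, hC⟩ := exists_clm_apply_eq_of_gram_le
    (topologicalClosure_span_fockPow τ (v := id) denseRange_id) (posSemidef_gram_fockPow_sub τ hB)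
  have h : ∃ C : Fock τ →L[ℝ] Fock τ, ∀ n f, C (fockPow τ n f) = fockPow τ n (B f) :=
    ⟨C, fun n f => hC (n, f)⟩
  rw [fockExp, dif_pos h]
  exact h.choose_spec n f

theorem tensorPowDeriv_mem_fockN (n : ℕ) (x : Lp ℝ 2 τ × Lp ℝ 2 τ) :
    tensorPowDeriv τ n x ∈ fockN τ n := by
  have hline : HasDerivAt (fun t : ℝ => x.1 + t • x.2) x.2 0 := by
    simpa only [id, one_smul] using ((hasDerivAt_id (0 : ℝ)).smul_const x.2).const_add x.1
  have hpow : HasFDerivAt (tensorPow τ n) _ (x.1 + (0 : ℝ) • x.2) := hasFDerivAt_tensorPow τ n _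
  have hderiv : deriv (fun t : ℝ => tensorPow τ n (x.1 + t • x.2)) 0 = tensorPowDeriv τ n x := by
    refine (hpow.comp_hasDerivAt 0 hline).deriv.trans ?_
    rw [zero_smul, add_zero]
    exact linearDeriv_tensorCMM τ n x
  have hmem := range_deriv_subset_closure_span_image
    (fun t : ℝ => tensorPow τ n (x.1 + t • x.2)) dense_univ (mem_range_self 0)
  rw [hderiv] at hmem
  refine closure_mono (Submodule.span_mono ?_) hmem
  rintro _ ⟨t, -, rfl⟩
  exact mem_range_self _

/-- The derivative of `f ↦ f^{⊗n}` at `x.1` in the direction `x.2`, in the Fock space. -/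
def fockPowDeriv (n : ℕ) (x : Lp ℝ 2 τ × Lp ℝ 2 τ) : Fock τ :=
  lp.single 2 n ⟨tensorPowDeriv τ n x, tensorPowDeriv_mem_fockN τ n x⟩

theorem inner_fockPowDeriv_fockPow (n m : ℕ) (x : Lp ℝ 2 τ × Lp ℝ 2 τ) (h : Lp ℝ 2 τ) :
    inner ℝ (fockPowDeriv τ n x) (fockPow τ m h) = if n = m then
      n.factorial * n * inner ℝ x.1 h ^ (n - 1) * inner ℝ x.2 h else 0 := by
  rw [fockPowDeriv, lp.inner_single_left, fockPow]
  split_ifs with hnm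
  · subst hnm
    rw [lp.single_apply_self, Submodule.coe_inner, inner_tensorPowDeriv_tensorPow]
  · rw [lp.single_apply_ne _ _ _ hnm, inner_zero_right]

theorem fockPow_fockPowDeriv_mem_graph_dExp {A : Lp ℝ 2 τ →ₗ.[ℝ] Lp ℝ 2 τ}
    (hA : IsPosSelfAdjoint A) (n : ℕ) {x : Lp ℝ 2 τ × Lp ℝ 2 τ} (hx : x ∈ A.graph) :
    (fockPow τ n x.1, fockPowDeriv τ n x) ∈ (dExp τ A).graph := by
  obtain ⟨hS, hgen⟩ := hA.expNeg_spec
  rw [dExp, graph_semigroupGenerator]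
  have hslope := tendsto_slope_tensorPow τ n hS (x := x)
    (by rwa [← graph_semigroupGenerator, hgen])
  let y (f : Lp ℝ 2 τ) : fockN τ n := ⟨tensorPow τ n f, tensorPow_mem_fockN τ n f⟩
  have hfock : Tendsto (fun t : ℝ≥0 => (t : ℝ)⁻¹ • (y x.1 - y (expNeg A t x.1))) (𝓝[>] 0)
      (𝓝 ⟨tensorPowDeriv τ n x, tensorPowDeriv_mem_fockN τ n x⟩) := tendsto_subtype_rng.2 hslope
  have hsingle := (lp.isometry_single (E := fun n : ℕ => fockN τ n) (p := 2) n).continuous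
  refine ((hsingle.tendsto _).comp hfock).congr fun t => ?_
  rw [Function.comp_apply, lp.single_smul, lp.single_sub, fockExp_fockPow τ (hS.norm_le t)]
  rfl

end FockPow

/-! ### Charlier polynomials of finite configurations -/

section CharlierAlgebra

variable {ι : Type*}

theorem fin_univ_erase {n : ℕ} (i : Fin (n + 1)) :
    Finset.univ.erase i = Finset.univ.map i.succAboveEmb := by
  rw [Fin.univ_succAbove n i, Finset.cons_eq_insert, Finset.erase_insert (by simp)]

theorem fin_univ_val_map {α : Type*} {n : ℕ} (x : Fin (n + 1) → α) (i : Fin (n + 1)) :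
    Finset.univ.val.map x = x i ::ₘ Finset.univ.val.map (i.removeNth x) := by
  rw [Fin.univ_succAbove n i, Finset.cons_val, Multiset.map_cons, Finset.map_val, Multiset.map_map]
  rfl

theorem derivation_prod {R A : Type*} [CommSemiring R] [CommSemiring A] [Algebra R A]
    [DecidableEq ι] (D : Derivation R A A) (f : ι → A) (s : Finset ι) :
    D (∏ i ∈ s, f i) = ∑ i ∈ s, D (f i) * ∏ j ∈ s.erase i, f j := by
  induction s using Finset.induction_on with
  | empty => simp
  | insert i s hi ih =>
    have herase : ∀ j ∈ s, ∏ k ∈ (insert i s).erase j, f k = f i * ∏ k ∈ s.erase j, f k :=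
      fun j hj => by
        rw [Finset.erase_insert_of_ne (ne_of_mem_of_not_mem hj hi).symm,
          Finset.prod_insert fun h => hi (Finset.mem_of_mem_erase h)]
    have hsum : ∑ j ∈ s, D (f j) * ∏ k ∈ (insert i s).erase j, f k
        = f i * ∑ j ∈ s, D (f j) * ∏ k ∈ s.erase j, f k := by
      rw [Finset.mul_sum]
      exact Finset.sum_congr rfl fun j hj => by rw [herase j hj, mul_left_comm]
    rw [Finset.prod_insert hi, D.leibniz, ih, Finset.sum_insert hi, Finset.erase_insert hi, hsum,
      smul_eq_mul, smul_eq_mul, add_comm, mul_comm (D (f i))]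

open PowerSeries in
/-- The value of `Q_n(φ^{⊗n})` at a finite configuration, where `x` lists the values of `φ` at its
points and `a` is the integral of `φ`. It is read off the generating function
`∑ₙ tⁿ Q_n(φ^{⊗n}) / n! = e^{-at} ∏ (1 + t φ(z))`. -/
def charlierVal (a : ℝ) (x : Multiset ℝ) (n : ℕ) : ℝ :=
  n.factorial * coeff n (rescale (-a) (exp ℝ) * (x.map fun w => 1 + C w * X).prod)

theorem charlierVal_nil (a : ℝ) (n : ℕ) : charlierVal a 0 n = (-a) ^ n := by
  simp only [charlierVal, Multiset.map_zero, Multiset.prod_zero, mul_one,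
    PowerSeries.coeff_rescale, PowerSeries.coeff_exp, one_div, map_inv₀, map_natCast]
  rw [mul_left_comm, mul_inv_cancel₀ (by positivity), mul_one]

theorem charlierVal_cons (a w : ℝ) (x : Multiset ℝ) (n : ℕ) :
    charlierVal a (w ::ₘ x) n = charlierVal a x n + n * w * charlierVal a x (n - 1) := by
  simp only [charlierVal, Multiset.map_cons, Multiset.prod_cons]
  rw [mul_left_comm, add_mul, one_mul, map_add, mul_assoc, PowerSeries.coeff_C_mul]
  cases n with
  | zero => simp
  | succ n =>
    rw [PowerSeries.coeff_succ_X_mul, Nat.factorial_succ, Nat.add_sub_cancel]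
    push_cast
    ring

theorem charlierVal_zero_right (a : ℝ) (x : Multiset ℝ) : charlierVal a x 0 = 1 := by
  induction x using Multiset.induction_on with
  | empty => rw [charlierVal_nil, pow_zero]
  | cons w x ih => simp [charlierVal_cons, ih]

open PowerSeries in
theorem charlierVal_succ (a : ℝ) {N : ℕ} (x : Fin (N + 1) → ℝ) (n : ℕ) :
    charlierVal a (Finset.univ.val.map x) (n + 1)
      = -a * charlierVal a (Finset.univ.val.map x) n
        + ∑ i, x i * charlierVal a (Finset.univ.val.map (i.removeNth x)) n := by
  have hexp : d⁄dX ℝ (rescale (-a) (exp ℝ)) = C (-a) * rescale (-a) (exp ℝ) := by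
    ext m
    simp only [coeff_derivative, coeff_rescale, coeff_exp, coeff_C_mul, Nat.factorial_succ,
      Nat.cast_mul, Nat.cast_add, Nat.cast_one, one_div, mul_inv_rev, map_inv₀, map_mul, map_add,
      map_one, map_natCast, neg_mul]
    field_simp
    ring
  have hprod : d⁄dX ℝ (∏ i, (1 + C (x i) * X))
      = ∑ i, C (x i) * ∏ j, (1 + C (i.removeNth x j) * X) := by
    rw [derivation_prod]
    refine Finset.sum_congr rfl fun i _ => ?_
    rw [fin_univ_erase, Finset.prod_map]
    simp [Fin.removeNth]
  have hcoeff : ∀ f : ℝ⟦X⟧, ((n + 1).factorial : ℝ) * coeff (n + 1) f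
      = n.factorial * coeff n (d⁄dX ℝ f) := fun f => by
    rw [coeff_derivative, Nat.factorial_succ]
    push_cast
    ring
  simp only [charlierVal, Multiset.map_map, Function.comp_def, Finset.prod_map_val, hcoeff,
    Derivation.leibniz, hexp, hprod, smul_eq_mul, map_add, Finset.mul_sum, map_sum,
    mul_left_comm _ (C _), coeff_C_mul]
  rw [mul_comm (∏ i, _), add_comm, mul_add, Finset.mul_sum, mul_left_comm]
  exact congrArg _ (Finset.sum_congr rfl fun i _ => mul_left_comm _ _ _)

theorem continuous_charlierVal (a : ℝ) (N n : ℕ) :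
    Continuous fun x : Fin N → ℝ => charlierVal a (Finset.univ.val.map x) n := by
  induction N generalizing n with
  | zero => exact continuous_of_discreteTopology
  | succ N ih =>
    have htail : Continuous fun x : Fin (N + 1) → ℝ => (0 : Fin (N + 1)).removeNth x :=
      continuous_pi fun i => continuous_apply _
    simp only [fin_univ_val_map _ 0, charlierVal_cons]
    exact ((ih n).comp htail).add
      ((continuous_const.mul (continuous_apply 0)).mul ((ih _).comp htail))

/-- The alternating sum of `a` over the subsets of `s`. -/
def altSum (a : Finset ι → ℝ) (s : Finset ι) : ℝ :=
  ∑ S ∈ s.powerset, (-1 : ℝ) ^ (s.card + S.card) * a S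

theorem altSum_charlierVal_cons (a : ι → ℝ) (w : ι → ℝ) (x : List (ι → ℝ)) (k : ℕ)
    (s : Finset ι) :
    altSum (fun S => charlierVal (∑ i ∈ S, a i) ((w :: x).map fun w => ∑ i ∈ S, w i) (k + 1)) s
      = altSum (fun S => charlierVal (∑ i ∈ S, a i) (x.map fun w => ∑ i ∈ S, w i) (k + 1)) s
        + (k + 1) * altSum (fun S => (∑ i ∈ S, w i) *
            charlierVal (∑ i ∈ S, a i) (x.map fun w => ∑ i ∈ S, w i) k) s := by
  rw [altSum, altSum, altSum, Finset.mul_sum, ← Finset.sum_add_distrib]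
  refine Finset.sum_congr rfl fun S _ => ?_
  rw [List.map_cons, ← Multiset.cons_coe, charlierVal_cons, Nat.add_sub_cancel, Nat.cast_succ]
  generalize ∑ i ∈ S, w i = c
  ring

variable [DecidableEq ι]

/-- The value of `Q(⊗_{i ∈ s} ψ_i)` at a finite configuration, where `x` lists the vectors
`(ψ_i(z))_i` for the points `z` of the configuration and `a i` is the integral of `ψ_i`. -/
def charlierOn (a : ι → ℝ) : List (ι → ℝ) → Finset ι → ℝ
  | [], s => ∏ i ∈ s, -a i
  | w :: x, s => charlierOn a x s + ∑ i ∈ s, w i * charlierOn a x (s.erase i)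

theorem charlierOn_congr {a a' : ι → ℝ} {s : Finset ι} (ha : ∀ i ∈ s, a i = a' i)
    (f : (ι → ℝ) → ι → ℝ) (hf : ∀ w, ∀ i ∈ s, f w i = w i) (x : List (ι → ℝ)) :
    charlierOn a (x.map f) s = charlierOn a' x s := by
  induction x generalizing s with
  | nil => exact Finset.prod_congr rfl fun i hi => by rw [ha i hi]
  | cons w x ih =>
    have herase : ∀ i, charlierOn a (x.map f) (s.erase i) = charlierOn a' x (s.erase i) := fun i =>
      ih (fun j hj => ha j (Finset.mem_of_mem_erase hj))
        fun w j hj => hf w j (Finset.mem_of_mem_erase hj)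
    rw [List.map_cons, charlierOn, charlierOn, ih ha hf]
    exact congrArg _ (Finset.sum_congr rfl fun i hi => by rw [hf w i hi, herase])

theorem charlierOn_map {κ : Type*} [DecidableEq κ] (a : ι → ℝ) (x : List (ι → ℝ)) (e : κ ↪ ι)
    (s : Finset κ) :
    charlierOn a x (s.map e) = charlierOn (a ∘ e) (x.map fun w => w ∘ e) s := by
  induction x generalizing s with
  | nil => exact Finset.prod_map s e _
  | cons w x ih =>
    rw [List.map_cons, charlierOn, charlierOn, ih, Finset.sum_map]
    exact congrArg _ (Finset.sum_congr rfl fun i _ => by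
      rw [← Finset.map_erase, ih, Function.comp_apply])

theorem charlierOn_const (a : ℝ) (x : List ℝ) (s : Finset ι) :
    charlierOn (fun _ => a) (x.map fun w _ => w) s = charlierVal a x s.card := by
  induction x generalizing s with
  | nil =>
    rw [List.map_nil, charlierOn, Finset.prod_const, Multiset.coe_nil, charlierVal_nil]
  | cons w x ih =>
    rw [List.map_cons, charlierOn, ih, ← Multiset.cons_coe, charlierVal_cons,
      Finset.sum_congr rfl fun i hi => by rw [ih, Finset.card_erase_of_mem hi], Finset.sum_const,
      nsmul_eq_mul, mul_assoc]

/-- The values `w j` of the `ψ_j` at a point after `ψ_i` has been replaced by `ψ_k ψ_i`. -/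
def mulCoord (k i : ι) (w : ι → ℝ) : ι → ℝ := Function.update w i (w k * w i)

theorem charlierOn_cons_mulCoord (a b : ι → ℝ) (w : ι → ℝ) (x : List (ι → ℝ)) (k : ι) {i : ι}
    {s : Finset ι} (hi : i ∈ s) :
    charlierOn (Function.update a i (b i)) ((w :: x).map (mulCoord k i)) s
      = charlierOn (Function.update a i (b i)) (x.map (mulCoord k i)) s
        + w k * w i * charlierOn a x (s.erase i)
        + ∑ j ∈ s.erase i, w j *
          charlierOn (Function.update a i (b i)) (x.map (mulCoord k i)) (s.erase j) := by
  have hne : ∀ w : ι → ℝ, ∀ j ∈ s.erase i, mulCoord k i w j = w j := fun w j hj =>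
    Function.update_of_ne (Finset.ne_of_mem_erase hj) _ _
  have herase : charlierOn (Function.update a i (b i)) (x.map (mulCoord k i)) (s.erase i)
      = charlierOn a x (s.erase i) :=
    charlierOn_congr (fun j hj => Function.update_of_ne (Finset.ne_of_mem_erase hj) _ _) _ hne x
  rw [List.map_cons, charlierOn, ← Finset.add_sum_erase s _ hi, herase, ← add_assoc,
    Finset.sum_congr rfl fun j hj => by rw [hne w j hj], mulCoord, Function.update_self]

/-- The recursion defining `charlierQ`, at the level of values; `b i` plays the role of the integral
of `ψ_k ψ_i`. -/
theorem charlierOn_insert (a b : ι → ℝ) (x : List (ι → ℝ)) {k : ι} {s : Finset ι} (hk : k ∉ s) :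
    charlierOn a x (insert k s)
      = charlierOn a x s * ((x.map fun w => w k).sum - a k)
        - ∑ i ∈ s, charlierOn (Function.update a i (b i)) (x.map (mulCoord k i)) s
        - ∑ i ∈ s, b i * charlierOn a x (s.erase i) := by
  induction x generalizing s with
  | nil =>
    have hprod : ∀ i ∈ s, ∏ j ∈ s, -Function.update a i (b i) j = -b i * ∏ j ∈ s.erase i, -a j := by
      intro i hi
      rw [← Finset.mul_prod_erase s _ hi, Function.update_self]
      congr 1
      refine Finset.prod_congr rfl fun j hj => ?_
      rw [Function.update_of_ne (Finset.ne_of_mem_erase hj)]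
    simp only [List.map_nil, List.sum_nil, charlierOn, Finset.prod_insert hk,
      Finset.sum_congr rfl hprod, neg_mul, Finset.sum_neg_distrib]
    ring
  | cons w x ih =>
    have hcons := fun i (hi : i ∈ s) => charlierOn_cons_mulCoord a b w x k hi
    have hsub : ∀ i ∈ s, w i * charlierOn a x ((insert k s).erase i)
        = w i * (charlierOn a x (s.erase i) * ((x.map fun w => w k).sum - a k)
          - ∑ j ∈ s.erase i,
            charlierOn (Function.update a j (b j)) (x.map (mulCoord k j)) (s.erase i)
          - ∑ j ∈ s.erase i, b j * charlierOn a x ((s.erase i).erase j)) := fun i hi => by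
      rw [Finset.erase_insert_of_ne (ne_of_mem_of_not_mem hi hk).symm,
        ih fun h => hk (Finset.mem_of_mem_erase h)]
    have hswap : ∀ f : ι → ι → ℝ,
        ∑ i ∈ s, ∑ j ∈ s.erase i, f i j = ∑ j ∈ s, ∑ i ∈ s.erase j, f i j := fun f =>
      Finset.sum_comm' fun i j => by
        simp only [Finset.mem_erase]
        tauto
    rw [charlierOn, charlierOn, Finset.sum_insert hk, Finset.erase_insert hk, ih hk,
      Finset.sum_congr rfl hcons, Finset.sum_congr rfl hsub]
    simp only [charlierOn, List.map_cons, List.sum_cons, mul_add, mul_sub, Finset.sum_add_distrib,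
      Finset.sum_sub_distrib, Finset.mul_sum, add_mul, Finset.sum_mul]
    rw [hswap fun i j => w j * _]
    rw [hswap fun i j => b i * _]
    simp only [Finset.erase_right_comm, mul_left_comm (b _), mul_assoc, mul_left_comm (w k)]
    simp only [mul_comm, mul_left_comm]
    ring

theorem charlierOn_empty (a : ι → ℝ) (x : List (ι → ℝ)) : charlierOn a x ∅ = 1 := by
  induction x with
  | nil => rfl
  | cons w x ih => rw [charlierOn, ih, Finset.sum_empty, add_zero]

theorem charlierOn_univ_succ {n : ℕ} (a : Fin (n + 1) → ℝ) (b : Fin n → ℝ)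
    (x : List (Fin (n + 1) → ℝ)) :
    charlierOn a x Finset.univ
      = charlierOn (Fin.tail a) (x.map Fin.tail) Finset.univ * ((x.map fun w => w 0).sum - a 0)
        - ∑ i, charlierOn (Function.update (Fin.tail a) i (b i))
            (x.map fun w => Function.update (Fin.tail w) i (w 0 * w i.succ)) Finset.univ
        - ∑ i, b i * charlierOn (Fin.tail a) (x.map Fin.tail) (Finset.univ.erase i) := by
  have hmap : ∀ (a : Fin (n + 1) → ℝ) (x : List (Fin (n + 1) → ℝ)) (s : Finset (Fin n)),
      charlierOn a x (s.map ⟨Fin.succ, Fin.succ_injective n⟩)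
        = charlierOn (Fin.tail a) (x.map Fin.tail) s :=
    fun a x s => charlierOn_map a x (Fin.succEmb n) s
  have htail : ∀ (w : Fin (n + 1) → ℝ) (i : Fin n) (c : ℝ),
      Fin.tail (Function.update w i.succ c) = Function.update (Fin.tail w) i c := fun w i c =>
    Fin.tail_update_succ w i c
  rw [Fin.univ_succ, Finset.cons_eq_insert,
    charlierOn_insert a (Fin.cons 0 b : Fin (n + 1) → ℝ) x (by simp), Finset.sum_map,
    Finset.sum_map, hmap]
  have herase : ∀ i : Fin n,
      (Finset.univ.map ⟨Fin.succ, Fin.succ_injective n⟩).erase i.succ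
        = (Finset.univ.erase i).map ⟨Fin.succ, Fin.succ_injective n⟩ := fun i =>
    (Finset.map_erase (Fin.succEmb n) _ _).symm
  have hmul : ∀ i : Fin n, Fin.tail ∘ mulCoord 0 i.succ
      = fun w : Fin (n + 1) → ℝ => Function.update (Fin.tail w) i (w 0 * w i.succ) := fun i =>
    funext fun w => htail w i _
  simp only [Function.Embedding.coeFn_mk, herase, hmap, htail, List.map_map, hmul, Fin.cons_succ]

theorem altSum_sum_mul (a : Finset ι → ℝ) (y : ι → ℝ) (s : Finset ι) :
    altSum (fun S => (∑ i ∈ S, y i) * a S) s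
      = ∑ i ∈ s, y i * (altSum a s + altSum a (s.erase i)) := by
  have h1 : ∀ i ∈ s, altSum a s + altSum a (s.erase i)
      = ∑ S ∈ s.powerset with i ∈ S, (-1 : ℝ) ^ (s.card + S.card) * a S := fun i hi => by
    have e : s.powerset.filter (fun S => i ∉ S) = (s.erase i).powerset := by
      ext S
      simp only [Finset.mem_filter, Finset.mem_powerset, Finset.subset_erase]
    rw [altSum, altSum, ← Finset.sum_filter_add_sum_filter_not s.powerset (fun S => i ∈ S), e,
      add_assoc, ← Finset.sum_add_distrib, ← Finset.card_erase_add_one hi]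
    rw [Finset.sum_eq_zero (s := (s.erase i).powerset), add_zero]
    intro S _
    ring
  rw [Finset.sum_congr rfl fun i hi => by rw [h1 i hi]]
  simp only [altSum, Finset.mul_sum, Finset.sum_mul, Finset.sum_filter]
  rw [Finset.sum_comm]
  refine Finset.sum_congr rfl fun S hS => ?_
  simp only [mul_ite, mul_zero]
  rw [← Finset.sum_filter, Finset.filter_mem_eq_inter,
    Finset.inter_eq_right.2 (Finset.mem_powerset.1 hS)]
  exact Finset.sum_congr rfl fun i _ => by ring

theorem altSum_one (s : Finset ι) : altSum (fun _ => 1) s = if s = ∅ then 1 else 0 := by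
  have h := Finset.sum_powerset_neg_one_pow_card (x := s)
  have h' : ∑ S ∈ s.powerset, (-1 : ℝ) ^ S.card = if s = ∅ then 1 else 0 := by
    exact_mod_cast h
  simp only [altSum, mul_one, pow_add]
  rw [← Finset.mul_sum, h']
  split_ifs with hs
  · simp [hs]
  · simp

theorem altSum_of_recursion {a : ℕ → Finset ι → ℝ} {b : Finset ι → ℝ} (s : Finset ι) {k : ℕ}
    (y : ι → ℝ) (hk : k + 1 ≤ s.card)
    (h : ∀ t : Finset ι, k ≤ t.card → altSum (a k) t
      = if k = t.card then k.factorial * b t else 0) :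
    altSum (fun S => (∑ i ∈ S, y i) * a k S) s
      = if k + 1 = s.card then k.factorial * ∑ i ∈ s, y i * b (s.erase i) else 0 := by
  rw [altSum_sum_mul]
  rw [Finset.sum_congr rfl fun i hi => by
    rw [h s (by omega), if_neg (by omega), zero_add,
      h (s.erase i) (by rw [Finset.card_erase_of_mem hi]; omega), Finset.card_erase_of_mem hi]]
  by_cases hc : k + 1 = s.card
  · rw [if_pos hc, Finset.mul_sum]
    refine Finset.sum_congr rfl fun i _ => ?_
    rw [if_pos (by omega)]
    ring
  · rw [if_neg hc]
    refine Finset.sum_eq_zero fun i _ => ?_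
    rw [if_neg (by omega), mul_zero]

omit [DecidableEq ι] in
theorem altSum_pow (x : ι → ℝ) (k : ℕ) (s : Finset ι) (hk : k ≤ s.card) :
    altSum (fun S => (∑ i ∈ S, x i) ^ k) s
      = if k = s.card then (k.factorial : ℝ) * ∏ i ∈ s, x i else 0 := by
  classical
  induction k generalizing s with
  | zero =>
    simp only [pow_zero]
    rw [altSum_one]
    rcases s.eq_empty_or_nonempty with rfl | hs
    · simp
    · rw [if_neg hs.ne_empty, if_neg hs.card_pos.ne]
  | succ k ih =>
    simp only [pow_succ']
    rw [altSum_of_recursion (a := fun k S => (∑ i ∈ S, x i) ^ k) s x hk ih]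
    split_ifs with h
    · rw [Finset.sum_congr rfl fun i hi => Finset.mul_prod_erase s x hi, Finset.sum_const,
        nsmul_eq_mul, ← h, Nat.factorial_succ]
      push_cast
      ring
    · rfl

theorem altSum_charlierVal (a : ι → ℝ) (x : List (ι → ℝ)) (k : ℕ) (s : Finset ι)
    (hk : k ≤ s.card) :
    altSum (fun S => charlierVal (∑ i ∈ S, a i) (x.map fun w => ∑ i ∈ S, w i) k) s
      = if k = s.card then k.factorial * charlierOn a x s else 0 := by
  induction x generalizing k s with
  | nil =>
    rw [charlierOn, ← altSum_pow (fun i => -a i) k s hk]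
    simp only [List.map_nil, Multiset.coe_nil, charlierVal_nil, Finset.sum_neg_distrib]
  | cons w x ih =>
    cases k with
    | zero =>
      simp only [charlierVal_zero_right, altSum_one, Nat.factorial_zero, Nat.cast_one, one_mul,
        eq_comm (a := 0), Finset.card_eq_zero]
      split_ifs with hs
      · rw [hs, charlierOn_empty]
      · rfl
    | succ k =>
      let p (k : ℕ) (S : Finset ι) : ℝ :=
        charlierVal (∑ i ∈ S, a i) (x.map fun w => ∑ i ∈ S, w i) k
      have hrec := altSum_of_recursion (a := p) s w hk (ih k)
      rw [altSum_charlierVal_cons, ih (k + 1) s hk, hrec, charlierOn, Nat.factorial_succ]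
      split_ifs with h
      · push_cast
        ring
      · simp

end CharlierAlgebra

/-! ### Charlier polynomials of marked configurations -/

section CharlierConfig

variable {X M : Type*} [TopologicalSpace X]

namespace MarkedConfig

theorem finite_inter (ω : MarkedConfig X M) {K : Set X} (hK : IsCompact K) :
    (ω.1 ∩ Prod.fst ⁻¹' K).Finite := by
  refine Finite.of_finite_image ((ω.2.2 K hK).subset ?_) (ω.2.1.mono inter_subset_left)
  rintro _ ⟨z, ⟨hz, hzK⟩, rfl⟩
  exact ⟨⟨z, hz, rfl⟩, hzK⟩

theorem addPoint_val (ω : MarkedConfig X M) {z : X × M} (hz : z.1 ∉ Prod.fst '' ω.1) :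
    (ω.addPoint z).1 = insert z ω.1 :=
  congrArg Subtype.val (dif_pos hz)

/-- The list `l` enumerates the points of `ω` over `K`, as far as sums of functions living over `K`
can tell. -/
def IsListedBy (ω : MarkedConfig X M) (K : Set X) (l : List (X × M)) : Prop :=
  ∀ f : X × M → ℝ, (∀ z, f z ≠ 0 → z.1 ∈ K) → pairing f ω = (l.map f).sum

theorem pairing_eq_sum (ω : MarkedConfig X M) {K : Set X} (hK : IsCompact K) {f : X × M → ℝ}
    (hf : ∀ z, f z ≠ 0 → z.1 ∈ K) : pairing f ω = ∑ z ∈ (ω.finite_inter hK).toFinset, f z := by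
  refine finsum_mem_eq_sum_of_inter_support_eq f ?_
  ext z
  simp only [mem_inter_iff, Function.mem_support, Finset.mem_coe, Finite.mem_toFinset,
    mem_preimage]
  exact ⟨fun h => ⟨⟨h.1, hf z h.2⟩, h.2⟩, fun h => ⟨h.1.1, h.2⟩⟩

theorem exists_isListedBy (ω : MarkedConfig X M) {K : Set X} (hK : IsCompact K) :
    ∃ l, ω.IsListedBy K l :=
  ⟨(ω.finite_inter hK).toFinset.toList, fun f hf => by
    rw [ω.pairing_eq_sum hK hf, Finset.sum_map_toList]⟩

end MarkedConfig

theorem pairing_addPoint (ω : MarkedConfig X M) {f : X × M → ℝ} {K : Set X} (hK : IsCompact K)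
    (hf : ∀ z, f z ≠ 0 → z.1 ∈ K) {z : X × M} (hz : z.1 ∉ Prod.fst '' ω.1) :
    pairing f (ω.addPoint z) = pairing f ω + f z := by
  have hfin : (ω.1 ∩ Function.support f).Finite :=
    (ω.finite_inter hK).subset fun z hz => ⟨hz.1, hf z hz.2⟩
  rw [pairing, pairing, ω.addPoint_val hz, finsum_mem_insert' f (fun h => hz ⟨z, h, rfl⟩) hfin,
    add_comm]

theorem MarkedConfig.IsListedBy.addPoint {ω : MarkedConfig X M} {K : Set X} (hK : IsCompact K)
    {l : List (X × M)} (hl : ω.IsListedBy K l) {z : X × M} (hz : z.1 ∉ Prod.fst '' ω.1) :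
    (ω.addPoint z).IsListedBy K (z :: l) := fun f hf => by
  rw [pairing_addPoint ω hK hf hz, hl f hf, List.map_cons, List.sum_cons, add_comm]

theorem fst_mem_image_tsupport [TopologicalSpace M] {φ : X × M → ℝ} {z : X × M} (hz : φ z ≠ 0) :
    z.1 ∈ Prod.fst '' tsupport φ :=
  ⟨z, subset_tsupport φ hz, rfl⟩

variable [MeasurableSpace X] [MeasurableSpace M]

theorem charlierQ_eq_charlierOn (τ : Measure (X × M)) {ω : MarkedConfig X M} {K : Set X}
    {l : List (X × M)} (hl : ω.IsListedBy K l) {n : ℕ} {φ : Fin n → X × M → ℝ}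
    (hφ : ∀ i z, φ i z ≠ 0 → z.1 ∈ K) :
    charlierQ τ ω n φ
      = charlierOn (fun i => ∫ z, φ i z ∂τ) (l.map fun z i => φ i z) Finset.univ := by
  induction n using Nat.strong_induction_on with
  | _ n ih =>
    match n, ih with
    | 0, _ => rw [charlierQ, Finset.univ_eq_empty, charlierOn_empty]
    | 1, _ =>
      rw [charlierQ, charlierOn_univ_succ _ 0, Finset.univ_eq_empty, charlierOn_empty, hl _ (hφ 0)]
      simp [Function.comp_def]
    | n + 2, ih =>
      have htail : ∀ i z, Fin.tail φ i z ≠ 0 → z.1 ∈ K := fun i => hφ i.succ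
      rw [charlierQ, charlierOn_univ_succ _ fun i => ∫ z, φ 0 z * φ i.succ z ∂τ, hl _ (hφ 0),
        ih (n + 1) (by omega) htail]
      have hupdate : ∀ i, charlierQ τ ω (n + 1)
          (Function.update (Fin.tail φ) i fun z => φ 0 z * Fin.tail φ i z)
          = charlierOn (Function.update (Fin.tail fun i => ∫ z, φ i z ∂τ) i
              (∫ z, φ 0 z * φ i.succ z ∂τ))
            (l.map fun z => Function.update (Fin.tail fun i => φ i z) i (φ 0 z * φ i.succ z))
            Finset.univ := fun i => by
        have hint := Function.comp_update (fun f => ∫ z, f z ∂τ) (Fin.tail φ) i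
          fun z => φ 0 z * Fin.tail φ i z
        have hval := fun z => Function.comp_update (fun f => f z) (Fin.tail φ) i
          fun z => φ 0 z * Fin.tail φ i z
        refine (ih (n + 1) (by omega) ?_).trans
          (congrArg₂ (charlierOn · · _) hint (List.map_congr_left fun z _ => hval z))
        exact (Function.forall_update_iff _ fun _ (f : X × M → ℝ) => ∀ z, f z ≠ 0 → z.1 ∈ K).2
          ⟨fun z h => hφ 0 z (left_ne_zero_of_mul h), fun j _ => htail j⟩
      have herase : ∀ i : Fin (n + 1), charlierQ τ ω n (fun j => Fin.tail φ (i.succAbove j))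
          = charlierOn (Fin.tail fun i => ∫ z, φ i z ∂τ)
            (l.map fun z => Fin.tail fun i => φ i z) (Finset.univ.erase i) := fun i => by
        rw [ih n (by omega) fun j => htail _, fin_univ_erase, charlierOn_map, List.map_map]
        rfl
      simp only [hupdate, herase, List.map_map, Function.comp_def]
      rfl

theorem charlierQ_const_eq_charlierVal (τ : Measure (X × M)) {ω : MarkedConfig X M} {K : Set X}
    {l : List (X × M)} (hl : ω.IsListedBy K l) (n : ℕ) {φ : X × M → ℝ}
    (hφ : ∀ z, φ z ≠ 0 → z.1 ∈ K) :
    charlierQ τ ω n (fun _ => φ) = charlierVal (∫ z, φ z ∂τ) (l.map φ) n := by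
  have h := charlierOn_const (ι := Fin n) (∫ z, φ z ∂τ) (l.map φ) Finset.univ
  rw [Finset.card_univ, Fintype.card_fin, List.map_map] at h
  rw [charlierQ_eq_charlierOn τ hl fun _ => hφ, ← h]
  rfl

theorem factorial_mul_charlierQ {τ : Measure (X × M)} {ω : MarkedConfig X M} {K : Set X}
    {l : List (X × M)} (hl : ω.IsListedBy K l) {n : ℕ} {ψ : Fin n → X × M → ℝ}
    (hψK : ∀ i z, ψ i z ≠ 0 → z.1 ∈ K) (hψ : ∀ i, Integrable (ψ i) τ) :
    n.factorial * charlierQ τ ω n ψ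
      = altSum (fun S => charlierQ τ ω n fun _ => ∑ i ∈ S, ψ i) Finset.univ := by
  have hS : ∀ S : Finset (Fin n), charlierQ τ ω n (fun _ => ∑ i ∈ S, ψ i)
      = charlierVal (∑ i ∈ S, ∫ z, ψ i z ∂τ)
        ((l.map fun z i => ψ i z).map fun w => ∑ i ∈ S, w i) n := fun S => by
    rw [charlierQ_const_eq_charlierVal τ hl n, List.map_map, ← integral_finsetSum S fun i _ => hψ i]
    · simp only [← Finset.sum_apply, Function.comp_def]
    · intro z hz
      rw [Finset.sum_apply] at hz
      obtain ⟨i, -, hi⟩ := Finset.exists_ne_zero_of_sum_ne_zero hz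
      exact hψK i z hi
  simp only [hS]
  rw [altSum_charlierVal _ _ n _ (by simp), if_pos (by simp), charlierQ_eq_charlierOn τ hl hψK]

variable [TopologicalSpace M]

theorem charlierQ_const_addPoint (τ : Measure (X × M)) {φ : X × M → ℝ} (hφ : HasCompactSupport φ)
    (ω : MarkedConfig X M) {z : X × M} (hz : z.1 ∉ Prod.fst '' ω.1) (n : ℕ) :
    charlierQ τ (ω.addPoint z) n (fun _ => φ) = charlierQ τ ω n (fun _ => φ)
      + n * charlierQ τ ω (n - 1) (fun _ => φ) * φ z := by
  have hK : IsCompact (Prod.fst '' tsupport φ) := hφ.isCompact.image continuous_fst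
  obtain ⟨l, hl⟩ := ω.exists_isListedBy hK
  simp only [charlierQ_const_eq_charlierVal τ hl _ fun _ => fst_mem_image_tsupport,
    charlierQ_const_eq_charlierVal τ (hl.addPoint hK hz) n fun _ => fst_mem_image_tsupport]
  rw [List.map_cons, ← Multiset.cons_coe, charlierVal_cons, mul_right_comm]

/-- The test functions of the chaos decomposition: an algebra (without unit) of compactly supported
continuous `τ`-integrable functions. Stability under scalars is not required. -/
structure IsTestClass (τ : Measure (X × M)) (D : Set (X × M → ℝ)) : Prop where
  zero_mem : (0 : X × M → ℝ) ∈ D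
  add_mem : ∀ f ∈ D, ∀ g ∈ D, f + g ∈ D
  mul_mem : ∀ f ∈ D, ∀ g ∈ D, (fun z => f z * g z) ∈ D
  hasCompactSupport : ∀ f ∈ D, HasCompactSupport f
  continuous : ∀ f ∈ D, Continuous f
  integrable : ∀ f ∈ D, Integrable f τ

/-- The span of the functions `Q_n(φ^{⊗n}; ·)`, `φ ∈ D`. -/
def charlierSpan (τ : Measure (X × M)) (D : Set (X × M → ℝ)) :
    Submodule ℝ (MarkedConfig X M → ℝ) :=
  Submodule.span ℝ (range fun (q : ℕ × D) ω => charlierQ τ ω q.1 fun _ => q.2.1)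

namespace IsTestClass

variable {τ : Measure (X × M)} {D : Set (X × M → ℝ)} (hD : IsTestClass τ D)
include hD

theorem sum_mem {ι : Type*} (s : Finset ι) {f : ι → X × M → ℝ} (hf : ∀ i, f i ∈ D) :
    ∑ i ∈ s, f i ∈ D :=
  Finset.sum_induction f (· ∈ D) (fun f g hf hg => hD.add_mem f hf g hg) hD.zero_mem fun i _ => hf i

theorem charlierQ_mem_charlierSpan {n : ℕ} {ψ : Fin n → X × M → ℝ} (hψ : ∀ i, ψ i ∈ D) :
    (fun ω => charlierQ τ ω n ψ) ∈ charlierSpan τ D := by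
  have hK : IsCompact (⋃ i, Prod.fst '' tsupport (ψ i)) :=
    isCompact_iUnion fun i => (hD.hasCompactSupport _ (hψ i)).isCompact.image continuous_fst
  have hpol : (fun ω => charlierQ τ ω n ψ) = (n.factorial : ℝ)⁻¹ •
      ∑ S ∈ (Finset.univ : Finset (Fin n)).powerset,
        (-1 : ℝ) ^ ((Finset.univ : Finset (Fin n)).card + S.card) •
          fun ω => charlierQ τ ω n fun _ => ∑ i ∈ S, ψ i := by
    funext ω
    obtain ⟨l, hl⟩ := ω.exists_isListedBy hK
    have h := factorial_mul_charlierQ hl (τ := τ) (ψ := ψ)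
      (fun i _ hz => mem_iUnion.2 ⟨i, fst_mem_image_tsupport hz⟩) fun i => hD.integrable _ (hψ i)
    simp only [Pi.smul_apply, Finset.sum_apply, smul_eq_mul]
    rw [eq_inv_mul_iff_mul_eq₀ (by positivity), h, altSum]
  rw [hpol]
  refine Submodule.smul_mem _ _ (Submodule.sum_mem _ fun S _ => Submodule.smul_mem _ _ ?_)
  exact Submodule.subset_span ⟨(n, ⟨_, hD.sum_mem S hψ⟩), rfl⟩

theorem charlierQ_const_mul_pairing_mem {φ ψ : X × M → ℝ} (hφ : φ ∈ D) (hψ : ψ ∈ D) (n : ℕ) :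
    (fun ω => charlierQ τ ω n (fun _ => ψ) * pairing φ ω) ∈ charlierSpan τ D := by
  have hmem {n : ℕ} {ψ : Fin n → X × M → ℝ} (hψ : ∀ i, ψ i ∈ D) :=
    hD.charlierQ_mem_charlierSpan hψ
  cases n with
  | zero =>
    have h : (fun ω : MarkedConfig X M => charlierQ τ ω 0 (fun _ => ψ) * pairing φ ω)
        = (fun ω => charlierQ τ ω 1 fun _ => φ)
          + (∫ z, φ z ∂τ) • fun ω => charlierQ τ ω 0 fun _ => φ := by
      funext ω
      simp [charlierQ]
    rw [h]
    exact Submodule.add_mem _ (hmem fun _ => hφ) (Submodule.smul_mem _ _ (hmem fun _ => hφ))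
  | succ n =>
    have h : (fun ω : MarkedConfig X M => charlierQ τ ω (n + 1) (fun _ => ψ) * pairing φ ω)
        = (fun ω => charlierQ τ ω (n + 2) (Fin.cons φ fun _ => ψ))
          + (∫ z, φ z ∂τ) • (fun ω => charlierQ τ ω (n + 1) fun _ => ψ)
          + ∑ i : Fin (n + 1), (fun ω => charlierQ τ ω (n + 1)
              (Function.update (fun _ => ψ) i fun z => φ z * ψ z))
          + ∑ _i : Fin (n + 1), (∫ z, φ z * ψ z ∂τ) • (fun ω => charlierQ τ ω n fun _ => ψ) := by
      funext ω
      simp only [Pi.add_apply, Pi.smul_apply, Finset.sum_apply, smul_eq_mul]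
      conv_rhs => rw [charlierQ]
      simp only [Fin.cons_zero, Fin.tail_cons]
      ring
    rw [h]
    refine Submodule.add_mem _ (Submodule.add_mem _ (Submodule.add_mem _ ?_ ?_) ?_) ?_
    · exact hmem (Fin.cases hφ fun _ => hψ)
    · exact Submodule.smul_mem _ _ (hmem fun _ => hψ)
    · refine Submodule.sum_mem _ fun i _ => hmem ?_
      rw [Function.forall_update_iff _ fun _ f => f ∈ D]
      exact ⟨hD.mul_mem _ hφ _ hψ, fun _ _ => hψ⟩
    · exact Submodule.sum_mem _ fun i _ => Submodule.smul_mem _ _ (hmem fun _ => hψ)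

theorem mul_pairing_mem_charlierSpan {φ : X × M → ℝ} (hφ : φ ∈ D) {F : MarkedConfig X M → ℝ}
    (hF : F ∈ charlierSpan τ D) : (fun ω => F ω * pairing φ ω) ∈ charlierSpan τ D := by
  induction hF using Submodule.span_induction with
  | mem F hF =>
    obtain ⟨⟨n, ψ⟩, rfl⟩ := hF
    exact hD.charlierQ_const_mul_pairing_mem hφ ψ.2 n
  | zero =>
    simp only [Pi.zero_apply, zero_mul]
    exact (charlierSpan τ D).zero_mem
  | add F G _ _ hF hG =>
    simp only [Pi.add_apply, add_mul]
    exact Submodule.add_mem _ hF hG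
  | smul a F _ hF =>
    simp only [Pi.smul_apply, smul_eq_mul, mul_assoc]
    exact Submodule.smul_mem _ a hF

theorem polyCylinder_subset_charlierSpan :
    PolyCylinder D ⊆ (charlierSpan τ D : Set (MarkedConfig X M → ℝ)) := by
  rintro F ⟨N, φ, g, hφ, hF⟩
  obtain rfl : F = fun ω => MvPolynomial.eval (fun i => pairing (φ i) ω) g := funext hF
  clear hF
  change _ ∈ charlierSpan τ D
  induction g using MvPolynomial.induction_on with
  | C a =>
    have h : (fun ω : MarkedConfig X M => MvPolynomial.eval (fun i => pairing (φ i) ω)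
        (MvPolynomial.C a)) = a • fun ω => charlierQ τ ω 0 fun _ => 0 := by
      funext ω
      simp [charlierQ]
    rw [h]
    exact Submodule.smul_mem _ _ (hD.charlierQ_mem_charlierSpan fun _ => hD.zero_mem)
  | add p q hp hq =>
    simp only [map_add]
    exact Submodule.add_mem _ hp hq
  | mul_X p i hp =>
    simp only [map_mul, MvPolynomial.eval_X]
    exact hD.mul_pairing_mem_charlierSpan (hφ i) hp

end IsTestClass

end CharlierConfig

/-! ### Measurability on the marked configuration space -/

section Tuples

variable {X M : Type*} [TopologicalSpace X]

theorem countIn_restrict (B : Set (X × M)) (L : Set X) (ω : MarkedConfig X M) :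
    countIn B (ω.restrict L) = countIn (B ∩ L ×ˢ univ) ω := by
  rw [countIn, countIn, MarkedConfig.restrict, inter_assoc, inter_comm B]

theorem pairing_restrict {f : X × M → ℝ} {L : Set X} (hf : ∀ z, f z ≠ 0 → z.1 ∈ L)
    (ω : MarkedConfig X M) : pairing f (ω.restrict L) = pairing f ω :=
  finsum_mem_inter_support_eq' f _ _ fun z hz => and_iff_left ⟨hf z hz, mem_univ z.2⟩

theorem pairing_indicator_one {B : Set (X × M)} {ω : MarkedConfig X M} (h : (ω.1 ∩ B).Finite) :
    pairing (B.indicator 1) ω = countIn B ω := by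
  have hsum : pairing (B.indicator 1) ω = ∑ᶠ z ∈ ω.1 ∩ B, (1 : ℝ) := by
    rw [pairing, ← finsum_mem_inter_support, support_indicator, Pi.one_def,
      Function.support_const one_ne_zero, inter_univ]
    exact finsum_mem_congr rfl fun z hz => indicator_of_mem hz.2 _
  rw [hsum, finsum_mem_eq_finite_toFinset_sum _ h, Finset.sum_const, nsmul_one, countIn,
    ncard_eq_toFinset_card _ h]

theorem ofTuple_val {n : ℕ} {z : Fin n → X × M} (h : Function.Injective fun i => (z i).1) :
    (MarkedConfig.ofTuple n z).1 = range z :=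
  congrArg Subtype.val (dif_pos h)

theorem ofTuple_val_of_not {n : ℕ} {z : Fin n → X × M}
    (h : ¬ Function.Injective fun i => (z i).1) : (MarkedConfig.ofTuple n z).1 = ∅ :=
  congrArg Subtype.val (dif_neg h)

theorem isListedBy_ofTuple {n : ℕ} {z : Fin n → X × M} (h : Function.Injective fun i => (z i).1)
    (K : Set X) : (MarkedConfig.ofTuple n z).IsListedBy K (List.ofFn z) := fun f _ => by
  have hz : Function.Injective z := fun i j hij => h (congrArg Prod.fst hij)
  rw [pairing, ofTuple_val h, finsum_mem_range hz, finsum_eq_sum_of_fintype, List.map_ofFn,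
    List.sum_ofFn]
  rfl

theorem countIn_ofTuple {n : ℕ} {z : Fin n → X × M} (h : Function.Injective fun i => (z i).1)
    (B : Set (X × M)) : countIn B (MarkedConfig.ofTuple n z) = ∑ i, B.indicator 1 (z i) := by
  classical
  have hfin : ((MarkedConfig.ofTuple n z).1 ∩ B).Finite := by
    rw [ofTuple_val h]
    exact (finite_range z).inter_of_left B
  have hB := isListedBy_ofTuple h univ (B.indicator 1) fun z _ => mem_univ z.1
  rw [pairing_indicator_one hfin, List.map_ofFn, List.sum_ofFn] at hB
  simp only [Function.comp_apply, indicator_apply, Pi.one_apply] at hB ⊢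
  exact_mod_cast hB

theorem countIn_ofTuple_le {n : ℕ} (B : Set (X × M)) (z : Fin n → X × M) :
    countIn B (MarkedConfig.ofTuple n z) ≤ n := by
  by_cases h : Function.Injective fun i => (z i).1
  · rw [countIn_ofTuple h]
    exact (Finset.sum_le_sum fun i _ => indicator_le_self B 1 (z i)).trans (by simp)
  · rw [countIn, ofTuple_val_of_not h, empty_inter, ncard_empty]
    exact n.zero_le

theorem countIn_mono (ω : MarkedConfig X M) {L L' : Set X} (h : L ⊆ L')
    (hL' : IsCompact (closure L')) :
    countIn (L ×ˢ univ) ω ≤ countIn (L' ×ˢ univ) ω :=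
  ncard_le_ncard (inter_subset_inter_right _ (prod_mono_left h))
    ((ω.finite_inter hL').subset fun _ hz => ⟨hz.1, subset_closure hz.2.1⟩)

/-- `F` grows at most exponentially in the number of points over some bounded open set. -/
def HasExpBound (F : MarkedConfig X M → ℝ) : Prop :=
  ∃ L : Set X, IsOpen L ∧ IsCompact (closure L) ∧
    ∃ c : ℝ, 0 ≤ c ∧ ∀ ω, |F ω| ≤ Real.exp (c * (countIn (L ×ˢ univ) ω + 1))

theorem HasExpBound.exists_common {F G : MarkedConfig X M → ℝ}
    (hF : HasExpBound F) (hG : HasExpBound G) :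
    ∃ L : Set X, IsOpen L ∧ IsCompact (closure L) ∧ ∃ c : ℝ, 0 ≤ c ∧
      (∀ ω, |F ω| ≤ Real.exp (c * (countIn (L ×ˢ univ) ω + 1))) ∧
      ∀ ω, |G ω| ≤ Real.exp (c * (countIn (L ×ˢ univ) ω + 1)) := by
  obtain ⟨L, hL, hLc, c, hc, h⟩ := hF
  obtain ⟨L', hL', hLc', c', hc', h'⟩ := hG
  have hcl : IsCompact (closure (L ∪ L')) := by
    rw [closure_union]
    exact hLc.union hLc'
  refine ⟨L ∪ L', hL.union hL', hcl, c + c', by positivity, fun ω => (h ω).trans ?_,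
    fun ω => (h' ω).trans ?_⟩
  · gcongr
    · linarith
    · exact countIn_mono ω subset_union_left hcl
  · gcongr
    · linarith
    · exact countIn_mono ω subset_union_right hcl

end Tuples

section Measurability

variable {X M : Type*} [TopologicalSpace X] [MeasurableSpace X] [MeasurableSpace M]

theorem measurable_countIn {B : Set (X × M)} (hB : IsBcMarked B) :
    Measurable (countIn B : MarkedConfig X M → ℕ) :=
  measurable_iff_comap_le.2 (le_iSup₂_of_le B hB le_rfl)

theorem measurable_markedConfig {α : Type*} [MeasurableSpace α] {g : α → MarkedConfig X M}
    (h : ∀ B : Set (X × M), IsBcMarked B → Measurable fun a => countIn B (g a)) :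
    Measurable g := by
  rw [measurable_iff_comap_le, MarkedConfig.instMeasurableSpace]
  simp only [MeasurableSpace.comap_iSup, MeasurableSpace.comap_comp]
  exact iSup₂_le fun B hB => (h B hB).comap_le

theorem IsBc.inter {L K : Set X} (hL : IsBc L) (hK : MeasurableSet K) : IsBc (L ∩ K) :=
  ⟨hL.1.inter hK, hL.2.of_isClosed_subset isClosed_closure (closure_mono inter_subset_left)⟩

theorem IsBcMarked.inter_prod_univ {B : Set (X × M)} (hB : IsBcMarked B) {L : Set X}
    (hL : MeasurableSet L) : IsBcMarked (B ∩ L ×ˢ univ) := by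
  refine ⟨hB.1.inter (hL.prod MeasurableSet.univ), ?_⟩
  rw [prod_univ, image_inter_preimage]
  exact hB.2.inter hL

theorem isBcMarked_prod {L : Set X} (hL : IsBc L) {T : Set M} (hT : MeasurableSet T) :
    IsBcMarked (L ×ˢ T) := by
  refine ⟨hL.1.prod hT, ?_⟩
  rcases T.eq_empty_or_nonempty with rfl | hne
  · rw [prod_empty, image_empty]
    exact ⟨MeasurableSet.empty, by simp⟩
  · rwa [fst_image_prod _ hne]

theorem MarkedConfig.measurable_restrict {L : Set X} (hL : MeasurableSet L) :
    Measurable (MarkedConfig.restrict L : MarkedConfig X M → MarkedConfig X M) := by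
  refine measurable_markedConfig fun B hB => ?_
  simp only [countIn_restrict]
  exact measurable_countIn (hB.inter_prod_univ hL)

/-- The counting measure of the points of `ω` over the compact set `K`. -/
def pointMeasure {K : Set X} (hK : IsCompact K) (ω : MarkedConfig X M) : Measure (X × M) :=
  ∑ z ∈ (ω.finite_inter hK).toFinset, Measure.dirac z

theorem pointMeasure_apply {K : Set X} (hK : IsCompact K) (ω : MarkedConfig X M) {B : Set (X × M)}
    (hB : MeasurableSet B) : pointMeasure hK ω B = countIn (B ∩ K ×ˢ univ) ω := by
  classical
  have hset : ω.1 ∩ (B ∩ K ×ˢ univ)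
      = ((ω.finite_inter hK).toFinset.filter (· ∈ B) : Set (X × M)) := by
    ext z
    simp [and_assoc, and_comm]
  rw [countIn, hset, ncard_coe_finset, pointMeasure, Measure.finsetSum_apply]
  simp [Measure.dirac_apply' _ hB, indicator_apply, Finset.sum_boole]

theorem integral_pointMeasure {K : Set X} (hK : IsCompact K) {f : X × M → ℝ} (hf : Measurable f)
    (hfK : ∀ z, f z ≠ 0 → z.1 ∈ K) (ω : MarkedConfig X M) :
    ∫ z, f z ∂pointMeasure hK ω = pairing f ω := by
  rw [pointMeasure, integral_finsetSum_measure fun z _ =>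
    integrable_dirac' hf.stronglyMeasurable enorm_lt_top]
  simp only [integral_dirac' _ _ hf.stronglyMeasurable]
  exact (ω.pairing_eq_sum hK hfK).symm

theorem measurable_pointMeasure {K : Set X} (hK : IsCompact K) (hKm : IsBc K) :
    Measurable (pointMeasure hK : MarkedConfig X M → Measure (X × M)) := by
  have (ω : MarkedConfig X M) : IsFiniteMeasure (pointMeasure hK ω) := by
    unfold pointMeasure
    infer_instance
  have happly {S : Set X} (hS : MeasurableSet S) {T : Set M} (hT : MeasurableSet T) :
      Measurable fun ω : MarkedConfig X M => pointMeasure hK ω (S ×ˢ T) := by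
    simp only [pointMeasure_apply hK _ (hS.prod hT), prod_inter_prod, inter_univ, inter_comm S]
    exact measurable_from_top.comp (measurable_countIn (isBcMarked_prod (hKm.inter hS) hT))
  refine .measure_of_isPiSystem generateFrom_prod.symm isPiSystem_prod ?_ ?_
  · rintro _ ⟨S, hS, T, hT, rfl⟩
    exact happly hS hT
  · rw [← univ_prod_univ]
    exact happly .univ .univ

theorem measurable_pairing [T2Space X] [BorelSpace X] {f : X × M → ℝ} (hf : Measurable f)
    {K : Set X} (hK : IsCompact K) (hfK : ∀ z, f z ≠ 0 → z.1 ∈ K) :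
    Measurable (pairing f : MarkedConfig X M → ℝ) := by
  have hKm : IsBc K := ⟨hK.measurableSet, hK.closure⟩
  let κ : Kernel (MarkedConfig X M) (X × M) := ⟨pointMeasure hK, measurable_pointMeasure hK hKm⟩
  have h := (hf.stronglyMeasurable.integral_kernel (κ := κ)).measurable
  exact (funext (integral_pointMeasure hK hf hfK)) ▸ h

theorem measurableSet_injective_fst [SecondCountableTopology X] [T2Space X] [BorelSpace X] (n : ℕ) :
    MeasurableSet {z : Fin n → X × M | Function.Injective fun i => (z i).1} := by
  have h : {z : Fin n → X × M | Function.Injective fun i => (z i).1}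
      = ⋂ i, ⋂ j, {z | (z i).1 = (z j).1 → i = j} := by
    ext z
    simp [Function.Injective]
  rw [h]
  refine .iInter fun i => .iInter fun j => .imp ?_ (.const _)
  exact measurableSet_eq_fun (measurable_fst.comp (measurable_pi_apply i))
    (measurable_fst.comp (measurable_pi_apply j))

theorem measurable_ofTuple [SecondCountableTopology X] [T2Space X] [BorelSpace X] (n : ℕ) :
    Measurable (MarkedConfig.ofTuple n : (Fin n → X × M) → MarkedConfig X M) := by
  classical
  refine measurable_markedConfig fun B hB => ?_
  have h : (fun z : Fin n → X × M => countIn B (MarkedConfig.ofTuple n z))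
      = {z | Function.Injective fun i => (z i).1}.indicator
        fun z => ∑ i, B.indicator 1 (z i) := by
    funext z
    by_cases hz : Function.Injective fun i => (z i).1
    · rw [indicator_of_mem hz, countIn_ofTuple hz]
    · rw [indicator_of_notMem hz, countIn, ofTuple_val_of_not hz, empty_inter, ncard_empty]
  rw [h]
  refine (Finset.measurable_sum _ fun i _ => ?_).indicator (measurableSet_injective_fst n)
  exact (measurable_one.indicator hB.1).comp (measurable_pi_apply i)

end Measurability

/-! ### Integrability with respect to the marked Poisson measure -/

section Integrability

variable {X M : Type*} [TopologicalSpace X] [MeasurableSpace X] [MeasurableSpace M]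

/-- The algebra of measurable functions of at most exponential growth, all of which are integrable
for a marked Poisson measure. -/
def expBounded (X M : Type*) [TopologicalSpace X] [MeasurableSpace X] [MeasurableSpace M] :
    Subalgebra ℝ (MarkedConfig X M → ℝ) where
  carrier := {F | Measurable F ∧ HasExpBound F}
  mul_mem' := by
    rintro F G ⟨hF, hF'⟩ ⟨hG, hG'⟩
    obtain ⟨L, hL, hLc, c, hc, h, h'⟩ := hF'.exists_common hG'
    refine ⟨hF.mul hG, L, hL, hLc, c + c, by positivity, fun ω => ?_⟩
    rw [Pi.mul_apply, abs_mul, add_mul, Real.exp_add]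
    exact mul_le_mul (h ω) (h' ω) (abs_nonneg _) (Real.exp_pos _).le
  add_mem' := by
    rintro F G ⟨hF, hF'⟩ ⟨hG, hG'⟩
    obtain ⟨L, hL, hLc, c, hc, h, h'⟩ := hF'.exists_common hG'
    refine ⟨hF.add hG, L, hL, hLc, c + 1, by positivity, fun ω => ?_⟩
    have htwo : (2 : ℝ) ≤ Real.exp (1 * (countIn (L ×ˢ univ) ω + 1)) := by
      have := Real.add_one_le_exp (1 * ((countIn (L ×ˢ univ) ω : ℝ) + 1))
      linarith [(countIn (L ×ˢ univ) ω).cast_nonneg (α := ℝ)]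
    calc |F ω + G ω| ≤ |F ω| + |G ω| := abs_add_le _ _
      _ ≤ Real.exp (c * (countIn (L ×ˢ univ) ω + 1)) * 2 := by linarith [h ω, h' ω]
      _ ≤ Real.exp (c * (countIn (L ×ˢ univ) ω + 1))
          * Real.exp (1 * (countIn (L ×ˢ univ) ω + 1)) := by gcongr
      _ = Real.exp ((c + 1) * (countIn (L ×ˢ univ) ω + 1)) := by rw [← Real.exp_add, add_mul]
  algebraMap_mem' a := by
    refine ⟨measurable_const, ∅, isOpen_empty, by simp, |a|, abs_nonneg a, fun ω => ?_⟩
    have := Real.add_one_le_exp |a|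
    simpa [countIn] using by linarith

theorem pairing_mem_expBounded [LocallyCompactSpace X] [T2Space X] [BorelSpace X]
    {f : X × M → ℝ} (hf : Measurable f) {R : ℝ} (hR : ∀ z, |f z| ≤ R) {K : Set X}
    (hK : IsCompact K) (hfK : ∀ z, f z ≠ 0 → z.1 ∈ K) : pairing f ∈ expBounded X M := by
  obtain ⟨L, hL, hKL, hLc⟩ := exists_isOpen_superset_and_isCompact_closure hK
  refine ⟨measurable_pairing hf hK hfK, L, hL, hLc, |R|, abs_nonneg R, fun ω => ?_⟩
  have hcard : ((ω.finite_inter hK).toFinset.card : ℝ) ≤ countIn (L ×ˢ univ) ω := by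
    rw [← ncard_eq_toFinset_card _ (ω.finite_inter hK), Nat.cast_le, countIn]
    exact ncard_le_ncard (fun z hz => ⟨hz.1, hKL hz.2, mem_univ z.2⟩)
      ((ω.finite_inter hLc).subset fun z hz => ⟨hz.1, subset_closure hz.2.1⟩)
  calc |pairing f ω| ≤ ∑ z ∈ (ω.finite_inter hK).toFinset, |f z| := by
        rw [ω.pairing_eq_sum hK hfK]
        exact Finset.abs_sum_le_sum_abs _ _
    _ ≤ ∑ _z ∈ (ω.finite_inter hK).toFinset, |R| :=
        Finset.sum_le_sum fun z _ => (hR z).trans (le_abs_self R)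
    _ = |R| * (ω.finite_inter hK).toFinset.card := by
        rw [Finset.sum_const, nsmul_eq_mul, mul_comm]
    _ ≤ |R| * (countIn (L ×ˢ univ) ω + 1) := by gcongr; linarith
    _ ≤ Real.exp (|R| * (countIn (L ×ˢ univ) ω + 1)) := by
        linarith [Real.add_one_le_exp (|R| * (countIn (L ×ˢ univ) ω + 1))]

theorem charlierQ_restrict [TopologicalSpace M] (τ : Measure (X × M)) {φ : X × M → ℝ}
    (hφ : HasCompactSupport φ) {L : Set X} (hL : Prod.fst '' tsupport φ ⊆ L)
    (ω : MarkedConfig X M) (n : ℕ) :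
    charlierQ τ (ω.restrict L) n (fun _ => φ) = charlierQ τ ω n (fun _ => φ) := by
  have hK : IsCompact (Prod.fst '' tsupport φ) := hφ.isCompact.image continuous_fst
  obtain ⟨l, hl⟩ := ω.exists_isListedBy hK
  have hl' : (ω.restrict L).IsListedBy (Prod.fst '' tsupport φ) l := fun f hf => by
    rw [pairing_restrict (fun z hz => hL (hf z hz)), hl f hf]
  simp only [charlierQ_const_eq_charlierVal τ hl n fun _ => fst_mem_image_tsupport,
    charlierQ_const_eq_charlierVal τ hl' n fun _ => fst_mem_image_tsupport]

theorem lintegral_exp_countIn_ofTuple_le {τ : Measure (X × M)} {L : Set X}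
    (hτ : τ (L ×ˢ univ) < ∞) {c : ℝ} (hc : 0 ≤ c) (n : ℕ) :
    ∫⁻ z, ENNReal.ofReal (Real.exp (c * countIn (L ×ˢ univ) (MarkedConfig.ofTuple n z)))
        ∂(Measure.pi fun _ : Fin n => τ.restrict (L ×ˢ univ))
      ≤ ENNReal.ofReal ((Real.exp c * (τ (L ×ˢ univ)).toReal) ^ n) := by
  have : IsFiniteMeasure (τ.restrict (L ×ˢ (univ : Set M))) := isFiniteMeasure_restrict.2 hτ.ne
  calc _ ≤ ∫⁻ _, ENNReal.ofReal (Real.exp (c * n))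
        ∂(Measure.pi fun _ : Fin n => τ.restrict (L ×ˢ univ)) := by
        gcongr with z
        exact countIn_ofTuple_le _ z
    _ = ENNReal.ofReal (Real.exp c) ^ n * τ (L ×ˢ univ) ^ n := by
        rw [lintegral_const, Measure.pi_univ, mul_comm c, Real.exp_nat_mul,
          ENNReal.ofReal_pow (Real.exp_pos c).le]
        simp
    _ = _ := by
        rw [mul_pow, ENNReal.ofReal_mul (by positivity), ENNReal.ofReal_pow (Real.exp_pos c).le,
          ENNReal.ofReal_pow ENNReal.toReal_nonneg, ENNReal.ofReal_toReal hτ.ne]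

section Poisson

variable [SecondCountableTopology X] [T2Space X] [BorelSpace X] {τ : Measure (X × M)}

theorem lintegral_poissonIn (τ : Measure (X × M)) (L : Set X) {f : MarkedConfig X M → ℝ≥0∞}
    (hf : Measurable f) : ∫⁻ ω, f ω ∂(poissonIn τ L)
      = ENNReal.ofReal (Real.exp (-(τ (L ×ˢ univ)).toReal)) * ∑' n : ℕ, (n.factorial : ℝ≥0∞)⁻¹ *
        ∫⁻ z, f (MarkedConfig.ofTuple n z)
          ∂(Measure.pi fun _ : Fin n => τ.restrict (L ×ˢ univ)) := by
  simp only [poissonIn, lintegral_smul_measure, lintegral_sum_measure, smul_eq_mul,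
    lintegral_map hf (measurable_ofTuple _)]

theorem integrable_exp_poissonIn {L : Set X} (hL : IsBc L) (hτ : τ (L ×ˢ univ) < ∞) {c : ℝ}
    (hc : 0 ≤ c) :
    Integrable (fun ω : MarkedConfig X M => Real.exp (c * countIn (L ×ˢ univ) ω))
      (poissonIn τ L) := by
  have hm : Measurable fun ω : MarkedConfig X M => Real.exp (c * countIn (L ×ˢ univ) ω) :=
    Real.measurable_exp.comp
      ((measurable_from_top.comp (measurable_countIn (isBcMarked_prod hL .univ))).const_mul c)
  refine ⟨hm.aestronglyMeasurable, ?_⟩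
  rw [hasFiniteIntegral_iff_ofReal (ae_of_all _ fun ω => (Real.exp_pos _).le),
    lintegral_poissonIn _ _ hm.ennreal_ofReal]
  refine ENNReal.mul_lt_top ENNReal.ofReal_lt_top ?_
  have hle (n : ℕ) : (n.factorial : ℝ≥0∞)⁻¹ * ∫⁻ z, ENNReal.ofReal (Real.exp
      (c * countIn (L ×ˢ univ) (MarkedConfig.ofTuple n z)))
        ∂(Measure.pi fun _ : Fin n => τ.restrict (L ×ˢ univ))
      ≤ ENNReal.ofReal ((Real.exp c * (τ (L ×ˢ univ)).toReal) ^ n / n.factorial) := by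
    rw [div_eq_inv_mul, ENNReal.ofReal_mul (by positivity),
      ENNReal.ofReal_inv_of_pos (by positivity), ENNReal.ofReal_natCast]
    gcongr
    exact lintegral_exp_countIn_ofTuple_le hτ hc n
  refine (ENNReal.tsum_le_tsum hle).trans_lt ?_
  rw [← ENNReal.ofReal_tsum_of_nonneg (fun n => by positivity)
    (Real.summable_pow_div_factorial _)]
  exact ENNReal.ofReal_lt_top

variable {π : Measure (MarkedConfig X M)} (hπ : IsMarkedPoisson τ π)
include hπ

theorem integrable_of_mem_expBounded (hfin : ∀ L : Set X, IsBc L → τ (L ×ˢ univ) < ∞)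
    {F : MarkedConfig X M → ℝ} (hF : F ∈ expBounded X M) : Integrable F π := by
  obtain ⟨hm, L, hL, hLc, c, hc, hbound⟩ := hF
  have hLbc : IsBc L := ⟨hL.measurableSet, hLc⟩
  have hexp := integrable_exp_poissonIn hLbc (hfin L hLbc) hc
  rw [← hπ.2 L hL hLc] at hexp
  have hexp' := hexp.comp_measurable (MarkedConfig.measurable_restrict hL.measurableSet)
  simp only [Function.comp_def, countIn_restrict, inter_self] at hexp'
  refine (hexp'.const_mul (Real.exp c)).mono' hm.aestronglyMeasurable (ae_of_all _ fun ω => ?_)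
  rw [← Real.exp_add, ← mul_one_add, add_comm 1]
  exact hbound ω

theorem memLp_two_of_mem_expBounded (hfin : ∀ L : Set X, IsBc L → τ (L ×ˢ univ) < ∞)
    {F : MarkedConfig X M → ℝ} (hF : F ∈ expBounded X M) : MemLp F 2 π := by
  rw [memLp_two_iff_integrable_sq hF.1.aestronglyMeasurable]
  exact integrable_of_mem_expBounded hπ hfin (pow_mem hF 2)

theorem hasSum_integral_markedPoisson {L : Set X} (hL : IsOpen L) (hLc : IsCompact (closure L))
    {G : MarkedConfig X M → ℝ} (hG : Measurable G) (hint : Integrable G π)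
    (hres : ∀ ω, G (ω.restrict L) = G ω) :
    HasSum (fun n : ℕ => Real.exp (-(τ (L ×ˢ univ)).toReal) * ((n.factorial : ℝ)⁻¹ *
      ∫ z, G (MarkedConfig.ofTuple n z) ∂(Measure.pi fun _ : Fin n => τ.restrict (L ×ˢ univ))))
      (∫ ω, G ω ∂π) := by
  have hr := MarkedConfig.measurable_restrict (M := M) hL.measurableSet
  have hmap : ∫ ω, G ω ∂π = ∫ ω, G ω ∂(poissonIn τ L) := by
    rw [← hπ.2 L hL hLc, integral_map hr.aemeasurable hG.aestronglyMeasurable]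
    simp only [hres]
  have hint' : Integrable G (poissonIn τ L) := by
    rw [← hπ.2 L hL hLc, integrable_map_measure hG.aestronglyMeasurable hr.aemeasurable]
    exact hint.congr (ae_of_all _ fun ω => (hres ω).symm)
  rw [poissonIn, integrable_smul_measure (ENNReal.ofReal_pos.2 (Real.exp_pos _)).ne'
    ENNReal.ofReal_ne_top] at hint'
  rw [hmap, poissonIn, integral_smul_measure, ENNReal.toReal_ofReal (Real.exp_pos _).le]
  refine ((hasSum_integral_measure hint').mul_left _).congr_fun fun n => ?_
  rw [integral_smul_measure, integral_map (measurable_ofTuple n).aemeasurable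
    hG.aestronglyMeasurable]
  simp

end Poisson

theorem IsTestClass.pairing_mem_expBounded [LocallyCompactSpace X] [T2Space X] [BorelSpace X]
    [TopologicalSpace M] [OpensMeasurableSpace (X × M)] {τ : Measure (X × M)}
    {D : Set (X × M → ℝ)} (hD : IsTestClass τ D) {f : X × M → ℝ} (hf : f ∈ D) :
    pairing f ∈ expBounded X M := by
  have hfc := hD.hasCompactSupport f hf
  obtain ⟨R, hR⟩ := hfc.exists_bound_of_continuous (hD.continuous f hf)
  exact _root_.pairing_mem_expBounded (hD.continuous f hf).measurable hR
    (hfc.isCompact.image continuous_fst) fun _ => fst_mem_image_tsupport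

theorem IsTestClass.charlierQ_mem_expBounded [LocallyCompactSpace X] [T2Space X] [BorelSpace X]
    [TopologicalSpace M] [OpensMeasurableSpace (X × M)] {τ : Measure (X × M)}
    {D : Set (X × M → ℝ)} (hD : IsTestClass τ D) {n : ℕ} {φ : Fin n → X × M → ℝ}
    (hφ : ∀ i, φ i ∈ D) : (fun ω => charlierQ τ ω n φ) ∈ expBounded X M := by
  have hconst (a : ℝ) : (fun _ => a) ∈ expBounded X M := Subalgebra.algebraMap_mem _ a
  have hsum {n : ℕ} {F : Fin n → MarkedConfig X M → ℝ} (hF : ∀ i, F i ∈ expBounded X M) :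
      (fun ω => ∑ i, F i ω) ∈ expBounded X M := by
    rw [← Finset.sum_fn]
    exact Subalgebra.sum_mem _ fun i _ => hF i
  induction n using Nat.strong_induction_on with
  | _ n ih =>
    match n, ih with
    | 0, _ => exact hconst 1
    | 1, _ => exact sub_mem (hD.pairing_mem_expBounded (hφ 0)) (hconst _)
    | n + 2, ih =>
      have ht (i) : Fin.tail φ i ∈ D := hφ i.succ
      refine sub_mem (sub_mem
        (Subalgebra.mul_mem _ (ih (n + 1) (by omega) ht)
          (sub_mem (hD.pairing_mem_expBounded (hφ 0)) (hconst _)))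
        (hsum fun i => ih (n + 1) (by omega) ?_))
        (hsum fun i => Subalgebra.mul_mem _ (hconst _) (ih n (by omega) fun j => ht _))
      exact (Function.forall_update_iff _ fun _ (f : X × M → ℝ) => f ∈ D).2
        ⟨hD.mul_mem _ (hφ 0) _ (ht i), fun j _ => ht j⟩

end Integrability

/-! ### Orthogonality of the Charlier polynomials -/

section Tuples

variable {Z : Type*}

/-- The `n`-th Charlier polynomial of `φ` at the configuration with the points `z₀, …, z_{N-1}`,
with `a` in place of the integral of `φ`. -/
def charlierTuple (a : ℝ) (φ : Z → ℝ) (n : ℕ) {N : ℕ} (z : Fin N → Z) : ℝ :=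
  charlierVal a (Finset.univ.val.map fun i => φ (z i)) n

theorem charlierTuple_removeNth (a : ℝ) (φ : Z → ℝ) (n : ℕ) {N : ℕ} (z : Fin (N + 1) → Z)
    (i : Fin (N + 1)) :
    charlierTuple a φ n z = charlierTuple a φ n (i.removeNth z)
      + n * φ (z i) * charlierTuple a φ (n - 1) (i.removeNth z) := by
  rw [charlierTuple, fin_univ_val_map _ i, charlierVal_cons]
  rfl

theorem charlierTuple_succ (a : ℝ) (φ : Z → ℝ) (n : ℕ) {N : ℕ} (z : Fin (N + 1) → Z) :
    charlierTuple a φ (n + 1) z = -a * charlierTuple a φ n z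
      + ∑ i, φ (z i) * charlierTuple a φ n (i.removeNth z) :=
  charlierVal_succ a (fun i => φ (z i)) n

theorem exists_abs_charlierTuple_le {φ : Z → ℝ} {R : ℝ} (hφR : ∀ z, |φ z| ≤ R) (a : ℝ) (N n : ℕ) :
    ∃ C, ∀ z : Fin N → Z, |charlierTuple a φ n z| ≤ C := by
  have hbox : IsCompact (univ.pi fun _ : Fin N => Icc (-R) R) :=
    isCompact_univ_pi fun _ => isCompact_Icc
  obtain ⟨C, hC⟩ := hbox.exists_bound_of_continuousOn (continuous_charlierVal a N n).continuousOn
  exact ⟨C, fun z => hC (fun i => φ (z i)) fun i _ => abs_le.1 (hφR _)⟩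

variable [MeasurableSpace Z]

theorem measurable_charlierTuple {φ : Z → ℝ} (hφ : Measurable φ) (a : ℝ) (N n : ℕ) :
    Measurable fun z : Fin N → Z => charlierTuple a φ n z :=
  (continuous_charlierVal a N n).measurable.comp
    (measurable_pi_lambda _ fun i => hφ.comp (measurable_pi_apply i))

/-- The integral over `N`-point configurations of the product of the `n`-th and `m`-th Charlier
polynomials of `φ` and `ψ`, with `a` and `b` in place of the integrals of `φ` and `ψ`. -/
def charlierMoment (μ : Measure Z) (a b : ℝ) (φ ψ : Z → ℝ) (N n m : ℕ) : ℝ :=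
  ∫ z : Fin N → Z, charlierTuple a φ n z * charlierTuple b ψ m z ∂(Measure.pi fun _ => μ)

theorem charlierMoment_zero_succ (μ : Measure Z) (a b : ℝ) (φ ψ : Z → ℝ) (n m : ℕ) :
    charlierMoment μ a b φ ψ 0 (n + 1) m = -a * charlierMoment μ a b φ ψ 0 n m := by
  have hz (c : ℝ) (f : Z → ℝ) (k : ℕ) (z : Fin 0 → Z) : charlierTuple c f k z = (-c) ^ k :=
    charlierVal_nil c k
  simp only [charlierMoment, hz, pow_succ', mul_assoc, integral_const_mul]

variable (μ : Measure Z)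

/-- The finite-volume form of the Mecke formula. -/
theorem integrable_and_integral_comp_removeNth [SigmaFinite μ] {N : ℕ} (i : Fin (N + 1))
    {f : Z × (Fin N → Z) → ℝ} (hf : Integrable f (μ.prod (Measure.pi fun _ => μ))) :
    Integrable (fun z : Fin (N + 1) → Z => f (z i, i.removeNth z)) (Measure.pi fun _ => μ) ∧
    ∫ z : Fin (N + 1) → Z, f (z i, i.removeNth z) ∂(Measure.pi fun _ => μ)
      = ∫ q, f q ∂(μ.prod (Measure.pi fun _ => μ)) :=
  have h := measurePreserving_piFinSuccAbove (fun _ : Fin (N + 1) => μ) i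
  ⟨h.integrable_comp_of_integrable hf, h.integral_comp' f⟩

section Bounded

variable [IsFiniteMeasure μ] {φ ψ : Z → ℝ} (hφ : Measurable φ) (hψ : Measurable ψ) {R R' : ℝ}
  (hφR : ∀ z, |φ z| ≤ R) (hψR : ∀ z, |ψ z| ≤ R')
include hφ hψ hφR hψR

theorem integrable_charlierTuple_mul (a b : ℝ) (N n m : ℕ) :
    Integrable (fun z : Fin N → Z => charlierTuple a φ n z * charlierTuple b ψ m z)
      (Measure.pi fun _ => μ) := by
  obtain ⟨C, hC⟩ := exists_abs_charlierTuple_le hφR a N n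
  obtain ⟨C', hC'⟩ := exists_abs_charlierTuple_le hψR b N m
  exact (Integrable.of_bound (measurable_charlierTuple hφ a N n).aestronglyMeasurable C
    (ae_of_all _ hC)).mul_bdd (measurable_charlierTuple hψ b N m).aestronglyMeasurable
    (ae_of_all _ hC')

theorem integrable_and_integral_mul_charlierTuple_removeNth (a b : ℝ) {N : ℕ} (i : Fin (N + 1))
    (n m : ℕ) :
    Integrable (fun z : Fin (N + 1) → Z =>
      φ (z i) * charlierTuple a φ n (i.removeNth z) * charlierTuple b ψ m z)
      (Measure.pi fun _ => μ) ∧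
    ∫ z : Fin (N + 1) → Z, φ (z i) * charlierTuple a φ n (i.removeNth z) * charlierTuple b ψ m z
        ∂(Measure.pi fun _ => μ)
      = (∫ z, φ z ∂μ) * charlierMoment μ a b φ ψ N n m
        + m * (∫ z, φ z * ψ z ∂μ) * charlierMoment μ a b φ ψ N n (m - 1) := by
  have hφi : Integrable φ μ := Integrable.of_bound hφ.aestronglyMeasurable R (ae_of_all _ hφR)
  have hφψ : Integrable (fun z => φ z * ψ z) μ :=
    hφi.mul_bdd hψ.aestronglyMeasurable (ae_of_all _ hψR)
  have hprod := integrable_charlierTuple_mul μ hφ hψ hφR hψR a b N n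
  let f (q : Z × (Fin N → Z)) : ℝ := φ q.1 * (charlierTuple a φ n q.2 * charlierTuple b ψ m q.2)
  let g (q : Z × (Fin N → Z)) : ℝ := φ q.1 * ψ q.1 *
    (m * (charlierTuple a φ n q.2 * charlierTuple b ψ (m - 1) q.2))
  have hf : Integrable f (μ.prod (Measure.pi fun _ => μ)) := hφi.mul_prod (hprod m)
  have hg : Integrable g (μ.prod (Measure.pi fun _ => μ)) :=
    hφψ.mul_prod ((hprod (m - 1)).const_mul _)
  have hfg : (fun z : Fin (N + 1) → Z =>
      φ (z i) * charlierTuple a φ n (i.removeNth z) * charlierTuple b ψ m z)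
      = fun z => (f + g) (z i, i.removeNth z) := by
    funext z
    rw [charlierTuple_removeNth b ψ m z i]
    simp only [f, g, Pi.add_apply]
    ring
  rw [hfg]
  refine (integrable_and_integral_comp_removeNth μ i (hf.add hg)).imp id fun h => h.trans ?_
  rw [integral_add' hf hg, integral_prod_mul φ fun y : Fin N → Z =>
      charlierTuple a φ n y * charlierTuple b ψ m y,
    integral_prod_mul (fun z => φ z * ψ z) fun y : Fin N → Z =>
      m * (charlierTuple a φ n y * charlierTuple b ψ (m - 1) y), integral_const_mul]
  simp only [charlierMoment]
  ring

theorem charlierMoment_succ (a b : ℝ) (N n m : ℕ) :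
    charlierMoment μ a b φ ψ (N + 1) (n + 1) m
      = -a * charlierMoment μ a b φ ψ (N + 1) n m
        + (N + 1) * ((∫ z, φ z ∂μ) * charlierMoment μ a b φ ψ N n m
          + m * (∫ z, φ z * ψ z ∂μ) * charlierMoment μ a b φ ψ N n (m - 1)) := by
  have hterm (i : Fin (N + 1)) :=
    integrable_and_integral_mul_charlierTuple_removeNth μ hφ hψ hφR hψR a b i n m
  calc charlierMoment μ a b φ ψ (N + 1) (n + 1) m
      = ∫ z : Fin (N + 1) → Z, (-a * (charlierTuple a φ n z * charlierTuple b ψ m z)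
          + ∑ i, φ (z i) * charlierTuple a φ n (i.removeNth z) * charlierTuple b ψ m z)
          ∂(Measure.pi fun _ => μ) :=
        integral_congr_ae (ae_of_all _ fun z => by
          simp only [charlierTuple_succ, add_mul, Finset.sum_mul, mul_assoc])
    _ = _ := by
        rw [integral_add
          ((integrable_charlierTuple_mul μ hφ hψ hφR hψR a b (N + 1) n m).const_mul _)
          (integrable_finsetSum _ fun i _ => (hterm i).1), integral_const_mul,
          integral_finsetSum _ fun i _ => (hterm i).1, Finset.sum_congr rfl fun i _ => (hterm i).2,
          Finset.sum_const, Finset.card_fin, nsmul_eq_mul, Nat.cast_succ]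
        rfl

end Bounded

end Tuples

section InjectiveTuples

variable {X M : Type*} [MeasurableSpace X] [MeasurableSpace M] [MeasurableEq X]

theorem ae_fst_ne {μ : Measure (X × M)} [SigmaFinite μ]
    (hμ : ∀ x, μ (Prod.fst ⁻¹' {x}) = 0) {N : ℕ} {i j : Fin N} (hij : i ≠ j) :
    ∀ᵐ z ∂(Measure.pi fun _ : Fin N => μ), (z i).1 ≠ (z j).1 := by
  cases N with
  | zero => exact i.elim0
  | succ N =>
    obtain ⟨k, rfl⟩ := Fin.exists_succAbove_eq hij.symm
    have hs : MeasurableSet {q : (X × M) × (Fin N → X × M) | q.1.1 = (q.2 k).1} :=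
      measurableSet_eq_fun (measurable_fst.comp measurable_fst)
        (measurable_fst.comp ((measurable_pi_apply k).comp measurable_snd))
    have h0 : (μ.prod (Measure.pi fun _ : Fin N => μ))
        {q : (X × M) × (Fin N → X × M) | q.1.1 = (q.2 k).1} = 0 := by
      rw [Measure.prod_apply_symm hs]
      exact lintegral_eq_zero_of_ae_eq_zero (ae_of_all _ fun y => hμ (y k).1)
    have hmp := measurePreserving_piFinSuccAbove (fun _ : Fin (N + 1) => μ) i
    exact measure_mono_null (fun z hz => not_not.1 hz)
      ((hmp.measure_preimage hs.nullMeasurableSet).trans h0)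

theorem ae_injective_fst {μ : Measure (X × M)} [SigmaFinite μ]
    (hμ : ∀ x, μ (Prod.fst ⁻¹' {x}) = 0) (N : ℕ) :
    ∀ᵐ z ∂(Measure.pi fun _ : Fin N => μ), Function.Injective fun i => (z i).1 := by
  have h : ∀ᵐ z ∂(Measure.pi fun _ : Fin N => μ), ∀ i j, i ≠ j → (z i).1 ≠ (z j).1 :=
    ae_all_iff.2 fun i => ae_all_iff.2 fun j =>
      eventually_imp_distrib_left.2 (ae_fst_ne hμ)
  filter_upwards [h] with z hz i j
  exact not_imp_not.1 (hz i j)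

end InjectiveTuples

/-- The Poisson expectation with weights `E / N!` of the recursion `u = -a v + N (a v + w)` of
`N`-point integrals: the two terms in `a` cancel after a shift of the summation index. -/
theorem eq_of_hasSum_factorial {u v w : ℕ → ℝ} {a E U V W : ℝ} (h0 : u 0 = -a * v 0)
    (hsucc : ∀ N : ℕ, u (N + 1) = -a * v (N + 1) + (N + 1) * (a * v N + w N))
    (hU : HasSum (fun N : ℕ => E * ((N.factorial : ℝ)⁻¹ * u N)) U)
    (hV : HasSum (fun N : ℕ => E * ((N.factorial : ℝ)⁻¹ * v N)) V)
    (hW : HasSum (fun N : ℕ => E * ((N.factorial : ℝ)⁻¹ * w N)) W) : U = W := by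
  have hshift : HasSum (fun N : ℕ => E * (((N + 1).factorial : ℝ)⁻¹ * u (N + 1))
      + a * (E * (((N + 1).factorial : ℝ)⁻¹ * v (N + 1)))) (a * V + W) := by
    refine ((hV.mul_left a).add hW).congr_fun fun N => ?_
    rw [hsucc, Nat.factorial_succ]
    push_cast
    field_simp
    ring
  rw [hasSum_nat_add_iff (f := fun N : ℕ => E * ((N.factorial : ℝ)⁻¹ * u N)
      + a * (E * ((N.factorial : ℝ)⁻¹ * v N))) 1] at hshift
  have hsum := (hU.add (hV.mul_left a)).unique hshift
  simp only [Finset.sum_range_one, h0] at hsum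
  linarith

section Orthogonality

variable {X M : Type*} [TopologicalSpace X] [MeasurableSpace X] [MeasurableSpace M]

theorem charlierQ_ofTuple (τ : Measure (X × M)) {N : ℕ} {z : Fin N → X × M}
    (hz : Function.Injective fun i => (z i).1) (φ : X × M → ℝ) (n : ℕ) :
    charlierQ τ (MarkedConfig.ofTuple N z) n (fun _ => φ)
      = charlierTuple (∫ z, φ z ∂τ) φ n z := by
  rw [charlierQ_const_eq_charlierVal τ (isListedBy_ofTuple hz univ) n fun _ _ => trivial,
    List.map_ofFn, charlierTuple, Fin.univ_val_map]
  rfl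

variable [SecondCountableTopology X] [T2Space X] [BorelSpace X] [LocallyCompactSpace X]
  [TopologicalSpace M] [OpensMeasurableSpace (X × M)] {τ : Measure (X × M)}
  (hfin : ∀ L : Set X, IsBc L → τ (L ×ˢ univ) < ∞) (hnull : ∀ x, τ (Prod.fst ⁻¹' {x}) = 0)
  {π : Measure (MarkedConfig X M)} (hπ : IsMarkedPoisson τ π) {D : Set (X × M → ℝ)}
  (hD : IsTestClass τ D) {φ ψ : X × M → ℝ} (hφ : φ ∈ D) (hψ : ψ ∈ D)
include hfin hnull hπ hD hφ hψ

theorem hasSum_integral_charlierQ_mul {L : Set X} (hL : IsOpen L) (hLc : IsCompact (closure L))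
    (hφL : Prod.fst '' tsupport φ ⊆ L) (hψL : Prod.fst '' tsupport ψ ⊆ L) (n m : ℕ) :
    HasSum (fun N : ℕ => Real.exp (-(τ (L ×ˢ univ)).toReal) * ((N.factorial : ℝ)⁻¹ *
      charlierMoment (τ.restrict (L ×ˢ univ)) (∫ z, φ z ∂τ) (∫ z, ψ z ∂τ) φ ψ N n m))
      (∫ ω, charlierQ τ ω n (fun _ => φ) * charlierQ τ ω m (fun _ => ψ) ∂π) := by
  let μ := τ.restrict (L ×ˢ (univ : Set M))
  have : IsFiniteMeasure μ := ⟨by simpa [μ] using hfin L ⟨hL.measurableSet, hLc⟩⟩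
  have hμ (x) : μ (Prod.fst ⁻¹' {x}) = 0 := Measure.absolutelyContinuous_restrict (hnull x)
  have hmem : (fun ω => charlierQ τ ω n (fun _ => φ) * charlierQ τ ω m (fun _ => ψ))
      ∈ expBounded X M :=
    Subalgebra.mul_mem _ (hD.charlierQ_mem_expBounded fun _ => hφ)
      (hD.charlierQ_mem_expBounded fun _ => hψ)
  refine (hasSum_integral_markedPoisson hπ hL hLc hmem.1
    (integrable_of_mem_expBounded hπ hfin hmem) fun ω => ?_).congr_fun fun N => ?_
  · simp only [charlierQ_restrict τ (hD.hasCompactSupport φ hφ) hφL,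
      charlierQ_restrict τ (hD.hasCompactSupport ψ hψ) hψL]
  · congr 2
    refine integral_congr_ae ?_
    filter_upwards [ae_injective_fst hμ N] with z hz
    rw [charlierQ_ofTuple τ hz, charlierQ_ofTuple τ hz]

theorem integral_charlierQ_succ_mul (n m : ℕ) :
    ∫ ω, charlierQ τ ω (n + 1) (fun _ => φ) * charlierQ τ ω m (fun _ => ψ) ∂π
      = m * (∫ z, φ z * ψ z ∂τ) *
        ∫ ω, charlierQ τ ω n (fun _ => φ) * charlierQ τ ω (m - 1) (fun _ => ψ) ∂π := by
  have hφc := hD.hasCompactSupport φ hφ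
  have hψc := hD.hasCompactSupport ψ hψ
  obtain ⟨L, hL, hsub, hLc⟩ := exists_isOpen_superset_and_isCompact_closure
    ((hφc.isCompact.image (continuous_fst (X := X) (Y := M))).union
      (hψc.isCompact.image (continuous_fst (X := X) (Y := M))))
  have hφL : Prod.fst '' tsupport φ ⊆ L := subset_union_left.trans hsub
  have hψL : Prod.fst '' tsupport ψ ⊆ L := subset_union_right.trans hsub
  let μ := τ.restrict (L ×ˢ (univ : Set M))
  have : IsFiniteMeasure μ := ⟨by simpa [μ] using hfin L ⟨hL.measurableSet, hLc⟩⟩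
  have hφz (z) (hz : z ∉ L ×ˢ (univ : Set M)) : φ z = 0 :=
    not_not.1 fun h => hz ⟨hφL (fst_mem_image_tsupport h), trivial⟩
  have hφμ : ∫ z, φ z ∂μ = ∫ z, φ z ∂τ := setIntegral_eq_integral_of_forall_compl_eq_zero hφz
  have hφψμ : ∫ z, φ z * ψ z ∂μ = ∫ z, φ z * ψ z ∂τ :=
    setIntegral_eq_integral_of_forall_compl_eq_zero fun z hz => by rw [hφz z hz, zero_mul]
  obtain ⟨R, hR⟩ := hφc.exists_bound_of_continuous (hD.continuous φ hφ)
  obtain ⟨R', hR'⟩ := hψc.exists_bound_of_continuous (hD.continuous ψ hψ)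
  have hsum := hasSum_integral_charlierQ_mul hfin hnull hπ hD hφ hψ hL hLc hφL hψL
  have hsum' := (hsum n (m - 1)).mul_left (m * ∫ z, φ z * ψ z ∂τ)
  simp only [mul_left_comm (m * ∫ z, φ z * ψ z ∂τ)] at hsum'
  refine eq_of_hasSum_factorial (charlierMoment_zero_succ μ _ _ φ ψ n m) (fun N => ?_)
    (hsum (n + 1) m) (hsum n m) hsum'
  rw [charlierMoment_succ μ (hD.continuous φ hφ).measurable (hD.continuous ψ hψ).measurable
    hR hR', hφμ, hφψμ]

theorem integral_charlierQ_mul (n m : ℕ) :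
    ∫ ω, charlierQ τ ω n (fun _ => φ) * charlierQ τ ω m (fun _ => ψ) ∂π
      = if n = m then (n.factorial : ℝ) * (∫ z, φ z * ψ z ∂τ) ^ n else 0 := by
  have := hπ.1
  induction n generalizing m with
  | zero =>
    cases m with
    | zero => simp [charlierQ]
    | succ m =>
      simp only [mul_comm (charlierQ τ _ 0 _)]
      simp [integral_charlierQ_succ_mul hfin hnull hπ hD hψ hφ]
  | succ n ih =>
    rw [integral_charlierQ_succ_mul hfin hnull hπ hD hφ hψ]
    cases m with
    | zero => simp
    | succ m =>
      rw [Nat.add_sub_cancel, ih]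
      rcases eq_or_ne n m with rfl | h
      · rw [if_pos rfl, if_pos rfl, Nat.factorial_succ]
        push_cast
        ring
      · rw [if_neg h, if_neg (by omega), mul_zero]

end Orthogonality

/-! ### The gradient and the second quantized operator on cylinder functions -/

theorem sum_smul_mk_mem {ι E F : Type*} [AddCommGroup E] [Module ℝ E] [AddCommGroup F]
    [Module ℝ F] {G : Submodule ℝ (E × F)} (s : Finset ι) (c : ι → ℝ) {f : ι → E} {g : ι → F}
    (h : ∀ i, (f i, g i) ∈ G) : (∑ i ∈ s, c i • f i, ∑ i ∈ s, c i • g i) ∈ G := by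
  simpa only [Prod.smul_mk, prod_mk_sum] using
    G.sum_mem (t := s) fun i _ => G.smul_mem (c i) (h i)

theorem mem_graph_imageOperator {H K : Type*} [NormedAddCommGroup H] [InnerProductSpace ℝ H]
    [NormedAddCommGroup K] [InnerProductSpace ℝ K] (U : H →ₗᵢ[ℝ] K) {L : H →ₗ.[ℝ] H} {x : H × H}
    (hx : x ∈ L.graph) : (U x.1, U x.2) ∈ (imageOperator U.toLinearMap L).graph := by
  rw [imageOperator, Submodule.toLinearPMap_graph_eq]
  · exact ⟨x, hx, rfl⟩
  · rintro _ ⟨y, hy, rfl⟩ hUy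
    have hy₁ : y.1 = 0 := U.injective (hUy.trans (map_zero U).symm)
    exact (congrArg U (L.graph_fst_eq_zero_snd hy hy₁)).trans (map_zero U)

theorem MarkedConfig.countable_image_fst {X M : Type*} [TopologicalSpace X] [SigmaCompactSpace X]
    (ω : MarkedConfig X M) : (Prod.fst '' ω.1).Countable := by
  rw [← inter_univ (Prod.fst '' ω.1), ← iUnion_compactCovering X, inter_iUnion]
  exact countable_iUnion fun n => (ω.2.2 _ (isCompact_compactCovering X n)).countable

theorem ae_fst_notMem {X M : Type*} [TopologicalSpace X] [SigmaCompactSpace X] [MeasurableSpace X]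
    [MeasurableSpace M] {τ : Measure (X × M)} (hnull : ∀ x, τ (Prod.fst ⁻¹' {x}) = 0)
    (ω : MarkedConfig X M) : ∀ᵐ z ∂τ, z.1 ∉ Prod.fst '' ω.1 := by
  have h : τ (Prod.fst ⁻¹' (Prod.fst '' ω.1)) = 0 := by
    rw [← biUnion_of_singleton (Prod.fst '' ω.1), preimage_iUnion₂]
    exact (measure_biUnion_null_iff ω.countable_image_fst).2 fun x _ => hnull x
  exact measure_mono_null (fun z hz => not_not.1 hz) h

section CharlierSum

variable {X M : Type*} [TopologicalSpace X] [TopologicalSpace M] [MeasurableSpace X]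
  [MeasurableSpace M] {τ : Measure (X × M)} {D : Set (X × M → ℝ)}

/-- The linear combination of the functions `ω ↦ Q_n(φ^{⊗n}; ω)` with coefficients `c (n, φ)`. -/
def charlierSum (τ : Measure (X × M)) (c : ℕ × D →₀ ℝ) (ω : MarkedConfig X M) : ℝ :=
  ∑ q ∈ c.support, c q * charlierQ τ ω q.1 fun _ => q.2.1

/-- The coefficient of `φ` in the gradient at `ω` of the term with index `(n, φ)` of
`charlierSum τ c`. -/
def gradCoeff (τ : Measure (X × M)) (c : ℕ × D →₀ ℝ) (ω : MarkedConfig X M) (q : ℕ × D) : ℝ :=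
  c q * (q.1 * charlierQ τ ω (q.1 - 1) fun _ => q.2.1)

theorem IsTestClass.memLp_two (hD : IsTestClass τ D) {φ : X × M → ℝ} (hφ : φ ∈ D) :
    MemLp φ 2 τ := by
  rw [memLp_two_iff_integrable_sq (hD.integrable φ hφ).aestronglyMeasurable]
  simpa only [sq] using hD.integrable _ (hD.mul_mem φ hφ φ hφ)

theorem IsTestClass.exists_eq_charlierSum [T2Space X] [LocallyCompactSpace X]
    (hD : IsTestClass τ D) {F : MarkedConfig X M → ℝ} (hF : F ∈ PolyCylinder D) :
    ∃ c : ℕ × D →₀ ℝ, F = charlierSum τ c := by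
  obtain ⟨c, rfl⟩ := Finsupp.mem_span_range_iff_exists_finsupp.1
    (hD.polyCylinder_subset_charlierSpan hF)
  exact ⟨c, funext fun ω => by simp [Finsupp.sum, charlierSum]⟩

section Gradient

variable [SigmaCompactSpace X] (hD : IsTestClass τ D) (hnull : ∀ x, τ (Prod.fst ⁻¹' {x}) = 0)
  (c : ℕ × D →₀ ℝ) (ω : MarkedConfig X M)
include hD hnull

theorem gradMP_charlierSum_ae :
    (fun z => ∑ q ∈ c.support, gradCoeff τ c ω q * q.2.1 z) =ᵐ[τ] gradMP (charlierSum τ c) ω := by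
  filter_upwards [ae_fst_notMem hnull ω] with z hz
  rw [gradMP, charlierSum, charlierSum, ← Finset.sum_sub_distrib]
  refine Finset.sum_congr rfl fun q _ => ?_
  rw [charlierQ_const_addPoint τ (hD.hasCompactSupport _ q.2.2) ω hz, gradCoeff]
  ring

theorem memLp_gradMP_charlierSum : MemLp (gradMP (charlierSum τ c) ω) 2 τ :=
  (memLp_finsetSum _ fun q _ => (hD.memLp_two q.2.2).const_mul (gradCoeff τ c ω q)).ae_eq
    (gradMP_charlierSum_ae hD hnull c ω)

theorem toL2_gradMP_charlierSum :
    toL2 τ (gradMP (charlierSum τ c) ω) = ∑ q ∈ c.support, gradCoeff τ c ω q • toL2 τ q.2.1 := by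
  rw [← toL2_congr (gradMP_charlierSum_ae hD hnull c ω)]
  exact toL2_sum_smul c.support (gradCoeff τ c ω) fun q => hD.memLp_two q.2.2

theorem mem_graph_gradMP_charlierSum {A : Lp ℝ 2 τ →ₗ.[ℝ] Lp ℝ 2 τ} {a : D → Lp ℝ 2 τ}
    (ha : ∀ φ : D, (toL2 τ φ.1, a φ) ∈ A.graph) :
    (toL2 τ (gradMP (charlierSum τ c) ω), ∑ q ∈ c.support, gradCoeff τ c ω q • a q.2)
      ∈ A.graph := by
  rw [toL2_gradMP_charlierSum hD hnull]
  exact sum_smul_mk_mem _ _ fun q => ha q.2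

theorem inner_gradMP_charlierSum (e : ℕ × D →₀ ℝ) (a : D → Lp ℝ 2 τ) :
    inner ℝ (toL2 τ (gradMP (charlierSum τ c) ω)) (∑ q ∈ e.support, gradCoeff τ e ω q • a q.2)
      = ∑ q ∈ c.support, ∑ q' ∈ e.support,
        c q * e q' * (q.1 * q'.1 * inner ℝ (toL2 τ q.2.1) (a q'.2)) *
          (charlierQ τ ω (q.1 - 1) (fun _ => q.2.1) *
            charlierQ τ ω (q'.1 - 1) fun _ => q'.2.1) := by
  rw [toL2_gradMP_charlierSum hD hnull, sum_inner]
  refine Finset.sum_congr rfl fun q _ => (inner_sum _ _ _).trans ?_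
  refine Finset.sum_congr rfl fun q' _ => ?_
  rw [real_inner_smul_left, real_inner_smul_right, gradCoeff, gradCoeff]
  ring

end Gradient

end CharlierSum

section Formula

variable {X M : Type*} [TopologicalSpace X] [MeasurableSpace X] [MeasurableSpace M]
  [T2Space X] [BorelSpace X] [LocallyCompactSpace X]
  [TopologicalSpace M] [OpensMeasurableSpace (X × M)]
  {τ : Measure (X × M)} {D : Set (X × M → ℝ)} {π : Measure (MarkedConfig X M)}

theorem charlierSum_mem_expBounded (hD : IsTestClass τ D) (c : ℕ × D →₀ ℝ) :
    charlierSum τ c ∈ expBounded X M := by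
  have h := Subalgebra.sum_mem (expBounded X M) (t := c.support)
    (f := fun q ω => c q * charlierQ τ ω q.1 fun _ => q.2.1) fun q _ =>
    Subalgebra.smul_mem _ (hD.charlierQ_mem_expBounded fun _ => q.2.2) (c q)
  rwa [Finset.sum_fn] at h

variable [SecondCountableTopology X] (hfin : ∀ L : Set X, IsBc L → τ (L ×ˢ univ) < ∞)
  (hπ : IsMarkedPoisson τ π) (hD : IsTestClass τ D)
include hfin hπ hD

theorem memLp_two_charlierQ {φ : X × M → ℝ} (hφ : φ ∈ D) (n : ℕ) :
    MemLp (fun ω => charlierQ τ ω n fun _ => φ) 2 π :=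
  memLp_two_of_mem_expBounded hπ hfin (hD.charlierQ_mem_expBounded fun _ => hφ)

theorem toL2_charlierSum {U : Fock τ →ₗᵢ[ℝ] Lp ℝ 2 π}
    (hU : ∀ n, ∀ φ ∈ D, U (fockPow τ n (toL2 τ φ)) = toL2 π fun ω => charlierQ τ ω n fun _ => φ)
    (c : ℕ × D →₀ ℝ) :
    toL2 π (charlierSum τ c) = U (∑ q ∈ c.support, c q • fockPow τ q.1 (toL2 τ q.2.1)) := by
  rw [map_sum, Finset.sum_congr rfl fun q _ => by rw [map_smul, hU _ _ q.2.2]]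
  exact toL2_sum_smul c.support c fun q => memLp_two_charlierQ hfin hπ hD q.2.2 q.1

theorem mem_graph_hamiltonianMP [SigmaFinite τ] {U : Fock τ →ₗᵢ[ℝ] Lp ℝ 2 π}
    (hchaos : chaosMap D τ π = U.toLinearMap)
    (hU : ∀ n, ∀ φ ∈ D, U (fockPow τ n (toL2 τ φ)) = toL2 π fun ω => charlierQ τ ω n fun _ => φ)
    {A : Lp ℝ 2 τ →ₗ.[ℝ] Lp ℝ 2 τ} (hA : IsPosSelfAdjoint A) {a : D → Lp ℝ 2 τ}
    (ha : ∀ φ : D, (toL2 τ φ.1, a φ) ∈ A.graph) (c : ℕ × D →₀ ℝ) :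
    (toL2 π (charlierSum τ c),
      U (∑ q ∈ c.support, c q • fockPowDeriv τ q.1 (toL2 τ q.2.1, a q.2)))
      ∈ (hamiltonianMP D τ π A).graph := by
  have h := sum_smul_mk_mem (G := (dExp τ A).graph) c.support c fun q : ℕ × D =>
    fockPow_fockPowDeriv_mem_graph_dExp τ hA q.1 (ha q.2)
  rw [hamiltonianMP, hchaos, toL2_charlierSum hfin hπ hD hU]
  exact mem_graph_imageOperator U h

variable [SigmaFinite τ] (hnull : ∀ x, τ (Prod.fst ⁻¹' {x}) = 0)
include hnull

theorem exists_chaosMap_eq (hdense : DenseRange fun φ : D => toL2 τ φ.1) :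
    ∃ U : Fock τ →ₗᵢ[ℝ] Lp ℝ 2 π, chaosMap D τ π = U.toLinearMap ∧ ∀ n, ∀ φ ∈ D,
      U (fockPow τ n (toL2 τ φ)) = toL2 π fun ω => charlierQ τ ω n fun _ => φ := by
  have h : ∃ U : Fock τ →ₗᵢ[ℝ] Lp ℝ 2 π, ∀ n, ∀ φ ∈ D,
      U (fockPow τ n (toL2 τ φ)) = toL2 π fun ω => charlierQ τ ω n fun _ => φ := by
    obtain ⟨U, hU⟩ := exists_linearIsometry_apply_eq_of_gram_eq
      (w := fun q : ℕ × D => toL2 π fun ω => charlierQ τ ω q.1 fun _ => q.2.1)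
      (topologicalClosure_span_fockPow τ hdense) <| Matrix.ext fun q q' => by
        rw [Matrix.gram_apply, Matrix.gram_apply,
          inner_toL2 (memLp_two_charlierQ hfin hπ hD q.2.2 q.1)
            (memLp_two_charlierQ hfin hπ hD q'.2.2 q'.1),
          integral_charlierQ_mul hfin hnull hπ hD q.2.2 q'.2.2,
          inner_fockPow, inner_toL2 (hD.memLp_two q.2.2) (hD.memLp_two q'.2.2)]
    exact ⟨U, fun n φ hφ => hU (n, ⟨φ, hφ⟩)⟩
  exact ⟨h.choose, by rw [chaosMap, dif_pos h], h.choose_spec⟩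

theorem inner_fockPowDeriv_fockPow_eq_integral {φ ψ : X × M → ℝ} (hφ : φ ∈ D) (hψ : ψ ∈ D)
    (n m : ℕ) (f : Lp ℝ 2 τ) :
    inner ℝ (fockPowDeriv τ n (toL2 τ φ, f)) (fockPow τ m (toL2 τ ψ))
      = n * m * inner ℝ f (toL2 τ ψ) *
        ∫ ω, charlierQ τ ω (n - 1) (fun _ => φ) * charlierQ τ ω (m - 1) (fun _ => ψ) ∂π := by
  rw [inner_fockPowDeriv_fockPow, integral_charlierQ_mul hfin hnull hπ hD hφ hψ,
    inner_toL2 (hD.memLp_two hφ) (hD.memLp_two hψ)]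
  cases n with
  | zero => simp
  | succ n =>
    cases m with
    | zero => simp
    | succ m =>
      rcases eq_or_ne n m with rfl | h
      · simp only [if_pos, Nat.add_sub_cancel, Nat.factorial_succ]
        push_cast
        ring
      · rw [if_neg (by omega), Nat.add_sub_cancel, Nat.add_sub_cancel, if_neg h, mul_zero]

theorem integrable_and_inner_hamiltonianMP_charlierSum
    (hdense : DenseRange fun φ : D => toL2 τ φ.1) {A : Lp ℝ 2 τ →ₗ.[ℝ] Lp ℝ 2 τ}
    (hA : IsPosSelfAdjoint A) {a : D → Lp ℝ 2 τ} (ha : ∀ φ : D, (toL2 τ φ.1, a φ) ∈ A.graph)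
    (c e : ℕ × D →₀ ℝ) {G : Lp ℝ 2 π}
    (hG : (toL2 π (charlierSum τ c), G) ∈ (hamiltonianMP D τ π A).graph)
    {g : MarkedConfig X M → Lp ℝ 2 τ}
    (hg : ∀ ω, (toL2 τ (gradMP (charlierSum τ e) ω), g ω) ∈ A.graph) :
    Integrable (fun ω => inner ℝ (toL2 τ (gradMP (charlierSum τ c) ω)) (g ω)) π ∧
      inner ℝ G (toL2 π (charlierSum τ e))
        = ∫ ω, inner ℝ (toL2 τ (gradMP (charlierSum τ c) ω)) (g ω) ∂π := by
  obtain ⟨U, hchaos, hU⟩ := exists_chaosMap_eq hfin hπ hD hnull hdense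
  have hG_eq := LinearPMap.mem_graph_snd_inj _ hG
    (mem_graph_hamiltonianMP hfin hπ hD hchaos hU hA ha c) rfl
  have hg_eq := fun ω => LinearPMap.mem_graph_snd_inj _ (hg ω)
    (mem_graph_gradMP_charlierSum hD hnull e ω ha) rfl
  have hint : ∀ q q' : ℕ × D, Integrable (fun ω =>
      c q * e q' * (q.1 * q'.1 * inner ℝ (toL2 τ q.2.1) (a q'.2)) *
        (charlierQ τ ω (q.1 - 1) (fun _ => q.2.1) *
          charlierQ τ ω (q'.1 - 1) fun _ => q'.2.1)) π := fun q q' =>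
    (integrable_of_mem_expBounded hπ hfin <| Subalgebra.mul_mem _
      (hD.charlierQ_mem_expBounded fun _ => q.2.2)
      (hD.charlierQ_mem_expBounded fun _ => q'.2.2)).const_mul _
  simp only [hg_eq, inner_gradMP_charlierSum hD hnull]
  refine ⟨integrable_finsetSum _ fun q _ => integrable_finsetSum _ fun q' _ => hint q q', ?_⟩
  rw [integral_finsetSum _ fun q _ => integrable_finsetSum _ fun q' _ => hint q q', hG_eq,
    toL2_charlierSum hfin hπ hD hU, U.inner_map_map, sum_inner]
  refine Finset.sum_congr rfl fun q _ => ?_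
  rw [integral_finsetSum _ fun q' _ => hint q q', inner_sum]
  refine Finset.sum_congr rfl fun q' _ => ?_
  rw [real_inner_smul_left, real_inner_smul_right, integral_const_mul,
    inner_fockPowDeriv_fockPow_eq_integral hfin hπ hD hnull q.2.2 q'.2.2,
    hA.inner_comm_of_mem_graph (ha q.2) (ha q'.2)]
  ring

end Formula

section FiniteOnStrips

variable {X M : Type*} [TopologicalSpace X] [T2Space X] [MeasurableSpace X] [BorelSpace X]
  [MeasurableSpace M] {τ : Measure (X × M)}
  (hfin : ∀ L : Set X, IsBc L → τ (L ×ˢ univ) < ∞)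
include hfin

theorem measure_prod_univ_lt_top_of_isCompact {K : Set X} (hK : IsCompact K) :
    τ (K ×ˢ univ) < ∞ :=
  hfin K ⟨hK.measurableSet, hK.isClosed.closure_eq.symm ▸ hK⟩

variable [LocallyCompactSpace X]

theorem sigmaFinite_of_finite_strips [SecondCountableTopology X] : SigmaFinite τ := by
  refine ⟨⟨⟨fun n => compactCovering X n ×ˢ univ, fun _ => trivial, fun n => ?_, ?_⟩⟩⟩
  · exact measure_prod_univ_lt_top_of_isCompact hfin (isCompact_compactCovering X n)
  · rw [← iUnion_prod_const, iUnion_compactCovering, univ_prod_univ]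

theorem isLocallyFiniteMeasure_of_finite_strips [TopologicalSpace M] :
    IsLocallyFiniteMeasure τ := by
  refine ⟨fun z => ?_⟩
  obtain ⟨K, hK, hzK⟩ := exists_compact_mem_nhds z.1
  exact ⟨K ×ˢ univ, prod_mem_nhds hzK univ_mem, measure_prod_univ_lt_top_of_isCompact hfin hK⟩

end FiniteOnStrips

/-! ### Test functions on manifolds -/

section Manifolds

/-- The set `TestFun d k X M` as a linear subspace of the space of all functions. -/
def testFunSubmodule (d k : ℕ) (X M : Type*) [TopologicalSpace X] [TopologicalSpace M]
    [ChartedSpace (EuclideanSpace ℝ (Fin d)) X] [ChartedSpace (EuclideanSpace ℝ (Fin k)) M] :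
    Submodule ℝ (X × M → ℝ) where
  carrier := TestFun d k X M
  zero_mem' := ⟨contMDiff_const, HasCompactSupport.zero⟩
  add_mem' hf hg := ⟨hf.1.add hg.1, hf.2.add hg.2⟩
  smul_mem' r _ hf := ⟨(contMDiff_const (c := r)).mul hf.1, hf.2.smul_left (f := fun _ => r)⟩

variable {d k : ℕ} {X M : Type*} [TopologicalSpace X] [TopologicalSpace M]
  [ChartedSpace (EuclideanSpace ℝ (Fin d)) X] [ChartedSpace (EuclideanSpace ℝ (Fin k)) M]
  [MeasurableSpace X] [MeasurableSpace M] [OpensMeasurableSpace (X × M)]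
  {τ : Measure (X × M)} [IsLocallyFiniteMeasure τ]

theorem isTestClass_testFun : IsTestClass τ (TestFun d k X M) where
  zero_mem := (testFunSubmodule d k X M).zero_mem
  add_mem _ hf _ hg := (testFunSubmodule d k X M).add_mem hf hg
  mul_mem _ hf _ hg := ⟨hf.1.mul hg.1, hf.2.mul_right⟩
  hasCompactSupport _ hf := hf.2
  continuous _ hf := hf.1.continuous
  integrable _ hf := hf.1.continuous.integrable_of_hasCompactSupport hf.2

theorem memLp_two_testFun (φ : testFunSubmodule d k X M) : MemLp φ.1 2 τ :=
  isTestClass_testFun.memLp_two φ.2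

variable (d k τ) in
/-- The map from the test functions to `L²(τ)`. -/
def toL2TestFun : testFunSubmodule d k X M →ₗ[ℝ] Lp ℝ 2 τ where
  toFun φ := toL2 τ φ.1
  map_add' φ ψ := by
    rw [toL2_of_memLp (memLp_two_testFun φ), toL2_of_memLp (memLp_two_testFun ψ),
      toL2_of_memLp (memLp_two_testFun (φ + ψ))]
    exact MemLp.toLp_add (memLp_two_testFun φ) (memLp_two_testFun ψ)
  map_smul' r φ := by
    rw [toL2_of_memLp (memLp_two_testFun φ), toL2_of_memLp (memLp_two_testFun (r • φ))]
    exact MemLp.toLp_const_smul r (memLp_two_testFun φ)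

end Manifolds

section Density

variable {d k : ℕ} {X M : Type*}
  [TopologicalSpace X] [T2Space X] [SecondCountableTopology X]
  [ChartedSpace (EuclideanSpace ℝ (Fin d)) X]
  [IsManifold (𝓡 d) ((⊤ : ℕ∞) : WithTop ℕ∞) X] [MeasurableSpace X] [BorelSpace X]
  [TopologicalSpace M] [T2Space M] [SecondCountableTopology M]
  [ChartedSpace (EuclideanSpace ℝ (Fin k)) M]
  [IsManifold (𝓡 k) ((⊤ : ℕ∞) : WithTop ℕ∞) M] [MeasurableSpace M] [BorelSpace M]
  {τ : Measure (X × M)} [IsLocallyFiniteMeasure τ]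

theorem eq_zero_of_inner_toL2_testFun_eq_zero {f : Lp ℝ 2 τ}
    (hf : ∀ φ ∈ TestFun d k X M, inner ℝ (toL2 τ φ) f = 0) : f = 0 := by
  have := ChartedSpace.locallyCompactSpace (EuclideanSpace ℝ (Fin d)) X
  have := ChartedSpace.locallyCompactSpace (EuclideanSpace ℝ (Fin k)) M
  refine Lp.eq_zero_iff_ae_eq_zero.2 ?_
  refine ae_eq_zero_of_integral_contMDiff_smul_eq_zero ((𝓡 d).prod (𝓡 k))
    ((Lp.memLp f).locallyIntegrable one_le_two) fun φ hφ hφc => ?_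
  have h := hf φ ⟨hφ, hφc⟩
  rwa [← toL2_coeFn f, inner_toL2 (isTestClass_testFun.memLp_two ⟨hφ, hφc⟩) (Lp.memLp f)] at h

theorem denseRange_toL2_testFun : DenseRange fun φ : TestFun d k X M => toL2 τ φ.1 := by
  have h : (toL2TestFun d k τ).range.topologicalClosure = ⊤ := by
    rw [Submodule.topologicalClosure_eq_top_iff, Submodule.eq_bot_iff]
    exact fun f hf => eq_zero_of_inner_toL2_testFun_eq_zero fun φ hφ =>
      (Submodule.mem_orthogonal _ _).1 hf _ ⟨⟨φ, hφ⟩, rfl⟩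
  exact Submodule.dense_iff_topologicalClosure_eq_top.2 h

end Density

theorem compProd_preimage_fst_singleton {X M : Type*} [MeasurableSpace X]
    [MeasurableSingletonClass X] [MeasurableSpace M] (σ : Measure X) [SFinite σ]
    [NullSingletonClass σ] (p : Kernel X M) [IsSFiniteKernel p] (x : X) :
    (σ.compProd p) (Prod.fst ⁻¹' {x}) = 0 := by
  have h := Measure.compProd_apply_prod (μ := σ) (κ := p) (measurableSet_singleton x) .univ
  rwa [Measure.restrict_eq_zero.2 (measure_singleton x), lintegral_zero_measure, prod_univ] at h

theorem theorem6p1_general {X M : Type*}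
    [TopologicalSpace X] [T2Space X] [SecondCountableTopology X] [LocallyCompactSpace X]
    [MeasurableSpace X] [BorelSpace X]
    [TopologicalSpace M] [MeasurableSpace M] [OpensMeasurableSpace (X × M)]
    {τ : Measure (X × M)} (hfin : ∀ L : Set X, IsBc L → τ (L ×ˢ univ) < ∞)
    (hnull : ∀ x, τ (Prod.fst ⁻¹' {x}) = 0)
    {π : Measure (MarkedConfig X M)} (hπ : IsMarkedPoisson τ π)
    {D : Set (X × M → ℝ)} (hD : IsTestClass τ D) (hdense : DenseRange fun φ : D => toL2 τ φ.1)
    {A : Lp ℝ 2 τ →ₗ.[ℝ] Lp ℝ 2 τ} (hA : IsSelfAdjoint A)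
    (hApos : ∀ f : A.domain, 0 ≤ inner ℝ (f : Lp ℝ 2 τ) (A f))
    (hAdom : ∀ φ ∈ D, toL2 τ φ ∈ A.domain) :
    (∀ F ∈ PolyCylinder D, MemLp F 2 π ∧ ∀ ω, MemLp (gradMP F ω) 2 τ) ∧
    ∃ (hdom : ∀ F ∈ PolyCylinder D, toL2 π F ∈ (hamiltonianMP D τ π A).domain)
      (hgrad : ∀ F ∈ PolyCylinder D, ∀ ω, toL2 τ (gradMP F ω) ∈ A.domain),
      ∀ (F₁ : MarkedConfig X M → ℝ) (hF₁ : F₁ ∈ PolyCylinder D)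
        (F₂ : MarkedConfig X M → ℝ) (hF₂ : F₂ ∈ PolyCylinder D),
        Integrable (fun ω => inner ℝ (toL2 τ (gradMP F₁ ω))
          (A ⟨toL2 τ (gradMP F₂ ω), hgrad F₂ hF₂ ω⟩)) π ∧
        inner ℝ (hamiltonianMP D τ π A ⟨toL2 π F₁, hdom F₁ hF₁⟩) (toL2 π F₂) =
          ∫ ω, inner ℝ (toL2 τ (gradMP F₁ ω))
            (A ⟨toL2 τ (gradMP F₂ ω), hgrad F₂ hF₂ ω⟩) ∂π := by
  have := sigmaFinite_of_finite_strips hfin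
  have hA' := IsPosSelfAdjoint.of_domain hA hApos
  have ha : ∀ φ : D, (toL2 τ φ.1, A ⟨toL2 τ φ.1, hAdom φ.1 φ.2⟩) ∈ A.graph :=
    fun φ => A.mem_graph ⟨_, hAdom φ.1 φ.2⟩
  obtain ⟨U, hchaos, hU⟩ := exists_chaosMap_eq hfin hπ hD hnull hdense
  refine ⟨fun F hF => ?_, fun F hF => ?_, fun F hF ω => ?_, fun F₁ hF₁ F₂ hF₂ => ?_⟩
  · obtain ⟨c, rfl⟩ := hD.exists_eq_charlierSum hF
    exact ⟨memLp_two_of_mem_expBounded hπ hfin (charlierSum_mem_expBounded hD c),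
      memLp_gradMP_charlierSum hD hnull c⟩
  · obtain ⟨c, rfl⟩ := hD.exists_eq_charlierSum hF
    exact LinearPMap.mem_domain_of_mem_graph
      (mem_graph_hamiltonianMP hfin hπ hD hchaos hU hA' ha c)
  · obtain ⟨c, rfl⟩ := hD.exists_eq_charlierSum hF
    exact LinearPMap.mem_domain_of_mem_graph (mem_graph_gradMP_charlierSum hD hnull c ω ha)
  · obtain ⟨c, rfl⟩ := hD.exists_eq_charlierSum hF₁
    obtain ⟨e, rfl⟩ := hD.exists_eq_charlierSum hF₂
    exact integrable_and_inner_hamiltonianMP_charlierSum hfin hπ hD hnull hdense hA' ha c e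
      (LinearPMap.mem_graph _ ⟨_, _⟩) fun ω => A.mem_graph ⟨_, _⟩

end

theorem theorem6p1
    {d k : ℕ} {X M : Type*}
    [TopologicalSpace X] [T2Space X] [SecondCountableTopology X]
    [ChartedSpace (EuclideanSpace ℝ (Fin d)) X]
    [IsManifold (𝓡 d) ((⊤ : ℕ∞) : WithTop ℕ∞) X]
    [MeasurableSpace X] [BorelSpace X]
    [TopologicalSpace M] [T2Space M] [SecondCountableTopology M]
    [ChartedSpace (EuclideanSpace ℝ (Fin k)) M]
    [IsManifold (𝓡 k) ((⊤ : ℕ∞) : WithTop ℕ∞) M]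
    [MeasurableSpace M] [BorelSpace M]
    (σ : Measure X) [IsLocallyFiniteMeasure σ] [NullSingletonClass σ]
    (p : Kernel X M) [IsSFiniteKernel p]
    (τ : Measure (X × M)) (hτ : τ = σ.compProd p)
    (hfin : ∀ L : Set X, IsBc L → τ (L ×ˢ univ) < ∞)
    (π : Measure (MarkedConfig X M)) (hπ : IsMarkedPoisson τ π)
    (A : Lp ℝ 2 τ →ₗ.[ℝ] Lp ℝ 2 τ) (hA : IsSelfAdjoint A)
    (hApos : ∀ f : A.domain, 0 ≤ inner ℝ (f : Lp ℝ 2 τ) (A f))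
    (hAdom : ∀ φ ∈ TestFun d k X M, toL2 τ φ ∈ A.domain) :
    -- the functions below define elements of `L²`, so that `toL2` is their class
    (∀ F ∈ PolyCylinder (TestFun d k X M), MemLp F 2 π ∧ ∀ ω, MemLp (gradMP F ω) 2 τ) ∧
    -- both sides of the formula are meaningful
    ∃ (hdom : ∀ F ∈ PolyCylinder (TestFun d k X M),
        toL2 π F ∈ (hamiltonianMP (TestFun d k X M) τ π A).domain)
      (hgrad : ∀ F ∈ PolyCylinder (TestFun d k X M), ∀ ω,
        toL2 τ (gradMP F ω) ∈ A.domain),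
      ∀ (F₁ : MarkedConfig X M → ℝ) (hF₁ : F₁ ∈ PolyCylinder (TestFun d k X M))
        (F₂ : MarkedConfig X M → ℝ) (hF₂ : F₂ ∈ PolyCylinder (TestFun d k X M)),
        Integrable (fun ω => inner ℝ (toL2 τ (gradMP F₁ ω))
          (A ⟨toL2 τ (gradMP F₂ ω), hgrad F₂ hF₂ ω⟩)) π ∧
        inner ℝ (hamiltonianMP (TestFun d k X M) τ π A ⟨toL2 π F₁, hdom F₁ hF₁⟩) (toL2 π F₂) =
          ∫ ω, inner ℝ (toL2 τ (gradMP F₁ ω))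
            (A ⟨toL2 τ (gradMP F₂ ω), hgrad F₂ hF₂ ω⟩) ∂π := by
  have := ChartedSpace.locallyCompactSpace (EuclideanSpace ℝ (Fin d)) X
  have := isLocallyFiniteMeasure_of_finite_strips hfin
  exact theorem6p1_general hfin (fun x => hτ ▸ compProd_preimage_fst_singleton σ p x) hπ
    isTestClass_testFun denseRange_toL2_testFun hA hApos hAdom
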